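/- Let $k$ be a perfect field of characteristic $p>0$, let $W(k)$ be its ring of Witt vectors with Frobenius $\sigma$, and let $A$ be an Artinian local $W(k)$-algebra with residue field $k$. Let $\tilde G$ be a group scheme over $W(k)$; put $G=\tilde G\otimes_{W(k)}k$, $G_A=\tilde G\otimes_{W(k)}A$, $\tilde G'=\tilde G\otimes_{W(k),\sigma}W(k)$, $G'_A=\tilde G'\otimes_{W(k)}A$, and let $G'$ be the Frobenius twist of $G$, which is canonically the special fibre of $G'_A$. Assume that the Frobenius of $G$ lifts over $A$, i.e. that there is a homomorphism of group schemes $F_{G,A}\colon G_A\to G'_A$ over $A$ whose restriction to the special fibres is the relative Frobenius $F_{G/k}\colon G\to G'$. Let $X$ be a scheme over $k$, with absolute Frobenius $F_X$, and let $X_A$ be a deformation of $X$ over $A$, i.e. a flat $A$-scheme with an identification $X_A\otimes_A k\cong X$. By a principal $G$-bundle $P\to X$ we mean a scheme $P$ over $X$ with a $G$-action over $X$ which is simply transitive on the points of $P$ over each point of $X$ (with values in any scheme) and such that $P\to X$ has sections fppf-locally on $X$. Then: 1. For every principal $G$-bundle $P\to X$ and every principal $G_A$-bundle $P_A\to X_A$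 lifting it (that is, $P_A|_X\cong P$ as $G$-bundles), there exists a principal $G'_A$-bundle $P'_A\to X_A$ lifting the $G'$-bundle $F_X^*P\to X$. 2. For every $n\ge 0$, every homomorphism $\tilde\pi\colon\tilde G\to \mathrm{GL}_{n,W(k)}$ and every vector bundle $\mathscr E_A$ of rank $n$ on $X_A$ which admits a reduction of structure group along $\pi_A\colon G_A\to \mathrm{GL}_{n,A}$ (that is, a principal $G_A$-bundle on $X_A$ with a $\pi_A$-equivariant morphism over $X_A$ to the frame bundle of $\mathscr E_A$), the Frobenius pullback $F_X^*\mathscr E$ of $\mathscr E=\mathscr E_A|_X$ lifts over $A$: there is a vector bundle $\mathscr E'_A$ of rank $n$ on $X_A$ with $\mathscr E'_A|_X\cong F_X^*\mathscr E$. -/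

import Mathlib

open CategoryTheory AlgebraicGeometry Limits Opposite
open scoped MonoidalCategory CartesianMonoidalCategory MonObj CategoryTheory.Obj

universe u
noncomputable section

namespace FrobBundle

/-- The `p`-th power map on a commutative ring in which the prime `p` vanishes. -/
def powHom (p : ℕ) [hp : Fact p.Prime] (R : Type u) [CommRing R] (h : (p : R) = 0) : R →+* R where
  toFun x := x ^ p
  map_one' := one_pow p
  map_mul' x y := mul_pow x y p
  map_zero' := zero_pow hp.out.ne_zero
  map_add' x y := by
    obtain ⟨r, hr⟩ := exists_add_pow_prime_eq hp.out x y
    simp [hr, h]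

theorem natCast_eq_zero_of_ringHom (p : ℕ) {R S : Type u} [CommRing R] [CommRing S] (f : R →+* S)
    (h : (p : R) = 0) : (p : S) = 0 := by
  rw [← map_natCast f, h, map_zero]

theorem natCast_section (p : ℕ) (X : Scheme.{u}) (h : (p : Γ(X, ⊤)) = 0) (U : X.Opens) :
    (p : Γ(X, U)) = 0 :=
  natCast_eq_zero_of_ringHom p (X.presheaf.map (homOfLE le_top).op).hom h

/-- The absolute Frobenius of a scheme in which the prime `p` vanishes: the identity on the
underlying space and `x ↦ x ^ p` on sections. -/
def absFrobenius (p : ℕ) [Fact p.Prime] (X : Scheme.{u}) (h : (p : Γ(X, ⊤)) = 0) : X ⟶ X :=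
  Scheme.Hom.mk
    { base := 𝟙 _
      c := { app := fun U => CommRingCat.ofHom (powHom p Γ(X, U.unop) (natCast_section p X h U.unop))
             naturality := by
              intro U V i
              ext x
              exact (map_pow (X.presheaf.map i).hom x p).symm }
      prop := by
        intro x
        refine ⟨fun a ha => ?_⟩
        obtain ⟨U, hxU, s, rfl⟩ := TopCat.Presheaf.exists_germ_eq X.presheaf a
        rw [PresheafedSpace.stalkMap_germ_apply] at ha
        have e : X.presheaf.germ U x hxU (s ^ p) = X.presheaf.germ U x hxU s ^ p :=
          map_pow (X.presheaf.germ U x hxU).hom s p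
        exact (isUnit_pow_iff (Fact.out : p.Prime).ne_zero).1 (e ▸ ha) }

theorem absFrobenius_app (p : ℕ) [Fact p.Prime] (X : Scheme.{u}) (h : (p : Γ(X, ⊤)) = 0)
   (U : X.Opens) (x : Γ(X, U)) : (absFrobenius p X h).app U x = x ^ p := rfl



theorem absFrobenius_comp {p : ℕ} [Fact p.Prime] {k : Type u} [Field k] [CharP k p]
    (X : Over (Spec (.of k))) (h : (p : Γ(X.left, ⊤)) = 0) :
    absFrobenius p X.left h ≫ X.hom =
      X.hom ≫ Spec.map (CommRingCat.ofHom (frobenius k p)) := by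
  apply ext_of_isAffine
  rw [Scheme.Hom.comp_appTop, Scheme.Hom.comp_appTop]
  ext x
  obtain ⟨y, rfl⟩ := (Scheme.ΓSpecIso (.of k)).commRingCatIsoToRingEquiv.symm.surjective x
  have e : (Spec.map (CommRingCat.ofHom (frobenius k p))).appTop.hom
      ((Scheme.ΓSpecIso (.of k)).inv.hom y) = (Scheme.ΓSpecIso (.of k)).inv.hom (y ^ p) :=
    congr($(Scheme.ΓSpecIso_inv_naturality (CommRingCat.ofHom (frobenius k p))).hom y).symm
  change (X.hom.appTop.hom ((Scheme.ΓSpecIso (.of k)).inv.hom y)) ^ p = X.hom.appTop.hom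
    ((Spec.map (CommRingCat.ofHom (frobenius k p))).appTop.hom
      ((Scheme.ΓSpecIso (.of k)).inv.hom y))
  rw [e, map_pow, map_pow]

variable {S S' : Scheme.{u}}

/-! ### Base change of group schemes and the general linear group -/

/-- A morphism over `S'` into the base change of `G` along `f : S' ⟶ S`, seen as a morphism
over `S` into `G`. -/
def transpose (f : S' ⟶ S) {G : Over S} {T : Over S'} (g : T ⟶ (Over.pullback f).obj G) :
    (Over.map f).obj T ⟶ G :=
  ((Over.mapPullbackAdj f).homEquiv T G).symm g

theorem transpose_mul (f : S' ⟶ S) {G : Over S} [GrpObj G] {T : Over S'}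
    (g h : T ⟶ (Over.pullback f).obj G) :
    transpose f (g * h) = transpose f g * transpose f h := by
  apply ((Over.mapPullbackAdj f).homEquiv T G).injective
  have e (x : T ⟶ (Over.pullback f).obj G) :
      (Over.mapPullbackAdj f).unit.app T ≫ (Over.pullback f).map (transpose f x) = x :=
    (Adjunction.homEquiv_unit ..).symm.trans (Equiv.apply_symm_apply _ _)
  rw [transpose, Equiv.apply_symm_apply, Adjunction.homEquiv_unit, Hom.mul_def, Hom.mul_def,
    Functor.map_comp]
  conv_lhs => rw [← e g, ← e h]
  rw [← CartesianMonoidalCategory.comp_lift, Category.assoc]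
  congr 1
  exact Functor.Monoidal.lift_μ_assoc (Over.pullback f) _ _ _

theorem transpose_one (f : S' ⟶ S) {G : Over S} [GrpObj G] {T : Over S'} :
    transpose f (1 : T ⟶ (Over.pullback f).obj G) = 1 :=
  (MonoidHom.mk' (transpose f (G := G) (T := T)) (transpose_mul f)).map_one

theorem transpose_comp (f : S' ⟶ S) {G : Over S} {T T' : Over S'}
    (s : T' ⟶ T) (g : T ⟶ (Over.pullback f).obj G) :
    transpose f (s ≫ g) = (Over.map f).map s ≫ transpose f g :=
  Adjunction.homEquiv_naturality_left_symm _ _ _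

/-- The general linear group over `S`, as the group functor `T ↦ GL_n(Γ(T, 𝒪_T))`. -/
def GLFunctor (n : ℕ) (S : Scheme.{u}) : (Over S)ᵒᵖ ⥤ GrpCat.{u} where
  obj T := GrpCat.of (GL (Fin n) Γ(T.unop.left, ⊤))
  map s := GrpCat.ofHom (Matrix.GeneralLinearGroup.map s.unop.left.appTop.hom)
  map_id T := by
    ext g i j
    simp
  map_comp s t := by
    ext g i j
    change (t.unop ≫ s.unop).left.appTop.hom _ = _
    rw [Over.comp_left, Scheme.Hom.comp_appTop]
    rfl

/-- The base change along `f : S' ⟶ S` of a homomorphism `G ⟶ GL_n` of group schemes over `S`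
(given on points). -/
def baseChangeRep (f : S' ⟶ S) {G : Over S} [GrpObj G] {n : ℕ}
    (π : yonedaGrpObj G ⟶ GLFunctor n S) :
    yonedaGrpObj ((Over.pullback f).obj G) ⟶ GLFunctor n S' where
  app T := GrpCat.ofHom (MonoidHom.mk'
    (fun g : T.unop ⟶ (Over.pullback f).obj G =>
      (π.app (op ((Over.map f).obj T.unop)) (transpose f g) : GL (Fin n) Γ(T.unop.left, ⊤)))
    (fun g h => by
      rw [transpose_mul]
      exact map_mul (π.app (op ((Over.map f).obj T.unop))).hom _ _))
  naturality T T' s := by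
    ext1
    ext1 g
    have := congr($(π.naturality ((Over.map f).map s.unop).op) (transpose f g))
    refine Eq.trans ?_ this
    exact congrArg (π.app (op ((Over.map f).obj T'.unop))).hom (transpose_comp f s.unop g)

/-! ### Principal bundles -/

section

variable {G P : Over S} [GrpObj G]

theorem lift_one_smul [ModObj G P] {T : Over S} (t : T ⟶ P) :
    CartesianMonoidalCategory.lift (1 : T ⟶ G) t ≫ γ[G, P] = t := by
  have h : η[G] ▷ P ≫ γ[G, P] = (λ_ P).hom := ModObj.one_smul (M := G) P
  have e : CartesianMonoidalCategory.lift (1 : T ⟶ G) t =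
      CartesianMonoidalCategory.lift (CartesianMonoidalCategory.toUnit T) t ≫ η[G] ▷ P := by
    simp [Hom.one_def]
  rw [e, Category.assoc]
  refine (congrArg _ h).trans ?_
  simp

theorem lift_mul_smul [ModObj G P] {T : Over S} (g h : T ⟶ G) (t : T ⟶ P) :
    CartesianMonoidalCategory.lift (g * h) t ≫ γ[G, P] =
      CartesianMonoidalCategory.lift g (CartesianMonoidalCategory.lift h t ≫ γ[G, P]) ≫
        γ[G, P] := by
  have h' : μ[G] ▷ P ≫ γ[G, P] = (α_ G G P).hom ≫ G ◁ γ[G, P] ≫ γ[G, P] :=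
    ModObj.mul_smul (M := G) P
  have e : CartesianMonoidalCategory.lift (g * h) t =
      CartesianMonoidalCategory.lift (CartesianMonoidalCategory.lift g h) t ≫ μ[G] ▷ P := by
    simp [Hom.mul_def]
  have e' : CartesianMonoidalCategory.lift g
        (CartesianMonoidalCategory.lift h t ≫ γ[G, P]) =
      CartesianMonoidalCategory.lift (CartesianMonoidalCategory.lift g h) t ≫
        (α_ G G P).hom ≫ G ◁ γ[G, P] := by
    have e₂ : CartesianMonoidalCategory.lift (CartesianMonoidalCategory.lift g h) t ≫
        (α_ G G P).hom = CartesianMonoidalCategory.lift g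
          (CartesianMonoidalCategory.lift h t) := by simp
    rw [← Category.assoc, e₂]
    exact (CartesianMonoidalCategory.lift_whiskerLeft ..).symm
  rw [e, e', Category.assoc]
  refine (congrArg _ h').trans ?_
  simp only [Category.assoc]

end

/-- A principal `G`-bundle `P ⟶ X`, for a group scheme `G` and a scheme `X` over `S`: a scheme `P`
with a left action of `G` and an invariant morphism to `X` such that `G` acts simply transitively
on the points of `P` lying over a given point of `X`, and such that `P ⟶ X` has sections locally
for the fppf topology. -/
structure PrincipalBundle (G : Over S) [GrpObj G] (X : Over S) where
  /-- the total space -/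
  total : Over S
  /-- the action of `G` -/
  [action : ModObj G total]
  /-- the bundle projection -/
  proj : total ⟶ X
  smul_proj : ∀ {T : Over S} (g : T ⟶ G) (t : T ⟶ total),
    (CartesianMonoidalCategory.lift g t ≫ γ[G, total]) ≫ proj = t ≫ proj
  simply_transitive : ∀ {T : Over S} (a b : T ⟶ total), a ≫ proj = b ≫ proj →
    ∃! g : T ⟶ G, CartesianMonoidalCategory.lift g b ≫ γ[G, total] = a
  locally_trivial :
    Sieve.generate (Presieve.singleton proj.left) ∈ Scheme.fppfTopology X.left

attribute [instance] PrincipalBundle.action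

namespace PrincipalBundle

/-- Let `f : S' ⟶ S` be a morphism of schemes, `φ : G' ⟶ G` a morphism of group schemes over `f`
and `h : X' ⟶ X` a morphism over `f`. A `G'`-bundle `P'` on `X'` is the pullback of the `G`-bundle
`P` on `X` if there is a cartesian square with sides `u : P' ⟶ P` and `h`, in which `u` is
equivariant along `φ`. -/
def IsPullbackOf (f : S' ⟶ S) {G' : Over S'} [GrpObj G'] {G : Over S} [GrpObj G]
    {X' : Over S'} {X : Over S} (φ : (Over.map f).obj G' ⟶ G) (h : (Over.map f).obj X' ⟶ X)
    (P' : PrincipalBundle G' X') (P : PrincipalBundle G X) : Prop :=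
  ∃ u : (Over.map f).obj P'.total ⟶ P.total,
    IsPullback u.left P'.proj.left P.proj.left h.left ∧
    ∀ {T : Over S'} (g : T ⟶ G') (t : T ⟶ P'.total),
      (Over.map f).map (CartesianMonoidalCategory.lift g t ≫ γ[G', P'.total]) ≫ u =
        CartesianMonoidalCategory.lift ((Over.map f).map g ≫ φ) ((Over.map f).map t ≫ u) ≫
          γ[G, P.total]

section BaseChange

variable (f : S' ⟶ S) {G : Over S} [GrpObj G] {X' : Over S'} {X : Over S}
  (h : (Over.map f).obj X' ⟶ X) (P : PrincipalBundle G X)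

/-- The fibre product `P ×_X X'`, as a scheme over `S'`. -/
def pbTotal : Over S' := Over.mk (pullback.snd P.proj.left h.left ≫ X'.hom)

/-- The projection `P ×_X X' ⟶ P`. -/
def pbFst : (Over.map f).obj (pbTotal f h P) ⟶ P.total :=
  Over.homMk (pullback.fst P.proj.left h.left) (by
    have e : h.left ≫ X.hom = X'.hom ≫ f := Over.w h
    change _ = (pullback.snd P.proj.left h.left ≫ X'.hom) ≫ f
    rw [Category.assoc, ← e, ← pullback.condition_assoc, Over.w]
    rfl)

/-- The projection `P ×_X X' ⟶ X'`. -/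
def pbSnd : pbTotal f h P ⟶ X' :=
  Over.homMk (pullback.snd P.proj.left h.left) rfl

theorem pb_condition : pbFst f h P ≫ P.proj = (Over.map f).map (pbSnd f h P) ≫ h := by
  ext1
  exact pullback.condition

/-- The point of `P ×_X X'` with given components. -/
def pbLift {T : Over S'} (a : (Over.map f).obj T ⟶ P.total) (b : T ⟶ X')
    (w : a ≫ P.proj = (Over.map f).map b ≫ h) : T ⟶ pbTotal f h P :=
  Over.homMk (pullback.lift a.left b.left congr(($w).left)) (by
    exact (pullback.lift_snd_assoc _ _ _ _).trans (Over.w b))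

theorem pbLift_fst {T : Over S'} (a : (Over.map f).obj T ⟶ P.total) (b : T ⟶ X')
    (w : a ≫ P.proj = (Over.map f).map b ≫ h) :
    (Over.map f).map (pbLift f h P a b w) ≫ pbFst f h P = a := by
  ext1
  exact pullback.lift_fst _ _ _

theorem pbLift_snd {T : Over S'} (a : (Over.map f).obj T ⟶ P.total) (b : T ⟶ X')
    (w : a ≫ P.proj = (Over.map f).map b ≫ h) :
    pbLift f h P a b w ≫ pbSnd f h P = b := by
  ext1
  exact pullback.lift_snd _ _ _

theorem pb_ext {T : Over S'} {a b : T ⟶ pbTotal f h P}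
    (h₁ : (Over.map f).map a ≫ pbFst f h P = (Over.map f).map b ≫ pbFst f h P)
    (h₂ : a ≫ pbSnd f h P = b ≫ pbSnd f h P) : a = b := by
  ext1
  exact pullback.hom_ext congr(($h₁).left) congr(($h₂).left)

theorem pbSMul_aux {T : Over S'} (g : (Over.map f).obj T ⟶ G) (t : T ⟶ pbTotal f h P) :
    (CartesianMonoidalCategory.lift g ((Over.map f).map t ≫ pbFst f h P) ≫ γ[G, P.total]) ≫
      P.proj = (Over.map f).map (t ≫ pbSnd f h P) ≫ h := by
  rw [P.smul_proj, Category.assoc, pb_condition, Functor.map_comp, Category.assoc]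

/-- The action of the base change of `G` on `P ×_X X'`. -/
def pbSMul : (Over.pullback f).obj G ⊗ pbTotal f h P ⟶ pbTotal f h P :=
  pbLift f h P _ _ (pbSMul_aux f h P (transpose f (CartesianMonoidalCategory.fst _ _))
    (CartesianMonoidalCategory.snd _ _))

theorem lift_pbSMul {T : Over S'} (g : T ⟶ (Over.pullback f).obj G) (t : T ⟶ pbTotal f h P) :
    CartesianMonoidalCategory.lift g t ≫ pbSMul f h P =
      pbLift f h P _ _ (pbSMul_aux f h P (transpose f g) t) := by
  apply pb_ext
  · rw [pbLift_fst, Functor.map_comp, Category.assoc, pbSMul, pbLift_fst,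
      CartesianMonoidalCategory.comp_lift_assoc, ← transpose_comp, ← Functor.map_comp_assoc,
      CartesianMonoidalCategory.lift_fst, CartesianMonoidalCategory.lift_snd]
  · rw [pbLift_snd, Category.assoc, pbSMul, pbLift_snd,
      CartesianMonoidalCategory.lift_snd_assoc]

theorem lift_pbSMul_fst {T : Over S'} (g : T ⟶ (Over.pullback f).obj G)
    (t : T ⟶ pbTotal f h P) :
    (Over.map f).map (CartesianMonoidalCategory.lift g t ≫ pbSMul f h P) ≫ pbFst f h P =
      CartesianMonoidalCategory.lift (transpose f g) ((Over.map f).map t ≫ pbFst f h P) ≫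
        γ[G, P.total] := by
  rw [lift_pbSMul, pbLift_fst]

theorem lift_pbSMul_snd {T : Over S'} (g : T ⟶ (Over.pullback f).obj G)
    (t : T ⟶ pbTotal f h P) :
    (CartesianMonoidalCategory.lift g t ≫ pbSMul f h P) ≫ pbSnd f h P = t ≫ pbSnd f h P := by
  rw [lift_pbSMul, pbLift_snd]

instance pbAction : ModObj ((Over.pullback f).obj G) (pbTotal f h P) where
  smul := pbSMul f h P
  one_smul := by
    have e : η[(Over.pullback f).obj G] ▷ pbTotal f h P =
        CartesianMonoidalCategory.lift 1 (CartesianMonoidalCategory.snd _ _) := by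
      ext1
      · rw [CartesianMonoidalCategory.whiskerRight_fst, CartesianMonoidalCategory.lift_fst,
          Hom.one_def]
        congr 1
      · rw [CartesianMonoidalCategory.whiskerRight_snd, CartesianMonoidalCategory.lift_snd]
    change η[(Over.pullback f).obj G] ▷ pbTotal f h P ≫ pbSMul f h P = (λ_ _).hom
    rw [e]
    apply pb_ext
    · rw [lift_pbSMul_fst, transpose_one, lift_one_smul]
      rfl
    · rw [lift_pbSMul_snd]
      rfl
  mul_smul := by
    let G' := (Over.pullback f).obj G
    let a : (G' ⊗ G') ⊗ pbTotal f h P ⟶ G' :=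
      CartesianMonoidalCategory.fst _ _ ≫ CartesianMonoidalCategory.fst _ _
    let b : (G' ⊗ G') ⊗ pbTotal f h P ⟶ G' :=
      CartesianMonoidalCategory.fst _ _ ≫ CartesianMonoidalCategory.snd _ _
    let c : (G' ⊗ G') ⊗ pbTotal f h P ⟶ pbTotal f h P := CartesianMonoidalCategory.snd _ _
    have e₁ : μ[G'] ▷ pbTotal f h P = CartesianMonoidalCategory.lift (a * b) c := by
      ext1 <;> simp [a, b, c, Hom.mul_def]
    have e₂ : (α_ G' G' (pbTotal f h P)).hom ≫ G' ◁ pbSMul f h P =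
        CartesianMonoidalCategory.lift a
          (CartesianMonoidalCategory.lift b c ≫ pbSMul f h P) := by
      ext1
      · simp [a]
      · simp only [Category.assoc, CartesianMonoidalCategory.whiskerLeft_snd,
          CartesianMonoidalCategory.lift_snd]
        rw [← Category.assoc]
        congr 1
        ext1 <;> simp [b, c]
    change μ[G'] ▷ pbTotal f h P ≫ pbSMul f h P =
      (α_ G' G' (pbTotal f h P)).hom ≫ G' ◁ pbSMul f h P ≫ pbSMul f h P
    rw [← Category.assoc, e₂, e₁]
    apply pb_ext
    · rw [lift_pbSMul_fst, lift_pbSMul_fst, lift_pbSMul_fst, transpose_mul, lift_mul_smul]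
    · rw [lift_pbSMul_snd, lift_pbSMul_snd, lift_pbSMul_snd]

/-- The pullback `P ×_X X' ⟶ X'` of a `G`-bundle along a morphism `h : X' ⟶ X` over
`f : S' ⟶ S`, a principal bundle under the base change of `G` along `f`. -/
def baseChange : PrincipalBundle ((Over.pullback f).obj G) X' where
  total := pbTotal f h P
  proj := pbSnd f h P
  smul_proj g t := lift_pbSMul_snd f h P g t
  simply_transitive := by
    intro T a b hab
    have hab' : ((Over.map f).map a ≫ pbFst f h P) ≫ P.proj =
        ((Over.map f).map b ≫ pbFst f h P) ≫ P.proj := by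
      simp only [Category.assoc, pb_condition]
      simp only [← Functor.map_comp_assoc, hab]
    obtain ⟨g, hg, hu⟩ := P.simply_transitive _ _ hab'
    refine ⟨(Over.mapPullbackAdj f).homEquiv T G g, ?_, ?_⟩
    · apply pb_ext
      · refine (lift_pbSMul_fst f h P _ _).trans ?_
        rw [transpose, Equiv.symm_apply_apply, hg]
      · exact (lift_pbSMul_snd f h P _ _).trans hab.symm
    · intro g' hg'
      rw [← Equiv.symm_apply_eq]
      apply hu
      refine (lift_pbSMul_fst f h P g' b).symm.trans ?_
      congr 2
  locally_trivial := by
    refine Scheme.fppfTopology.superset_covering ?_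
      (Scheme.fppfTopology.pullback_stable h.left P.locally_trivial)
    rintro Y y ⟨Z, a, b, hb, hab⟩
    obtain ⟨⟩ := hb
    exact ⟨_, pullback.lift a y hab, _, ⟨⟩, pullback.lift_snd _ _ _⟩

end BaseChange

end PrincipalBundle


/-! ### Frobenius morphisms and their liftings -/

section Frobenius

variable (p : ℕ) [Fact p.Prime] {k : Type u} [Field k] [CharP k p]

/-- The Frobenius of `Spec k`. -/
abbrev frobPoint : Spec (.of k) ⟶ Spec (.of k) :=
  Spec.map (CommRingCat.ofHom (frobenius k p))

theorem natCast_section_over (X : Over (Spec (.of k))) : (p : Γ(X.left, ⊤)) = 0 :=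
  natCast_eq_zero_of_ringHom p (X.hom.appTop.hom.comp (Scheme.ΓSpecIso (.of k)).inv.hom)
    (CharP.cast_eq_zero k p)

/-- The absolute Frobenius `F_X` of a scheme `X` over `k`, as a morphism over the Frobenius of
`Spec k`. -/
def overFrobenius (X : Over (Spec (.of k))) : (Over.map (frobPoint p)).obj X ⟶ X :=
  Over.homMk (absFrobenius p X.left (natCast_section_over p X))
    (absFrobenius_comp X (natCast_section_over p X))

/-- The Frobenius twist of a scheme over `k`. -/
abbrev twist (X : Over (Spec (.of k))) : Over (Spec (.of k)) :=
  (Over.pullback (frobPoint p)).obj X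

/-- The relative Frobenius `F_{X/k} : X ⟶ X'`. -/
def relFrobenius (X : Over (Spec (.of k))) : X ⟶ twist p X :=
  (Over.mapPullbackAdj (frobPoint p)).homEquiv X X (overFrobenius p X)

/-- The Frobenius pullback `F_X^* P` of a `G`-bundle `P` on `X`, a bundle under the Frobenius
twist of `G`. -/
def PrincipalBundle.frobeniusPullback {G X : Over (Spec (.of k))} [GrpObj G]
    (P : PrincipalBundle G X) : PrincipalBundle (twist p G) X :=
  P.baseChange (frobPoint p) (overFrobenius p X)

/-- `Spec k ⟶ Spec W(k)`. -/
abbrev closedPoint : Spec (.of k) ⟶ Spec (.of (WittVector p k)) :=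
  Spec.map (CommRingCat.ofHom WittVector.constantCoeff)

/-- The Frobenius of `Spec W(k)`. -/
abbrev frobWitt : Spec (.of (WittVector p k)) ⟶ Spec (.of (WittVector p k)) :=
  Spec.map (CommRingCat.ofHom WittVector.frobenius)

theorem closedPoint_frobWitt :
    closedPoint (k := k) p ≫ frobWitt p = frobPoint p ≫ closedPoint p := by
  rw [← Spec.map_comp, ← Spec.map_comp]
  congr 1
  ext x
  exact WittVector.coeff_frobenius_charP p x 0

/-- The special fibre `G = G̃ ⊗ k`. -/
abbrev specialFibre (G : Over (Spec (.of (WittVector p k)))) : Over (Spec (.of k)) :=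
  (Over.pullback (closedPoint p)).obj G

/-- The base change `G̃' = G̃ ⊗_{W(k), σ} W(k)`. -/
abbrev wittTwist (G : Over (Spec (.of (WittVector p k)))) :
    Over (Spec (.of (WittVector p k))) :=
  (Over.pullback (frobWitt p)).obj G

variable (A : Type u) [CommRing A] [Algebra (WittVector p k) A]

/-- `Spec A ⟶ Spec W(k)`. -/
abbrev specAlg : Spec (.of A) ⟶ Spec (.of (WittVector p k)) :=
  Spec.map (CommRingCat.ofHom (algebraMap (WittVector p k) A))

/-- The base change `G_A = G̃ ⊗_{W(k)} A`. -/
abbrev overAlg (G : Over (Spec (.of (WittVector p k)))) : Over (Spec (.of A)) :=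
  (Over.pullback (specAlg p A)).obj G

variable {A} {p}

/-- `Spec k ⟶ Spec A` for an augmentation `ε : A → k`. -/
abbrev specRes (ε : A →+* k) : Spec (.of k) ⟶ Spec (.of A) :=
  Spec.map (CommRingCat.ofHom ε)

theorem specRes_specAlg {ε : A →+* k}
    (hε : ε.comp (algebraMap (WittVector p k) A) = WittVector.constantCoeff) :
    specRes ε ≫ specAlg p A = closedPoint p := by
  rw [← Spec.map_comp, ← CommRingCat.ofHom_comp, hε]

/-- The canonical closed immersion `G ⟶ G_A`. -/
def fibreIncl {ε : A →+* k}
    (hε : ε.comp (algebraMap (WittVector p k) A) = WittVector.constantCoeff)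
    (G : Over (Spec (.of (WittVector p k)))) :
    (Over.map (specRes ε)).obj (specialFibre p G) ⟶ overAlg p A G :=
  Over.homMk (pullback.lift (pullback.fst G.hom (closedPoint p))
    (pullback.snd G.hom (closedPoint p) ≫ specRes ε)
    (by rw [Category.assoc, specRes_specAlg hε, pullback.condition]))
    (pullback.lift_snd _ _ _)

theorem twistFibreIncl_aux (G : Over (Spec (.of (WittVector p k)))) :
    (pullback.fst (pullback.snd G.hom (closedPoint p)) (frobPoint p) ≫
      pullback.fst G.hom (closedPoint p)) ≫ G.hom =
    (pullback.snd (pullback.snd G.hom (closedPoint p)) (frobPoint p) ≫ closedPoint p) ≫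
      frobWitt p := by
  rw [Category.assoc, Category.assoc, closedPoint_frobWitt, pullback.condition,
    pullback.condition_assoc]

/-- The canonical closed immersion `G' ⟶ G'_A`, where `G'` is the Frobenius twist of the special
fibre `G` and `G'_A = G̃' ⊗ A`. -/
def twistFibreIncl {ε : A →+* k}
    (hε : ε.comp (algebraMap (WittVector p k) A) = WittVector.constantCoeff)
    (G : Over (Spec (.of (WittVector p k)))) :
    (Over.map (specRes ε)).obj (twist p (specialFibre p G)) ⟶ overAlg p A (wittTwist p G) :=
  Over.homMk
    (pullback.lift
      (pullback.lift
        (pullback.fst (pullback.snd G.hom (closedPoint p)) (frobPoint p) ≫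
          pullback.fst G.hom (closedPoint p))
        (pullback.snd (pullback.snd G.hom (closedPoint p)) (frobPoint p) ≫ closedPoint p)
        (twistFibreIncl_aux G))
      (pullback.snd (pullback.snd G.hom (closedPoint p)) (frobPoint p) ≫ specRes ε)
      ((pullback.lift_snd _ _ (twistFibreIncl_aux G)).trans
        (by rw [Category.assoc, specRes_specAlg hε])))
    (pullback.lift_snd _ _ _)

/-- A lifting over `A` of the Frobenius homomorphism of `G = G̃ ⊗ k`: a homomorphism of group
schemes `G_A ⟶ G'_A` whose restriction to the special fibres is the relative Frobenius
`G ⟶ G'`. -/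
structure IsFrobeniusLifting {ε : A →+* k}
    (hε : ε.comp (algebraMap (WittVector p k) A) = WittVector.constantCoeff)
    {G : Over (Spec (.of (WittVector p k)))} [GrpObj G]
    (F : overAlg p A G ⟶ overAlg p A (wittTwist p G)) : Prop where
  isMonHom : IsMonHom F
  restrict : fibreIncl hε G ≫ F =
    (Over.map (specRes ε)).map (relFrobenius p (specialFibre p G)) ≫ twistFibreIncl hε G

/-- The morphism `i : X ⟶ X_A` over `Spec k ⟶ Spec A` exhibits `X_A` as a deformation of `X`
over `A`. -/
structure IsDeformation (ε : A →+* k) {X : Over (Spec (.of k))} {XA : Over (Spec (.of A))}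
    (i : (Over.map (specRes ε)).obj X ⟶ XA) : Prop where
  flat : Flat XA.hom
  isPullback : IsPullback i.left X.hom XA.hom (specRes ε)

end Frobenius

/-! ### Vector bundles and reductions of the structure group -/

/-- The sections `e₁, …, eₙ` over `U` form a basis of `M` over every open subset of `U`, i.e. they
define an isomorphism `𝒪_U^n ≅ M|_U`. -/
def IsFrame {X : Scheme.{u}} (M : X.Modules) (U : X.Opens) {n : ℕ} (e : Fin n → Γ(M, U)) : Prop :=
  ∀ (V : X.Opens) (hV : V ≤ U), Function.Bijective fun r : Fin n → Γ(X, V) =>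
    ∑ i, r i • M.presheaf.map (homOfLE hV).op (e i)

/-- Vector bundles of rank `n`: locally free sheaves of rank `n`. -/
def IsVectorBundle {X : Scheme.{u}} (n : ℕ) (M : X.Modules) : Prop :=
  ∀ x : X, ∃ U : X.Opens, x ∈ U ∧ ∃ e : Fin n → Γ(M, U), IsFrame M U e

/-- The pullback along `t : T ⟶ Y` of a global section of `q^* M`, as a global section of
`h^* M`, where `h = q ∘ t`. -/
def pullbackSection {T Y X : Scheme.{u}} (t : T ⟶ Y) (q : Y ⟶ X) (h : T ⟶ X) (w : t ≫ q = h)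
    (M : X.Modules) (s : Γ((Scheme.Modules.pullback q).obj M, ⊤)) :
    Γ((Scheme.Modules.pullback h).obj M, ⊤) :=
  ((Scheme.Modules.pullbackComp t q ≪≫ Scheme.Modules.pullbackCongr w).hom.app M).app ⊤
    (((Scheme.Modules.pullbackPushforwardAdjunction t).unit.app
      ((Scheme.Modules.pullback q).obj M)).app ⊤ s)

/-- The invertible matrix `ρ(g)`, for a point `g` of `G`. -/
def repMatrix {S : Scheme.{u}} {G : Over S} [GrpObj G] {n : ℕ}
    (ρ : yonedaGrpObj G ⟶ GLFunctor n S) {T : Over S} (g : T ⟶ G) :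
    GL (Fin n) Γ(T.left, ⊤) :=
  ρ.app (op T) g

/-- Let `ρ : G ⟶ GL_n` be a homomorphism. A rank `n` bundle `M` on `X` admits a reduction of
structure group along `ρ` if there are a principal `G`-bundle `q : Q ⟶ X` and a morphism from `Q`
to the frame bundle of `M`, equivariant along `ρ`; in other words a frame `e` of `q^* M` such that
`e(g x) = e(x) ρ(g)⁻¹` for all points `g` of `G` and `x` of `Q`. -/
def HasReduction {S : Scheme.{u}} {G X : Over S} [GrpObj G] {n : ℕ}
    (ρ : yonedaGrpObj G ⟶ GLFunctor n S) (M : X.left.Modules) : Prop :=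
  ∃ (Q : PrincipalBundle G X)
    (e : Fin n → Γ((Scheme.Modules.pullback Q.proj.left).obj M, ⊤)),
    IsFrame ((Scheme.Modules.pullback Q.proj.left).obj M) ⊤ e ∧
    ∀ {T : Over S} (g : T ⟶ G) (x : T ⟶ Q.total) (j : Fin n),
      pullbackSection (CartesianMonoidalCategory.lift g x ≫ γ[G, Q.total]).left Q.proj.left
          (x ≫ Q.proj).left congr(($(Q.smul_proj g x)).left) M (e j) =
        ∑ i, (repMatrix ρ g)⁻¹.val i j •
          pullbackSection x.left Q.proj.left (x ≫ Q.proj).left rfl M (e i)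

end FrobBundle

end

open FrobBundle

/-! Principal bundles. The lift of `F_X^* P` is the contracted product of `P_A` with `G'_A` along
the lifted Frobenius. Over `X` this becomes the contracted product of `P` with `G'` along the
relative Frobenius, and that is `F_X^* P`, because the relative Frobenius `P ⟶ F_X^* P` is
equivariant along `G ⟶ G'` (`PrincipalBundle.smul_relFrob`).

The difficulty is representability: `G` need not be affine, so fppf descent of a torsor does not
automatically give a scheme. What helps is that the restriction to `X` is already a scheme and that
`X ⟶ X_A` is a nilpotent thickening. The contracted product is realised as the fppf sheaf of
equivariant morphisms from the pulled-back torsors to `G'_A` (`contr_isSheaf`). An affine open `U`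
of `F_X^* P` cuts out an open subsheaf, since openness only depends on points
(`LiftDatum.sub_isOpen`). Suppose that `U` lies over an affine open `V` of `X_A` and that `Y ⟶ V` is
an affine fppf cover over which `P_A` has a section. Over `Y` the subsheaf is an open `W` of `G'_A ×
Y`, and the part of `W` over `X` is `U ×_V Y`, hence affine. Affineness passes to the thickening `W`
(`isAffine_of_isPullback`), and affine schemes descend along flat covers (`descent_bijective`,
`exists_affine_representing`), so the subsheaf is an affine scheme. These open pieces glue
(`exists_representing_of_cover`), and the resulting scheme is a torsor restricting to `F_X^* P`
(`LiftDatum.exists_bundle`).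

Vector bundles. Here one works with matrices instead of frame bundles. Let `Q` be the reduction and
`e` the frame of the pullback of `E` to `Q`. A local frame `f_a` of `E` is written `f_a = e(x)
m_a(x)` at a point `x` of `Q`, with `m_a(g x) = ρ(g) m_a(x)` and `m_b = m_a t_ab`, where `t` is the
cocycle of `E`. Over `k`, raising entries to the `p`-th power gives a matrix equivariant under
`ρ'(g) = π'(F(g))`, where `π'` is the Frobenius twist of `π`; this is the only place where the
lifting of Frobenius enters (`IsFrobeniusLifting.repMatrix_eq`). Equivariant matrices for `ρ'` over
an affine `V_a` are sections of a form of affine space, which is affine and smooth over `V_a`, so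
the `p`-th power of `m_a` lifts to some `M_a` over `A` (`exists_lift_equivMatrix`). The `M_a` are
invertible because they are so modulo a nilpotent ideal, and `M_a⁻¹ M_b` is invariant and descends
to a cocycle `t'` on `X_A`, which reduces to the `p`-th power of `t`. Glueing along `t'` gives the
lift of `F_X^* E` (`exists_frobenius_lift_of_hasReduction`). -/

noncomputable section

namespace FrobBundle

/-! ### Flat descent of affine schemes -/

section RingDescent

open TensorProduct

variable {R B C : Type u} [CommRing R] [CommRing B] [CommRing C] [Algebra R B] [Algebra B C]
  [Algebra R C] [IsScalarTower R B C]

/-- The multiplication `C ⊗ B → C` of a `B`-algebra `C`. -/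
def actMul (R B C : Type u) [CommRing R] [CommRing B] [CommRing C] [Algebra R B] [Algebra B C]
    [Algebra R C] [IsScalarTower R B C] : C ⊗[R] B →ₐ[R] C :=
  Algebra.TensorProduct.lift (AlgHom.id R C) (IsScalarTower.toAlgHom R B C)
    (fun _ _ => Commute.all _ _)

theorem actMul_tmul (c : C) (b : B) : actMul R B C (c ⊗ₜ b) = c * algebraMap B C b := rfl

/-- The descended ring is the equalizer `D` of the coaction and `c ↦ c ⊗ 1`. Formation of this
equalizer commutes with `⊗ B` by flatness, and coassociativity puts `α c` into `D ⊗ B`. Faithful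
flatness plays no role at this stage. -/
theorem descent_bijective [Module.Flat R B] (α : C →ₐ[R] C ⊗[R] B)
    (h₁ : ∀ b : B, α (algebraMap B C b) = 1 ⊗ₜ b)
    (h₂ : ∀ c, actMul R B C (α c) = c)
    (h₃ : (Algebra.TensorProduct.map α (AlgHom.id R B)).comp α =
      (Algebra.TensorProduct.map Algebra.TensorProduct.includeLeft (AlgHom.id R B)).comp α) :
    Function.Bijective ((actMul R B C).comp (Algebra.TensorProduct.map
      (AlgHom.equalizer α Algebra.TensorProduct.includeLeft).val (AlgHom.id R B))) := by
  set D := AlgHom.equalizer α (Algebra.TensorProduct.includeLeft : C →ₐ[R] C ⊗[R] B) with hD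
  set v : D ⊗[R] B →ₐ[R] C ⊗[R] B := Algebra.TensorProduct.map D.val (AlgHom.id R B) with hv
  -- On `d ⊗ b` this reads `α (d b) = (d ⊗ 1)(1 ⊗ b)`. It makes multiplication on `D ⊗ B` injective
  -- as soon as `v` is.
  have key : ∀ x, α (actMul R B C (v x)) = v x := by
    intro x
    induction x with
    | zero => simp
    | add x y hx hy => simp only [map_add, hx, hy]
    | tmul d b =>
      have hd : α d.1 = d.1 ⊗ₜ 1 := d.2
      simp [hv, actMul, h₁, hd]
  have hvl : v.toLinearMap = LinearMap.rTensor B D.val.toLinearMap := by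
    ext; rfl
  have hvinj : Function.Injective v := by
    have := Module.Flat.rTensor_preserves_injective_linearMap (M := B) D.val.toLinearMap
      Subtype.val_injective
    rw [← hvl] at this
    exact this
  constructor
  · intro x y hxy
    apply hvinj
    rw [← key x, ← key y]
    exact congrArg α hxy
  · intro c
    have hex : Function.Exact D.val.toLinearMap (α.toLinearMap -
        (Algebra.TensorProduct.includeLeft : C →ₐ[R] C ⊗[R] B).toLinearMap) := by
      intro c
      constructor
      · intro h
        exact ⟨⟨c, sub_eq_zero.1 h⟩, rfl⟩
      · rintro ⟨d, rfl⟩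
        exact sub_eq_zero.2 d.2
    -- After tensoring, `D ⊗ B` is the kernel of the difference of the two maps `C ⊗ B → (C ⊗ B) ⊗
    -- B`; by `h₃` it contains `α c`, and multiplication sends `α c` back to `c`.
    have hex' := Module.Flat.rTensor_exact B hex
    obtain ⟨x, hx⟩ := (hex' (α c)).1 (by
      rw [LinearMap.rTensor_sub, LinearMap.sub_apply, sub_eq_zero]
      exact DFunLike.congr_fun h₃ c)
    refine ⟨x, ?_⟩
    have hx' : v x = α c := by rw [← hx, ← hvl]; rfl
    change actMul R B C (v x) = c
    rw [hx', h₂]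

end RingDescent

/-! ### Geometric descent data for affine schemes -/

section SchemeDescent

open TensorProduct

/-- The descent datum is a rule `a (w, y)` moving a point `w` to the fibre over `y`. The three
conditions say that the result lies over `y`, that `a (w, ψ w) = w`, and that two successive moves
compose. Dually they are the unit and coassociativity conditions of `descent_bijective`. -/
theorem exists_descent_spec {R B C : CommRingCat.{u}} (φ : R ⟶ B) (ψ : B ⟶ C) (hφ : φ.hom.Flat)
    (a : pullback (Spec.map ψ ≫ Spec.map φ) (Spec.map φ) ⟶ Spec C)
    (h₁ : a ≫ Spec.map ψ = pullback.snd _ _)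
    (h₂ : pullback.lift (𝟙 _) (Spec.map ψ) (by simp) ≫ a = 𝟙 _)
    (h₃ : ∀ {T : Scheme.{u}} (w : T ⟶ Spec C) (y y' : T ⟶ Spec B)
      (e : w ≫ Spec.map ψ ≫ Spec.map φ = y ≫ Spec.map φ)
      (e' : w ≫ Spec.map ψ ≫ Spec.map φ = y' ≫ Spec.map φ)
      (e'' : (pullback.lift w y e ≫ a) ≫ Spec.map ψ ≫ Spec.map φ = y' ≫ Spec.map φ),
      pullback.lift (pullback.lift w y e ≫ a) y' e'' ≫ a = pullback.lift w y' e' ≫ a) :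
    ∃ (D : CommRingCat.{u}) (z : Spec C ⟶ Spec D) (q : Spec D ⟶ Spec R),
      IsPullback z (Spec.map ψ) q (Spec.map φ) ∧ pullback.fst _ _ ≫ z = a ≫ z := by
  algebraize [φ.hom, ψ.hom, ψ.hom.comp φ.hom]
  have : Module.Flat R B := hφ
  let T := CommRingCat.of (C ⊗[R] B)
  let iL : C ⟶ T := CommRingCat.ofHom
    (Algebra.TensorProduct.includeLeft : C →ₐ[R] C ⊗[R] B).toRingHom
  let iR : B ⟶ T := CommRingCat.ofHom
    (Algebra.TensorProduct.includeRight : B →ₐ[R] C ⊗[R] B).toRingHom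
  have hT : (φ ≫ ψ) ≫ iL = φ ≫ iR := by
    ext r
    exact (Algebra.TensorProduct.includeLeft : C →ₐ[R] C ⊗[R] B).commutes r |>.trans
      ((Algebra.TensorProduct.includeRight : B →ₐ[R] C ⊗[R] B).commutes r).symm
  have hT' : Spec.map iL ≫ Spec.map ψ ≫ Spec.map φ = Spec.map iR ≫ Spec.map φ := by
    simp only [← Spec.map_comp, ← hT, Category.assoc]
  let α₀ : C ⟶ T := Spec.preimage (pullback.lift (Spec.map iL) (Spec.map iR) hT' ≫ a)
  have hα₀ : Spec.map α₀ = pullback.lift (Spec.map iL) (Spec.map iR) hT' ≫ a := Spec.map_preimage _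
  have eψ : ψ ≫ α₀ = iR := by
    apply Spec.map_injective
    rw [Spec.map_comp, hα₀, Category.assoc, h₁, pullback.lift_snd]
  let α : C →ₐ[R] C ⊗[R] B := { α₀.hom with
    commutes' := fun r => by
      have : (φ ≫ ψ ≫ α₀) = (φ ≫ iR) := by rw [eψ]
      exact congr($(this).hom r).trans
        ((Algebra.TensorProduct.includeRight : B →ₐ[R] C ⊗[R] B).commutes r) }
  have key : ∀ {E : CommRingCat.{u}} (f : T ⟶ E), Spec.map f ≫ Spec.map α₀ =
      pullback.lift (Spec.map (iL ≫ f)) (Spec.map (iR ≫ f)) (by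
        rw [Spec.map_comp, Spec.map_comp, Category.assoc, hT', Category.assoc]) ≫ a := by
    intro E f
    rw [hα₀, ← Category.assoc]
    congr 1
    apply pullback.hom_ext
    · rw [Category.assoc, pullback.lift_fst, pullback.lift_fst, Spec.map_comp]
    · rw [Category.assoc, pullback.lift_snd, pullback.lift_snd, Spec.map_comp]
  have hb := descent_bijective (R := R) (B := B) (C := C) α
    (fun b => congr($(eψ).hom b))
    (fun c => by
      have e : α₀ ≫ CommRingCat.ofHom (actMul R B C).toRingHom = 𝟙 _ := by
        apply Spec.map_injective
        rw [Spec.map_comp, key, Spec.map_id]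
        refine Eq.trans ?_ h₂
        congr 1
        apply pullback.hom_ext
        · rw [pullback.lift_fst, pullback.lift_fst, ← Spec.map_id]
          congr 1
          ext c
          exact (actMul_tmul (R := R) (B := B) c 1).trans (by rw [map_one, mul_one]; rfl)
        · rw [pullback.lift_snd, pullback.lift_snd]
          congr 1
          ext c
          exact (actMul_tmul (R := R) (C := C) 1 c).trans (one_mul _)
      exact congr($(e).hom c))
    (by
      let T₂ := CommRingCat.of ((C ⊗[R] B) ⊗[R] B)
      let j : T ⟶ T₂ := CommRingCat.ofHom
        (Algebra.TensorProduct.includeLeft : C ⊗[R] B →ₐ[R] (C ⊗[R] B) ⊗[R] B).toRingHom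
      let j₂ : B ⟶ T₂ := CommRingCat.ofHom
        (Algebra.TensorProduct.includeRight : B →ₐ[R] (C ⊗[R] B) ⊗[R] B).toRingHom
      let A₁ : T ⟶ T₂ := CommRingCat.ofHom
        (Algebra.TensorProduct.map α (AlgHom.id R B)).toRingHom
      let A₂ : T ⟶ T₂ := CommRingCat.ofHom
        (Algebra.TensorProduct.map (Algebra.TensorProduct.includeLeft : C →ₐ[R] C ⊗[R] B)
          (AlgHom.id R B)).toRingHom
      have e₁ : iL ≫ A₁ = α₀ ≫ j := by
        ext c
        exact (Algebra.TensorProduct.map_tmul ..).trans (by rw [map_one]; rfl)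
      have e₂ : iR ≫ A₁ = j₂ := by
        ext c
        exact (Algebra.TensorProduct.map_tmul ..).trans (by rw [map_one]; rfl)
      have e₃ : iL ≫ A₂ = iL ≫ j := by
        ext c
        exact (Algebra.TensorProduct.map_tmul ..).trans (by rw [map_one]; rfl)
      have e₄ : iR ≫ A₂ = j₂ := by
        ext c
        exact (Algebra.TensorProduct.map_tmul ..).trans (by rw [map_one]; rfl)
      have ew : Spec.map (iL ≫ j) ≫ Spec.map ψ ≫ Spec.map φ = Spec.map (iR ≫ j) ≫ Spec.map φ := by
        rw [Spec.map_comp, Spec.map_comp, Category.assoc, hT', Category.assoc]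
      have ew' : Spec.map (iL ≫ j) ≫ Spec.map ψ ≫ Spec.map φ = Spec.map j₂ ≫ Spec.map φ := by
        rw [← e₃, ← e₄, Spec.map_comp, Spec.map_comp, Category.assoc, hT', Category.assoc]
      have e : α₀ ≫ A₁ = α₀ ≫ A₂ := by
        apply Spec.map_injective
        rw [Spec.map_comp, Spec.map_comp, key, key]
        -- Coassociativity is the composition law at the universal triple `(w, y, y')`, whose ring
        -- is `(C ⊗ B) ⊗ B`.
        have := h₃ (Spec.map (iL ≫ j)) (Spec.map (iR ≫ j)) (Spec.map j₂) ew ew' (by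
          rw [Category.assoc, reassoc_of% h₁, pullback.lift_snd_assoc, ← ew, ew'])
        simp only [e₁, e₂, e₃, e₄, Spec.map_comp α₀ j, key]
        exact this
      ext c
      exact congr($(e).hom c))
  let D := AlgHom.equalizer α (Algebra.TensorProduct.includeLeft : C →ₐ[R] C ⊗[R] B)
  let Dc : CommRingCat.{u} := CommRingCat.of D
  let i : Dc ⟶ C := CommRingCat.ofHom D.val.toRingHom
  let q : R ⟶ Dc := CommRingCat.ofHom (algebraMap R D)
  refine ⟨Dc, Spec.map i, Spec.map q, ?_, ?_⟩
  · apply isPullback_SpecMap_of_isPushout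
    let eq := RingEquiv.ofBijective _ hb
    refine IsPushout.of_iso (CommRingCat.isPushout_tensorProduct R D B)
      (Iso.refl _) (Iso.refl _) (Iso.refl _) (RingEquiv.toCommRingCatIso eq) ?_ ?_ ?_ ?_
    · rfl
    · rfl
    · ext d
      change actMul R B C (D.val d ⊗ₜ 1) = d.1
      simp [actMul]
    · ext b
      change actMul R B C (1 ⊗ₜ b) = ψ.hom b
      simp [actMul]
      rfl
  · have hp := isPullback_SpecMap_of_isPushout _ _ _ _ (CommRingCat.isPushout_tensorProduct R C B)
    have e : i ≫ iL = i ≫ α₀ := by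
      ext d
      exact d.2.symm
    -- Since `Spec (C ⊗ B)` is the fibre product, the equality of the two maps to `Spec D` may be
    -- checked there, where it is the defining property of the equalizer.
    have hl : IsIso (pullback.lift (f := Spec.map ψ ≫ Spec.map φ) (g := Spec.map φ)
        (Spec.map iL) (Spec.map iR) hT') := by
      have h2 : IsPullback (Spec.map iL) (Spec.map iR) (Spec.map ψ ≫ Spec.map φ) (Spec.map φ) := by
        rw [← Spec.map_comp]
        exact hp
      have : pullback.lift (f := Spec.map ψ ≫ Spec.map φ) (g := Spec.map φ)
        (Spec.map iL) (Spec.map iR) hT' = h2.isoPullback.hom := by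
        apply pullback.hom_ext
        · rw [pullback.lift_fst, IsPullback.isoPullback_hom_fst]
        · rw [pullback.lift_snd, IsPullback.isoPullback_hom_snd]
      rw [this]
      infer_instance
    rw [← cancel_epi (pullback.lift (f := Spec.map ψ ≫ Spec.map φ) (g := Spec.map φ)
        (Spec.map iL) (Spec.map iR) hT'), pullback.lift_fst_assoc, ← Category.assoc, ← hα₀,
      ← Spec.map_comp, ← Spec.map_comp, e]

end SchemeDescent

end FrobBundle

namespace FrobBundle

theorem pullback_lift_congr {C : Type*} [Category C] {X Y Z T : C} {f : X ⟶ Z} {g : Y ⟶ Z}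
    [HasPullback f g] {a a' : T ⟶ X} {b b' : T ⟶ Y} (e : a ≫ f = b ≫ g) (ha : a = a')
    (hb : b = b') (e' : a' ≫ f = b' ≫ g) : pullback.lift a b e = pullback.lift a' b' e' := by
  subst ha hb
  rfl

theorem exists_descent {V Y W : Scheme.{u}} [IsAffine V] [IsAffine Y] [IsAffine W] (f : Y ⟶ V)
    [Flat f] (π : W ⟶ Y) (a : pullback (π ≫ f) f ⟶ W)
    (h₁ : a ≫ π = pullback.snd _ _)
    (h₂ : pullback.lift (𝟙 _) π (by simp) ≫ a = 𝟙 _)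
    (h₃ : ∀ {T : Scheme.{u}} (w : T ⟶ W) (y y' : T ⟶ Y)
      (e : w ≫ π ≫ f = y ≫ f) (e' : w ≫ π ≫ f = y' ≫ f)
      (e'' : (pullback.lift w y e ≫ a) ≫ π ≫ f = y' ≫ f),
      pullback.lift (pullback.lift w y e ≫ a) y' e'' ≫ a = pullback.lift w y' e' ≫ a) :
    ∃ (Z : Scheme.{u}) (_ : IsAffine Z) (z : W ⟶ Z) (q : Z ⟶ V),
      IsPullback z π q f ∧ pullback.fst _ _ ≫ z = a ≫ z := by
  have nf : Spec.map f.appTop ≫ V.isoSpec.inv = Y.isoSpec.inv ≫ f :=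
    (Scheme.isoSpec_inv_naturality f)
  have nπ : Spec.map π.appTop ≫ Y.isoSpec.inv = W.isoSpec.inv ≫ π :=
    (Scheme.isoSpec_inv_naturality π)
  have nf' : f ≫ V.isoSpec.hom = Y.isoSpec.hom ≫ Spec.map f.appTop :=
    (Scheme.isoSpec_hom_naturality f).symm
  have nπ' : π ≫ Y.isoSpec.hom = W.isoSpec.hom ≫ Spec.map π.appTop :=
    (Scheme.isoSpec_hom_naturality π).symm
  have tr {T : Scheme.{u}} (w : T ⟶ Spec Γ(W, ⊤)) (y : T ⟶ Spec Γ(Y, ⊤))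
      (e : w ≫ Spec.map π.appTop ≫ Spec.map f.appTop = y ≫ Spec.map f.appTop) :
      (w ≫ W.isoSpec.inv) ≫ π ≫ f = (y ≫ Y.isoSpec.inv) ≫ f := by
    rw [Category.assoc, ← reassoc_of% nπ, ← nf, Category.assoc, ← nf, reassoc_of% e]
  let a' : pullback (Spec.map π.appTop ≫ Spec.map f.appTop) (Spec.map f.appTop) ⟶
      Spec Γ(W, ⊤) :=
    pullback.lift (pullback.fst _ _ ≫ W.isoSpec.inv) (pullback.snd _ _ ≫ Y.isoSpec.inv)
      (tr _ _ pullback.condition) ≫ a ≫ W.isoSpec.hom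
  have ha' {T : Scheme.{u}} (w : T ⟶ Spec Γ(W, ⊤)) (y : T ⟶ Spec Γ(Y, ⊤))
      (e : w ≫ Spec.map π.appTop ≫ Spec.map f.appTop = y ≫ Spec.map f.appTop) :
      pullback.lift w y e ≫ a' = pullback.lift (w ≫ W.isoSpec.inv) (y ≫ Y.isoSpec.inv)
        (tr w y e) ≫ a ≫ W.isoSpec.hom := by
    rw [← Category.assoc]
    congr 1
    apply pullback.hom_ext
    · rw [Category.assoc, pullback.lift_fst, pullback.lift_fst_assoc, pullback.lift_fst]
    · rw [Category.assoc, pullback.lift_snd, pullback.lift_snd_assoc, pullback.lift_snd]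
  obtain ⟨D, z, q, hz, hz'⟩ := exists_descent_spec f.appTop π.appTop (Scheme.Hom.flat_appTop f) a'
    (by
      rw [Category.assoc, Category.assoc, ← nπ', reassoc_of% h₁, pullback.lift_snd_assoc,
        Category.assoc, Iso.inv_hom_id, Category.comp_id])
    (by
      rw [ha', pullback_lift_congr _ (a' := W.isoSpec.inv ≫ 𝟙 W) (b' := W.isoSpec.inv ≫ π)
        (Category.id_comp _ |>.trans (Category.comp_id _).symm) nπ (by simp)]
      have : pullback.lift (f := π ≫ f) (g := f) (W.isoSpec.inv ≫ 𝟙 W) (W.isoSpec.inv ≫ π)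
          (by simp) = W.isoSpec.inv ≫ pullback.lift (𝟙 _) π (by simp) := by
        apply pullback.hom_ext
        · rw [pullback.lift_fst, Category.assoc, pullback.lift_fst]
        · rw [pullback.lift_snd, Category.assoc, pullback.lift_snd]
      rw [this, Category.assoc, reassoc_of% h₂, Iso.inv_hom_id])
    (by
      intro T w y y' e e' e''
      have := h₃ (w ≫ W.isoSpec.inv) (y ≫ Y.isoSpec.inv) (y' ≫ Y.isoSpec.inv) (tr _ _ e)
        (tr _ _ e') (by
          rw [Category.assoc, reassoc_of% h₁, pullback.lift_snd_assoc, ← tr _ _ e, tr _ _ e'])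
      refine (ha' _ _ e'').trans ?_
      rw [ha' w y', ← reassoc_of% this]
      congr 1
      apply pullback_lift_congr
      · rw [ha', Category.assoc, Category.assoc, Iso.hom_inv_id, Category.comp_id]
      · rfl)
  refine ⟨Spec D, inferInstance, W.isoSpec.hom ≫ z, q ≫ V.isoSpec.inv, ?_, ?_⟩
  · refine IsPullback.of_iso hz W.isoSpec.symm (Iso.refl _) Y.isoSpec.symm V.isoSpec.symm
      ?_ ?_ ?_ ?_
    · simp
    · exact nπ
    · simp
    · exact nf
  · have e : pullback.lift (f := Spec.map π.appTop ≫ Spec.map f.appTop) (g := Spec.map f.appTop)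
        (pullback.fst (π ≫ f) f ≫ W.isoSpec.hom) (pullback.snd (π ≫ f) f ≫ Y.isoSpec.hom) (by
          have := pullback.condition (f := π ≫ f) (g := f) =≫ V.isoSpec.hom
          rw [Category.assoc, ← reassoc_of% nπ', ← nf', Category.assoc, ← nf']
          simpa only [Category.assoc] using this) ≫ a' = a ≫ W.isoSpec.hom := by
      refine (ha' _ _ _).trans ?_
      convert! Category.id_comp _ using 2
      apply pullback.hom_ext
      · rw [pullback.lift_fst, Category.assoc, Iso.hom_inv_id, Category.comp_id,
          Category.id_comp]
      · rw [pullback.lift_snd, Category.assoc, Iso.hom_inv_id, Category.comp_id,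
          Category.id_comp]
    rw [← reassoc_of% e, ← hz', pullback.lift_fst_assoc, Category.assoc]

/-! ### fppf sheaves that become affine after a base change -/

section

variable (Q : Scheme.{u}ᵒᵖ ⥤ Type u) (hQ : Presieve.IsSheaf Scheme.fppfTopology Q)

include hQ

theorem fppf_isSheafFor {W Z : Scheme.{u}} (h : W ⟶ Z) [Flat h] [Surjective h]
    [LocallyOfFinitePresentation h] : Presieve.IsSheafFor Q (Presieve.singleton h) := by
  rw [Presieve.isSheafFor_iff_generate]
  exact hQ _ (Precoverage.generate_mem_toGrothendieck h.singleton_mem_fppfPrecoverage)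

theorem fppf_injective {W Z : Scheme.{u}} (h : W ⟶ Z) [Flat h] [Surjective h]
    [LocallyOfFinitePresentation h] : Function.Injective (Q.map h.op) := by
  intro a b hab
  refine (fppf_isSheafFor Q hQ h).isSeparatedFor.ext ?_
  rintro _ _ ⟨⟩
  exact hab

theorem fppf_glue {W Z : Scheme.{u}} (h : W ⟶ Z) [Flat h] [Surjective h]
    [LocallyOfFinitePresentation h] (w : Q.obj (op W))
    (hw : ∀ {T : Scheme.{u}} (a b : T ⟶ W), a ≫ h = b ≫ h → Q.map a.op w = Q.map b.op w) :
    ∃ z, Q.map h.op z = w := by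
  obtain ⟨z, hz, -⟩ := (Presieve.isSheafFor_singleton.1 (fppf_isSheafFor Q hQ h)) w
    (fun a b e => hw a b e)
  exact ⟨z, hz⟩

/-- Let `Q` be an fppf sheaf over an affine scheme `V` which becomes representable by an affine
scheme after an affine fppf base change. Then `Q` is representable by an affine scheme. -/
theorem exists_affine_representing {V Y W : Scheme.{u}} [IsAffine V] [IsAffine Y] [IsAffine W]
    (t : ∀ {T : Scheme.{u}}, Q.obj (op T) → (T ⟶ V))
    (ht : ∀ {T T' : Scheme.{u}} (s : T' ⟶ T) (q : Q.obj (op T)), t (Q.map s.op q) = s ≫ t q)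
    (f : Y ⟶ V) [Flat f] [Surjective f] [LocallyOfFinitePresentation f] (π : W ⟶ Y)
    (w : Q.obj (op W)) (hw : t w = π ≫ f)
    (huniv : ∀ {T : Scheme.{u}} (y : T ⟶ Y) (q : Q.obj (op T)), t q = y ≫ f →
      ∃! m : T ⟶ W, m ≫ π = y ∧ Q.map m.op w = q) :
    ∃ (Z : Scheme.{u}) (_ : IsAffine Z) (z : Q.obj (op Z)) (h : W ⟶ Z),
      IsPullback h π (t z) f ∧ Q.map h.op z = w ∧
      ∀ {T : Scheme.{u}} (q : Q.obj (op T)), ∃! m : T ⟶ Z, Q.map m.op z = q := by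
  have comp {T T' T'' : Scheme.{u}} (a : T ⟶ T') (b : T' ⟶ T'') (q : Q.obj (op T'')) :
      Q.map (a ≫ b).op q = Q.map a.op (Q.map b.op q) := by
    rw [op_comp, Functor.map_comp]; rfl
  -- A point of `W` is a point of `Y` together with an element of `Q`; equality in `W` is tested on
  -- these two components throughout.
  have uniq {T : Scheme.{u}} (m m' : T ⟶ W) (h : m ≫ π = m' ≫ π)
      (h' : Q.map m.op w = Q.map m'.op w) : m = m' := by
    have e : t (Q.map m'.op w) = (m' ≫ π) ≫ f := by rw [ht, hw, Category.assoc]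
    exact (huniv _ _ e).unique ⟨h, h'⟩ ⟨rfl, rfl⟩
  -- The descent datum keeps the element of `Q` and changes only the point of `Y` to the given `y`.
  obtain ⟨a, ⟨ha₁, ha₂⟩, -⟩ := huniv (pullback.snd (π ≫ f) f)
    (Q.map (pullback.fst (π ≫ f) f).op w) (by rw [ht, hw, pullback.condition])
  have ha₂' {T : Scheme.{u}} (m : T ⟶ W) (y : T ⟶ Y) (e : m ≫ π ≫ f = y ≫ f) :
      Q.map (pullback.lift m y e ≫ a).op w = Q.map m.op w := by
    rw [comp, ha₂, ← comp, pullback.lift_fst]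
  have ha₁' {T : Scheme.{u}} (m : T ⟶ W) (y : T ⟶ Y) (e : m ≫ π ≫ f = y ≫ f) :
      (pullback.lift m y e ≫ a) ≫ π = y := by
    rw [Category.assoc, ha₁, pullback.lift_snd]
  obtain ⟨Z, hZ, h, q, hpb, hh⟩ := exists_descent f π a ha₁
    (uniq _ _ (by rw [ha₁', Category.id_comp]) (ha₂' _ _ _))
    (fun m y y' e e' e'' => uniq _ _ (by rw [ha₁', ha₁']) (by rw [ha₂', ha₂', ha₂']))
  have hf : Flat h := MorphismProperty.of_isPullback hpb.flip ‹_›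
  have hs : Surjective h := MorphismProperty.of_isPullback hpb.flip ‹_›
  have hl : LocallyOfFinitePresentation h := MorphismProperty.of_isPullback hpb.flip ‹_›
  have hh' {T : Scheme.{u}} (m : T ⟶ W) (y : T ⟶ Y) (e : m ≫ π ≫ f = y ≫ f) :
      (pullback.lift m y e ≫ a) ≫ h = m ≫ h := by
    rw [Category.assoc, ← hh, pullback.lift_fst_assoc]
  -- Two points `m`, `m'` of `W` with the same image in `Z` satisfy `m' = a (m, π m')`, as both
  -- sides agree in `Z` and in `Y`. Hence they carry the same element of `Q`, and `w` descends to
  -- `Z`.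
  obtain ⟨z, hz⟩ := fppf_glue Q hQ h w (by
    intro T m m' e
    have e' : m ≫ π ≫ f = (m' ≫ π) ≫ f := by
      rw [Category.assoc, ← hpb.w, reassoc_of% e]
    have : m' = pullback.lift m (m' ≫ π) e' ≫ a :=
      hpb.hom_ext (by rw [hh', e]) (by rw [ha₁'])
    rw [this, ha₂'])
  have htz : t z = q := by
    have : Epi h := by
      have : EffectiveEpi h := inferInstance
      infer_instance
    rw [← cancel_epi h, ← ht, hz, hw, hpb.w]
  refine ⟨Z, hZ, z, h, htz ▸ hpb, hz, ?_⟩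
  intro T p
  have hepi : EffectiveEpi (pullback.fst (t p) f) := inferInstance
  obtain ⟨m, ⟨hm₁, hm₂⟩, hm₃⟩ := huniv (pullback.snd (t p) f) (Q.map (pullback.fst (t p) f).op p)
    (by rw [ht, pullback.condition])
  -- Over `T ×_V Y` the element gives a map to `W`, hence to `Z`; that map descends to `T` because
  -- representable functors are fppf sheaves.
  obtain ⟨r, hr⟩ := fppf_glue (yoneda.obj Z)
    (GrothendieckTopology.Subcanonical.isSheaf_of_isRepresentable _) (pullback.fst (t p) f)
    (m ≫ h) (by
      intro T' b b' e
      change b ≫ m ≫ h = b' ≫ m ≫ h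
      have e' : (b ≫ m) ≫ π ≫ f = (b' ≫ pullback.snd (t p) f) ≫ f := by
        rw [Category.assoc, reassoc_of% hm₁, ← pullback.condition, Category.assoc,
          ← pullback.condition, reassoc_of% e]
      have : b' ≫ m = pullback.lift (b ≫ m) _ e' ≫ a := by
        apply uniq
        · rw [ha₁', Category.assoc, hm₁]
        · rw [ha₂', comp b' m, comp b m, hm₂, ← comp, ← comp, e]
      have e2 := hh' _ _ e'
      rw [← this] at e2
      rw [← Category.assoc, ← Category.assoc, e2])
  change pullback.fst (t p) f ≫ r = m ≫ h at hr
  refine ⟨r, ?_, ?_⟩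
  · apply fppf_injective Q hQ (pullback.fst (t p) f)
    rw [← comp, hr, comp, hz, hm₂]
  · intro r' hr'
    change Q.map r'.op z = p at hr'
    rw [← cancel_epi (pullback.fst (t p) f), hr]
    have e : (pullback.fst (t p) f ≫ r') ≫ q = pullback.snd (t p) f ≫ f := by
      rw [← htz, Category.assoc, ← ht, hr', pullback.condition]
    have := hm₃ (hpb.lift _ _ e) ⟨hpb.lift_snd _ _ _, by
      rw [← hz, ← comp, hpb.lift_fst, comp, hr']⟩
    rw [← this, hpb.lift_fst]

end

end FrobBundle

namespace FrobBundle

/-! ### Nilpotent thickenings -/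

/-- Each `p`-th power improves a congruence by one power of `I`, because `p ∈ I`. Consequently the
`p ^ m`-th power of a lift does not depend on the lift, which makes such powers of sections globally
liftable. -/
theorem pow_prime_pow_eq_of_sub_mem {R : Type*} [CommRing R] {p : ℕ} (hp : p.Prime) {I : Ideal R}
    (hpI : (p : R) ∈ I) {m : ℕ} (hm : I ^ m = ⊥) {a b : R} (h : a - b ∈ I) :
    a ^ p ^ m = b ^ p ^ m := by
  have key : ∀ n, a ^ p ^ n - b ^ p ^ n ∈ I ^ (n + 1) := by
    intro n
    induction n with
    | zero => simpa using h
    | succ n ih =>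
      obtain ⟨d, hd⟩ : ∃ d, d = a ^ p ^ n - b ^ p ^ n := ⟨_, rfl⟩
      rw [← hd] at ih
      obtain ⟨r, hr⟩ := exists_add_pow_prime_eq hp (b ^ p ^ n) d
      have e : a ^ p ^ n = b ^ p ^ n + d := by rw [hd]; ring
      -- With `d ∈ I ^ (n + 1)`, the first term lies in `I ^ ((n + 1) p)`, where `(n + 1) p ≥ n + 2`
      -- as `p ≥ 2`; the second lies in `I · I ^ (n + 1)` because of the factor `p`.
      have : a ^ p ^ (n + 1) - b ^ p ^ (n + 1) = d ^ p + (p : R) * d * (b ^ p ^ n * r) := by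
        rw [pow_succ, pow_mul, pow_mul, e, hr]
        ring
      rw [this]
      refine Ideal.add_mem _ ?_ (Ideal.mul_mem_right _ _ ?_)
      · have h1 : d ^ p ∈ (I ^ (n + 1)) ^ p := Ideal.pow_mem_pow ih p
        rw [← pow_mul] at h1
        refine Ideal.pow_le_pow_right ?_ h1
        have := hp.two_le
        nlinarith
      · rw [pow_succ' I (n + 1)]
        exact Ideal.mul_mem_mul hpI ih
  rw [← sub_eq_zero, ← Ideal.mem_bot, ← hm]
  exact Ideal.pow_le_pow_right (Nat.le_succ m) (key m)

/-- The image of `R` in `S` also contains the image of `K`, so the universal property retracts `S`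
onto it. -/
theorem surjective_of_isPushout {A K R S : CommRingCat.{u}} {e : A ⟶ K} {a : A ⟶ R} {r : R ⟶ S}
    {b : K ⟶ S} (h : IsPushout a e r b) (he : Function.Surjective e) :
    Function.Surjective r := by
  let T : Subring S := r.hom.range
  let r' : R ⟶ CommRingCat.of T := CommRingCat.ofHom r.hom.rangeRestrict
  let i : CommRingCat.of T ⟶ S := CommRingCat.ofHom T.subtype
  have hb (x : K) : b.hom x ∈ T := by
    obtain ⟨y, rfl⟩ := he x
    exact ⟨a.hom y, congr($(h.w).hom y)⟩
  let b' : K ⟶ CommRingCat.of T := CommRingCat.ofHom (b.hom.codRestrict T hb)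
  have hri : r' ≫ i = r := rfl
  have hbi : b' ≫ i = b := rfl
  have w : a ≫ r' = e ≫ b' := by
    ext x
    exact congr($(h.w).hom x)
  have : h.desc r' b' w ≫ i = 𝟙 S := by
    apply h.hom_ext
    · rw [h.inl_desc_assoc, hri, Category.comp_id]
    · rw [h.inr_desc_assoc, hbi, Category.comp_id]
  intro s
  obtain ⟨x, hx⟩ := ((h.desc r' b' w).hom s).2
  exact ⟨x, hx.trans congr($(this).hom s)⟩

/-- The quotient of `R` by the extended kernel is itself a cocone, so the projection onto it factors
through `S`. -/
theorem ker_le_of_isPushout {A K R S : CommRingCat.{u}} {e : A ⟶ K} {a : A ⟶ R} {r : R ⟶ S}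
    {b : K ⟶ S} (h : IsPushout a e r b) (he : Function.Surjective e) :
    RingHom.ker r.hom ≤ (RingHom.ker e.hom).map a.hom := by
  let J := (RingHom.ker e.hom).map a.hom
  let π : R ⟶ CommRingCat.of (R ⧸ J) := CommRingCat.ofHom (Ideal.Quotient.mk J)
  have hk : RingHom.ker e.hom ≤ RingHom.ker (a ≫ π).hom := by
    intro x hx
    exact Ideal.Quotient.eq_zero_iff_mem.2 (Ideal.mem_map_of_mem _ hx)
  let b' : K ⟶ CommRingCat.of (R ⧸ J) :=
    CommRingCat.ofHom (RingHom.liftOfSurjective e.hom he ⟨(a ≫ π).hom, hk⟩)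
  have w : a ≫ π = e ≫ b' := by
    ext x
    exact (RingHom.liftOfRightInverse_comp_apply _ _ (Function.rightInverse_surjInv he)
      ⟨(a ≫ π).hom, hk⟩ x).symm
  intro x hx
  have : π.hom x = 0 := by
    have h2 : r ≫ h.desc π b' w = π := h.inl_desc _ _ _
    rw [← h2]
    change (h.desc π b' w).hom (r.hom x) = 0
    rw [show r.hom x = 0 from hx, map_zero]
  exact Ideal.Quotient.eq_zero_iff_mem.1 this

section Thickening

variable {A K : CommRingCat.{u}} {e : A ⟶ K} {W₀ W : Scheme.{u}} {i : W₀ ⟶ W}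
  {q₀ : W₀ ⟶ Spec K} {q : W ⟶ Spec A}

/-- On affine opens, base change along `Spec K ⟶ Spec A` is a tensor product of rings; surjectivity
and nilpotence of the kernel of `A ⟶ K` are thus inherited by sections. -/
theorem isPushout_app_of_isPullback (h : IsPullback i q₀ q (Spec.map e)) {U : W.Opens}
    (hU : IsAffineOpen U) : ∃ (a : A ⟶ Γ(W, U)) (b : K ⟶ Γ(W₀, i ⁻¹ᵁ U)),
      IsPushout a e (i.app U) b := by
  have hi := (isIso_pushoutSection_iff ..).1 (isIso_pushoutSection_of_isAffineOpen h (US := ⊤)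
    (UT := ⊤) (UX := U) (UY := i ⁻¹ᵁ U) le_top le_top (by simp) (isAffineOpen_top _)
    (isAffineOpen_top _) hU)
  have e1 : (Spec.map e).appLE ⊤ ⊤ le_top = (Spec.map e).appTop := by
    rw [Scheme.Hom.appTop, Scheme.Hom.app_eq_appLE]
    rfl
  have e2 : i.appLE U (i ⁻¹ᵁ U) le_rfl = i.app U := by
    rw [Scheme.Hom.app_eq_appLE]
  rw [e1, e2] at hi
  refine ⟨(Scheme.ΓSpecIso A).inv ≫ q.appLE ⊤ U le_top, (Scheme.ΓSpecIso K).inv ≫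
    q₀.appLE ⊤ (i ⁻¹ᵁ U) le_top, ?_⟩
  refine IsPushout.of_iso hi (Scheme.ΓSpecIso A) (Iso.refl _) (Scheme.ΓSpecIso K) (Iso.refl _)
    ?_ ?_ ?_ ?_
  · simp
  · exact Scheme.ΓSpecIso_naturality e
  · simp
  · simp

theorem app_surjective_of_isPullback (h : IsPullback i q₀ q (Spec.map e))
    (he : Function.Surjective e) {U : W.Opens} (hU : IsAffineOpen U) :
    Function.Surjective (i.app U) := by
  obtain ⟨a, b, hab⟩ := isPushout_app_of_isPullback h hU
  exact surjective_of_isPushout hab he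

theorem ker_app_pow_eq_bot (h : IsPullback i q₀ q (Spec.map e))
    (he : Function.Surjective e) {m : ℕ} (hm : RingHom.ker e.hom ^ m = ⊥) {U : W.Opens}
    (hU : IsAffineOpen U) : RingHom.ker (i.app U).hom ^ m = ⊥ := by
  obtain ⟨a, b, hab⟩ := isPushout_app_of_isPullback h hU
  rw [eq_bot_iff]
  refine (Ideal.pow_right_mono (ker_le_of_isPushout hab he) m).trans ?_
  rw [← Ideal.map_pow, hm, Ideal.map_bot]

theorem surjective_of_ker_nilpotent (he : Function.Surjective e) {m : ℕ}
    (hm : RingHom.ker e.hom ^ m = ⊥) : Surjective (Spec.map e) := by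
  constructor
  intro x
  have hx : RingHom.ker e.hom ≤ x.asIdeal := by
    intro a ha
    have : a ^ m ∈ (⊥ : Ideal A) := hm ▸ Ideal.pow_mem_pow ha m
    rw [Ideal.mem_bot] at this
    exact x.2.mem_of_pow_mem m (this ▸ x.asIdeal.zero_mem)
  have := range_comap_of_surjective _ e.hom he
  have hx' : x ∈ Set.range (PrimeSpectrum.comap e.hom) := by
    rw [this]
    exact hx
  exact hx'

theorem surjective_of_isPullback (h : IsPullback i q₀ q (Spec.map e))
    (he : Function.Surjective e) {m : ℕ} (hm : RingHom.ker e.hom ^ m = ⊥) : Surjective i :=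
  have := surjective_of_ker_nilpotent he hm
  MorphismProperty.of_isPullback h.flip this

theorem isClosedImmersion_of_isPullback (h : IsPullback i q₀ q (Spec.map e))
    (he : Function.Surjective e) : IsClosedImmersion i :=
  have := IsClosedImmersion.spec_of_surjective e he
  MorphismProperty.of_isPullback h.flip this

theorem preimage_le_preimage_iff [Surjective i] {U V : W.Opens} :
    i ⁻¹ᵁ U ≤ i ⁻¹ᵁ V ↔ U ≤ V := by
  refine ⟨fun h x hx => ?_, fun h x hx => h hx⟩
  obtain ⟨y, rfl⟩ := i.surjective x
  exact h hx

/-- Invertibility of a section is a condition at points, and every point of `W` comes from `W₀`. -/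
theorem isUnit_of_isUnit_app [Surjective i] {U : W.Opens} {s : Γ(W, U)}
    (h : IsUnit (i.app U s)) : IsUnit s := by
  have h1 : W.basicOpen s = U := by
    refine le_antisymm (W.basicOpen_le s) ?_
    rw [← preimage_le_preimage_iff (i := i), Scheme.preimage_basicOpen]
    exact (Scheme.basicOpen_of_isUnit _ h).ge
  refine RingedSpace.isUnit_of_isUnit_germ W.toRingedSpace U s fun x hx => ?_
  exact (Scheme.mem_basicOpen _ _ _ hx).1 (h1.ge hx)

end Thickening

end FrobBundle

namespace FrobBundle

section Thickening

variable {A K : CommRingCat.{u}} {e : A ⟶ K} {W₀ W : Scheme.{u}} {i : W₀ ⟶ W}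
  {q₀ : W₀ ⟶ Spec K} {q : W ⟶ Spec A}

theorem app_map_apply {X Y : Scheme.{u}} (f : X ⟶ Y) {U V : Y.Opens} (h : V ≤ U) (s : Γ(Y, U)) :
    f.app V (Y.presheaf.map (homOfLE h).op s) =
      X.presheaf.map (homOfLE (f.preimage_mono h)).op (f.app U s) :=
  congr($(f.naturality (homOfLE h).op).hom s)

theorem presheaf_map_map_apply (X : Scheme.{u}) {U V W : X.Opens} (h : V ≤ U) (h' : W ≤ V)
    (s : Γ(X, U)) : X.presheaf.map (homOfLE h').op (X.presheaf.map (homOfLE h).op s) =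
      X.presheaf.map (homOfLE (h'.trans h)).op s := by
  rw [← CategoryTheory.comp_apply, ← Functor.map_comp]
  rfl

theorem section_ext_of_affine {X : Scheme.{u}} {U : X.Opens} {s t : Γ(X, U)}
    (h : ∀ V : X.Opens, IsAffineOpen V → ∀ hV : V ≤ U,
      X.presheaf.map (homOfLE hV).op s = X.presheaf.map (homOfLE hV).op t) : s = t := by
  refine X.sheaf.eq_of_locally_eq' (fun V : {V : X.Opens // IsAffineOpen V ∧ V ≤ U} => V.1) U
    (fun V => homOfLE V.2.2) ?_ s t (fun V => h V.1 V.2.1 V.2.2)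
  intro x hx
  obtain ⟨_, ⟨V, hV, rfl⟩, hxV, hVU⟩ := X.isBasis_affineOpens.exists_subset_of_mem_open hx U.isOpen
  exact TopologicalSpace.Opens.mem_iSup.2 ⟨⟨V, hV, hVU⟩, hxV⟩

theorem natCast_section_eq_zero {p : ℕ} (hpK : (p : K) = 0) (q₀ : W₀ ⟶ Spec K) (U : W₀.Opens) :
    (p : Γ(W₀, U)) = 0 :=
  natCast_section p W₀ (natCast_eq_zero_of_ringHom p
    (q₀.appTop.hom.comp (Scheme.ΓSpecIso K).inv.hom) hpK) U

/-- Lifts of `g` exist on affine opens; their `p ^ m`-th powers are independent of choices and so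
glue. This replaces a cohomological argument and needs no assumption on `W`. -/
theorem exists_appTop_eq_pow (h : IsPullback i q₀ q (Spec.map e))
    (he : Function.Surjective e) {p : ℕ} (hp : p.Prime) (hpK : (p : K) = 0) {m : ℕ}
    (hm : RingHom.ker e.hom ^ m = ⊥) (g : Γ(W₀, ⊤)) :
    ∃ s : Γ(W, ⊤), i.appTop s = g ^ p ^ m := by
  have hl (U : W.affineOpens) : ∃ l : Γ(W, U), i.app U l =
      W₀.presheaf.map (homOfLE le_top).op g := app_surjective_of_isPullback h he U.2 _
  choose l hl using hl
  obtain ⟨s, hs, -⟩ := W.sheaf.existsUnique_gluing' (fun U : W.affineOpens => U.1) ⊤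
    (fun U => homOfLE le_top) (iSup_affineOpens_eq_top W).ge (fun U => l U ^ p ^ m) (by
      intro U U'
      refine section_ext_of_affine fun V hV hVU => ?_
      change W.presheaf.map (homOfLE hVU).op (W.presheaf.map (homOfLE inf_le_left).op _) =
        W.presheaf.map (homOfLE hVU).op (W.presheaf.map (homOfLE inf_le_right).op _)
      rw [presheaf_map_map_apply, presheaf_map_map_apply, map_pow, map_pow]
      refine pow_prime_pow_eq_of_sub_mem hp (I := RingHom.ker (i.app V).hom) ?_
        (ker_app_pow_eq_bot h he hm hV) ?_
      · rw [RingHom.mem_ker, map_natCast, natCast_section_eq_zero hpK q₀]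
      · rw [RingHom.sub_mem_ker_iff]
        refine (app_map_apply ..).trans (Eq.trans ?_ (app_map_apply ..).symm)
        rw [hl, hl, presheaf_map_map_apply, presheaf_map_map_apply])
  refine ⟨s, W₀.sheaf.eq_of_locally_eq' (fun U : W.affineOpens => i ⁻¹ᵁ U.1) ⊤
    (fun U => homOfLE le_top) ?_ _ _ fun U => ?_⟩
  · rw [← Scheme.Hom.preimage_iSup, iSup_affineOpens_eq_top W]
    exact le_rfl
  · refine (app_map_apply i le_top s).symm.trans ?_
    have h1 : W.presheaf.map (homOfLE le_top).op s = l U ^ p ^ m := hs U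
    rw [h1, map_pow, hl]
    exact (map_pow (W₀.presheaf.map _).hom g _).symm

/-- A nilpotent thickening in residue characteristic `p` of an affine scheme is affine. The
criterion by affine basic opens generating the unit ideal is applied to the sections `l g` lifting
`g ^ p ^ m`: since `W₀ ⟶ W` is surjective, their basic opens are governed by those of `g`. -/
theorem isAffine_of_isPullback (h : IsPullback i q₀ q (Spec.map e))
    (he : Function.Surjective e) {p : ℕ} (hp : p.Prime) (hpK : (p : K) = 0) {m : ℕ}
    (hm : RingHom.ker e.hom ^ m = ⊥) [IsAffine W₀] : IsAffine W := by
  have hsurj := surjective_of_isPullback h he hm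
  have hm0 : p ^ m ≠ 0 := pow_ne_zero _ hp.ne_zero
  choose l hl using exists_appTop_eq_pow h he hp hpK hm
  have hb (g : Γ(W₀, ⊤)) : i ⁻¹ᵁ W.basicOpen (l g) = W₀.basicOpen g := by
    rw [Scheme.preimage_basicOpen_top, hl, Scheme.basicOpen_pow _ _ hm0.bot_lt]
  -- If the basic open of `g` lies in the trace of an affine open `O`, then the basic open of `l g`
  -- lies in `O` and is a basic open of `O`. Such `g` exist near every point.
  let s : Set Γ(W₀, ⊤) := {g | IsAffineOpen (W.basicOpen (l g))}
  have hs : Ideal.span s = ⊤ := by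
    rw [← (isAffineOpen_top W₀).iSup_basicOpen_eq_self_iff, eq_top_iff]
    intro x _
    obtain ⟨_, ⟨O, hO, rfl⟩, hxO, -⟩ := W.isBasis_affineOpens.exists_subset_of_mem_open
      (Set.mem_univ (i x)) isOpen_univ
    obtain ⟨g, hg, hxg⟩ := (isAffineOpen_top W₀).exists_basicOpen_le (V := i ⁻¹ᵁ O)
      ⟨x, hxO⟩ trivial
    have hgO : W.basicOpen (l g) ≤ O := by
      rw [← preimage_le_preimage_iff (i := i), hb]
      exact hg
    refine TopologicalSpace.Opens.mem_iSup.2 ⟨⟨g, ?_⟩, hxg⟩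
    have e : W.basicOpen (W.presheaf.map (homOfLE (le_top : O ≤ ⊤)).op (l g)) =
        W.basicOpen (l g) := by
      rw [Scheme.basicOpen_res]
      exact inf_eq_right.2 hgO
    change IsAffineOpen _
    rw [← e]
    exact hO.basicOpen _
  refine isAffine_of_isAffineOpen_basicOpen (l '' s) ?_ (by rintro _ ⟨g, hg, rfl⟩; exact hg)
  -- `y ↦ y ^ p ^ m` is additive on `W₀`, so linear combinations can be lifted up to this power. For
  -- `y = 1` one obtains an element of the ideal that is a unit on `W₀`, hence a unit.
  have key : ∀ y ∈ Ideal.span s, ∃ z ∈ Ideal.span (l '' s), i.appTop z = y ^ p ^ m := by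
    intro y hy
    induction hy using Submodule.span_induction with
    | mem y hy => exact ⟨l y, Ideal.subset_span ⟨y, hy, rfl⟩, hl y⟩
    | zero => exact ⟨0, Ideal.zero_mem _, by rw [map_zero, zero_pow hm0]⟩
    | add x y _ _ hx hy =>
      obtain ⟨a, ha, ha'⟩ := hx
      obtain ⟨b, hb, hb'⟩ := hy
      refine ⟨a + b, Ideal.add_mem _ ha hb, ?_⟩
      obtain ⟨r, hr⟩ := exists_add_pow_prime_pow_eq hp x y m
      rw [map_add, ha', hb', hr, natCast_section_eq_zero hpK q₀]
      ring
    | smul a x _ hx =>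
      obtain ⟨b, hb, hb'⟩ := hx
      refine ⟨l a * b, Ideal.mul_mem_left _ _ hb, ?_⟩
      rw [map_mul, hl, hb', smul_eq_mul, mul_pow]
  obtain ⟨z, hz, hz'⟩ := key 1 (hs ▸ Submodule.mem_top)
  refine Ideal.eq_top_of_isUnit_mem _ hz (isUnit_of_isUnit_app (i := i) (U := ⊤) ?_)
  rw [one_pow] at hz'
  exact hz' ▸ isUnit_one

end Thickening

/-- Flat morphisms locally of finite presentation are open, so one chart of the fppf cover, shrunk
on source and target, already surjects onto a neighbourhood of the given point. -/
theorem exists_affine_section {P X : Scheme.{u}} (q : P ⟶ X)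
    (h : Sieve.generate (Presieve.singleton q) ∈ Scheme.fppfTopology X) {x : X} {U : X.Opens}
    (hx : x ∈ U) :
    ∃ (V : X.Opens) (Y : Scheme.{u}) (f : Y ⟶ V) (s : Y ⟶ P),
      IsAffineOpen V ∧ IsAffine Y ∧ Flat f ∧ Surjective f ∧ LocallyOfFinitePresentation f ∧
      x ∈ V ∧ V ≤ U ∧ s ≫ q = f ≫ V.ι := by
  have : Scheme.fppfPrecoverage.{u}.HasIsos :=
    ⟨fun {_ _} f _ => Scheme.Hom.singleton_mem_fppfPrecoverage f⟩
  obtain ⟨R, hR, hle⟩ := Scheme.fppfPrecoverage.mem_toGrothendieck_iff_of_isStableUnderComposition.1 h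
  rw [Precoverage.mem_iff_exists_zeroHypercover] at hR
  obtain ⟨E, rfl⟩ := hR
  obtain ⟨hE, hE'⟩ := (Scheme.ofArrows_mem_precoverage_iff ..).1 E.mem₀
  obtain ⟨a, y, rfl⟩ := hE x
  obtain ⟨hfl, hlo⟩ := hE' a
  obtain ⟨_, s, _, ⟨⟩, hs⟩ := hle _ _ ⟨a⟩
  generalize E.f a = g at *
  obtain ⟨_, ⟨W, hW, rfl⟩, hxW, hWU⟩ := X.isBasis_affineOpens.exists_subset_of_mem_open hx U.isOpen
  obtain ⟨_, ⟨O, hO, rfl⟩, hyO, hOW⟩ := (E.X a).isBasis_affineOpens.exists_subset_of_mem_open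
    (show y ∈ g ⁻¹ᵁ W from hxW) (g ⁻¹ᵁ W).isOpen
  obtain ⟨r, hr, hxr⟩ := hW.exists_basicOpen_le (V := ⟨g '' O, g.isOpenMap _ O.isOpen⟩)
    ⟨g y, y, hyO, rfl⟩ hxW
  -- The preimage in the affine `O` of a basic open contained in the image of `O`: it is affine and
  -- still surjects onto that basic open.
  let O' : (E.X a).Opens := (E.X a).basicOpen (g.appLE W O hOW r)
  have e : O' = O ⊓ g ⁻¹ᵁ X.basicOpen r := Scheme.basicOpen_appLE ..
  have hO'V : O' ≤ g ⁻¹ᵁ X.basicOpen r := e.trans_le inf_le_right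
  refine ⟨X.basicOpen r, O', g.resLE _ _ hO'V, O'.ι ≫ s, hW.basicOpen r, hO.basicOpen _,
    inferInstance, ⟨?_⟩, inferInstance, hxr, (X.basicOpen_le r).trans hWU, ?_⟩
  · rintro ⟨v, hv⟩
    obtain ⟨z, hz, hzv⟩ := hr hv
    refine ⟨⟨z, e.ge ⟨hz, ?_⟩⟩, Subtype.ext ?_⟩
    · change g z ∈ X.basicOpen r
      rwa [hzv]
    · exact (Scheme.Hom.coe_resLE_apply ..).trans hzv
  · rw [Category.assoc, hs, Scheme.Hom.resLE_comp_ι]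

end FrobBundle

namespace FrobBundle

/-! ### Gluing morphisms over a base, and points of principal bundles -/

variable {S : Scheme.{u}}

/-- The fppf topology is subcanonical. The glued morphism respects the structure maps to `S` because
morphisms to `S` are separated for the same cover. -/
theorem exists_glue_over {T M : Over S} {R : Sieve T.left} (hR : R ∈ Scheme.fppfTopology T.left)
    (m : ∀ {T₂ : Over S} (r : T₂ ⟶ T), R r.left → (T₂ ⟶ M))
    (hm : ∀ {T₂ T₃ : Over S} (r : T₂ ⟶ T) (hr : R r.left) (a : T₃ ⟶ T₂) (r' : T₃ ⟶ T)
      (hr' : R r'.left), a ≫ r = r' → m r' hr' = a ≫ m r hr) :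
    ∃! m₀ : T ⟶ M, ∀ {T₂ : Over S} (r : T₂ ⟶ T) (hr : R r.left), r ≫ m₀ = m r hr := by
  have hs (Z : Scheme.{u}) : Presieve.IsSheafFor (yoneda.obj Z) R.arrows :=
    GrothendieckTopology.Subcanonical.isSheaf_of_isRepresentable (J := Scheme.fppfTopology)
      (yoneda.obj Z) R hR
  let o {Y : Scheme.{u}} (r : Y ⟶ T.left) : Over.mk (r ≫ T.hom) ⟶ T := Over.homMk r
  let x : Presieve.FamilyOfElements (yoneda.obj M.left) R.arrows := fun Y r hr => (m (o r) hr).left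
  have hx : x.Compatible := by
    rw [Presieve.compatible_iff_sieveCompatible]
    intro Y Z r s hr
    let a : Over.mk ((s ≫ r) ≫ T.hom) ⟶ Over.mk (r ≫ T.hom) := Over.homMk s (by simp)
    have := hm (o r) hr a (o (s ≫ r)) (R.downward_closed hr s) (by ext1; rfl)
    exact congr(($this).left)
  obtain ⟨m₀, hm₀, hu⟩ := hs M.left x hx
  have hw : m₀ ≫ M.hom = T.hom := by
    refine (hs S).isSeparatedFor.ext fun Y r hr => ?_
    have e : r ≫ m₀ = (m (o r) hr).left := hm₀ r hr
    change r ≫ m₀ ≫ M.hom = r ≫ T.hom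
    rw [reassoc_of% e]
    exact Over.w (m (o r) hr)
  refine ⟨Over.homMk m₀ hw, fun {T₂} r hr => ?_, fun m' hm' => ?_⟩
  · let a : T₂ ⟶ Over.mk (r.left ≫ T.hom) := Over.homMk (𝟙 _) (by simp)
    rw [hm (o r.left) hr a r hr (by ext1; exact Category.id_comp _)]
    ext1
    exact (hm₀ r.left hr).trans (Category.id_comp _).symm
  · ext1
    refine hu m'.left fun Y r hr => ?_
    exact congr(($(hm' (o r) hr)).left)

/-- An action of the group scheme `G` on `M`, given on points. -/
structure PtAct (G M : Over S) [GrpObj G] where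
  /-- the action on points -/
  act : ∀ {T : Over S}, (T ⟶ G) → (T ⟶ M) → (T ⟶ M)
  comp_act : ∀ {T T' : Over S} (s : T' ⟶ T) (g : T ⟶ G) (m : T ⟶ M),
    s ≫ act g m = act (s ≫ g) (s ≫ m)
  one_act : ∀ {T : Over S} (m : T ⟶ M), act 1 m = m
  mul_act : ∀ {T : Over S} (g h : T ⟶ G) (m : T ⟶ M), act (g * h) m = act g (act h m)

namespace PtAct

variable {G M : Over S} [GrpObj G] (α : PtAct G M)

theorem inv_act_eq_iff {T : Over S} (g : T ⟶ G) (m m' : T ⟶ M) :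
    α.act g⁻¹ m = m' ↔ m = α.act g m' := by
  constructor
  · rintro rfl
    rw [← α.mul_act, mul_inv_cancel, α.one_act]
  · rintro rfl
    rw [← α.mul_act, inv_mul_cancel, α.one_act]

/-- The module object defined by an action on points. -/
@[reducible] def toModObj : ModObj G M where
  smul := α.act (CartesianMonoidalCategory.fst _ _) (CartesianMonoidalCategory.snd _ _)
  one_smul := by
    change η[G] ▷ M ≫ α.act _ _ = (λ_ M).hom
    refine (α.comp_act _ _ _).trans ?_
    rw [CartesianMonoidalCategory.whiskerRight_fst, CartesianMonoidalCategory.whiskerRight_snd]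
    have e : CartesianMonoidalCategory.fst (𝟙_ (Over S)) M ≫ η[G] = 1 := by
      rw [Hom.one_def]
      congr 1
    rw [e, α.one_act]
    exact (CartesianMonoidalCategory.leftUnitor_hom M).symm
  mul_smul := by
    change μ[G] ▷ M ≫ α.act _ _ = (α_ G G M).hom ≫ G ◁ α.act _ _ ≫ α.act _ _
    refine (α.comp_act _ _ _).trans ?_
    rw [CartesianMonoidalCategory.whiskerRight_fst, CartesianMonoidalCategory.whiskerRight_snd]
    refine Eq.trans ?_ (congrArg _ (α.comp_act _ _ _).symm)
    refine Eq.trans ?_ (α.comp_act _ _ _).symm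
    rw [CartesianMonoidalCategory.whiskerLeft_fst, CartesianMonoidalCategory.whiskerLeft_snd,
      α.comp_act]
    have e : CartesianMonoidalCategory.fst (G ⊗ G) M ≫ μ[G] =
      (CartesianMonoidalCategory.fst (G ⊗ G) M ≫ CartesianMonoidalCategory.fst _ _) *
        (CartesianMonoidalCategory.fst (G ⊗ G) M ≫ CartesianMonoidalCategory.snd _ _) := by
      rw [← MonObj.comp_mul, Hom.mul_def]
      simp
    rw [e, α.mul_act]
    simp [α.comp_act]

theorem lift_toModObj {T : Over S} (g : T ⟶ G) (m : T ⟶ M) :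
    letI := α.toModObj
    CartesianMonoidalCategory.lift g m ≫ γ[G, M] = α.act g m := by
  refine (α.comp_act _ _ _).trans ?_
  rw [CartesianMonoidalCategory.lift_fst, CartesianMonoidalCategory.lift_snd]

/-- The action on points defined by a module object. -/
def ofModObj (G M : Over S) [GrpObj G] [ModObj G M] : PtAct G M where
  act g m := CartesianMonoidalCategory.lift g m ≫ γ[G, M]
  comp_act s g m := by rw [CartesianMonoidalCategory.comp_lift_assoc]
  one_act := lift_one_smul
  mul_act := lift_mul_smul

end PtAct

/-! ### Translates and quotients of points of a principal bundle -/

namespace PrincipalBundle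

variable {G X : Over S} [GrpObj G] (P : PrincipalBundle G X)

/-- The translate `g • x` of a point of a principal bundle. -/
def smul {T : Over S} (g : T ⟶ G) (x : T ⟶ P.total) : T ⟶ P.total :=
  CartesianMonoidalCategory.lift g x ≫ γ[G, P.total]

theorem comp_smul {T T' : Over S} (s : T' ⟶ T) (g : T ⟶ G) (x : T ⟶ P.total) :
    s ≫ P.smul g x = P.smul (s ≫ g) (s ≫ x) := (PtAct.ofModObj G P.total).comp_act s g x

theorem mul_smul {T : Over S} (g h : T ⟶ G) (x : T ⟶ P.total) :
    P.smul (g * h) x = P.smul g (P.smul h x) := lift_mul_smul g h x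

theorem smul_comp_proj {T : Over S} (g : T ⟶ G) (x : T ⟶ P.total) :
    P.smul g x ≫ P.proj = x ≫ P.proj := P.smul_proj g x

theorem smul_left_proj {T : Over S} (g : T ⟶ G) (x : T ⟶ P.total) :
    (P.smul g x).left ≫ P.proj.left = x.left ≫ P.proj.left := congr(($(P.smul_proj g x)).left)

/-- The element `a / b` of `G` with `(a / b) • b = a`. -/
def div {T : Over S} (a b : T ⟶ P.total) (h : a ≫ P.proj = b ≫ P.proj) : T ⟶ G :=
  (P.simply_transitive a b h).choose

theorem div_smul {T : Over S} (a b : T ⟶ P.total) (h : a ≫ P.proj = b ≫ P.proj) :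
    P.smul (P.div a b h) b = a := (P.simply_transitive a b h).choose_spec.1

theorem eq_div {T : Over S} {a b : T ⟶ P.total} (h : a ≫ P.proj = b ≫ P.proj) {g : T ⟶ G}
    (hg : P.smul g b = a) : g = P.div a b h := (P.simply_transitive a b h).choose_spec.2 g hg

theorem comp_div {T T' : Over S} (s : T' ⟶ T) {a b : T ⟶ P.total} (h : a ≫ P.proj = b ≫ P.proj)
    (h' : (s ≫ a) ≫ P.proj = (s ≫ b) ≫ P.proj) :
    s ≫ P.div a b h = P.div (s ≫ a) (s ≫ b) h' := by
  apply P.eq_div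
  rw [← P.comp_smul, P.div_smul]

theorem div_smul_left {T : Over S} (g : T ⟶ G) {a b : T ⟶ P.total}
    (h : a ≫ P.proj = b ≫ P.proj) (h' : P.smul g a ≫ P.proj = b ≫ P.proj) :
    P.div (P.smul g a) b h' = g * P.div a b h := by
  symm
  apply P.eq_div
  rw [P.mul_smul, P.div_smul]

theorem div_self {T : Over S} (a : T ⟶ P.total) (h : a ≫ P.proj = a ≫ P.proj) :
    P.div a a h = 1 := (P.eq_div h (lift_one_smul a)).symm

theorem locally_lift (T : Over S) (t : T ⟶ X) :
    ∃ R ∈ Scheme.fppfTopology T.left, ∀ {T₂ : Over S} (r : T₂ ⟶ T), R r.left →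
      ∃ x : T₂ ⟶ P.total, x ≫ P.proj = r ≫ t := by
  refine ⟨_, Scheme.fppfTopology.pullback_stable t.left P.locally_trivial, ?_⟩
  rintro T₂ r ⟨_, s, _, ⟨⟩, hs⟩
  refine ⟨Over.homMk s ?_, ?_⟩
  · rw [← Over.w P.proj, reassoc_of% hs, Over.w, Over.w]
  · ext1
    exact hs

/-- A `G`-invariant family of points of `Z`, parametrised by the points of `P`, descends. -/
theorem exists_descent {T Z : Over S} (t : T ⟶ X)
    (ρ : ∀ {T₂ : Over S} (s : T₂ ⟶ T) (x : T₂ ⟶ P.total), x ≫ P.proj = s ≫ t → (T₂ ⟶ Z))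
    (hρ : ∀ {T₂ T₃ : Over S} (a : T₃ ⟶ T₂) (s : T₂ ⟶ T) (x : T₂ ⟶ P.total)
      (h : x ≫ P.proj = s ≫ t) (h' : (a ≫ x) ≫ P.proj = (a ≫ s) ≫ t),
      ρ (a ≫ s) (a ≫ x) h' = a ≫ ρ s x h)
    (hρ' : ∀ {T₂ : Over S} (s : T₂ ⟶ T) (g : T₂ ⟶ G) (x : T₂ ⟶ P.total)
      (h : x ≫ P.proj = s ≫ t) (h' : P.smul g x ≫ P.proj = s ≫ t),
      ρ s (P.smul g x) h' = ρ s x h) :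
    ∃! r : T ⟶ Z, ∀ {T₂ : Over S} (s : T₂ ⟶ T) (x : T₂ ⟶ P.total) (h : x ≫ P.proj = s ≫ t),
      s ≫ r = ρ s x h := by
  obtain ⟨R, hR, hx⟩ := P.locally_lift T t
  choose x hx using @hx
  -- Two points of `P` over the same point of `X` differ by an element of `G`, so invariance makes
  -- the value independent of the chosen local lift.
  have key {T₂ : Over S} (s : T₂ ⟶ T) (a b : T₂ ⟶ P.total) (ha : a ≫ P.proj = s ≫ t)
      (hb : b ≫ P.proj = s ≫ t) : ρ s a ha = ρ s b hb := by
    have e := P.div_smul a b (ha.trans hb.symm)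
    rw [← hρ' s (P.div a b (ha.trans hb.symm)) b hb (by rw [e]; exact ha)]
    congr 1
    exact e.symm
  obtain ⟨r, hr, hu⟩ := exists_glue_over hR (fun r h => ρ r (x r h) (hx r h)) (by
    rintro T₂ T₃ r hr a _ hr' rfl
    rw [← hρ a r _ _ (by rw [Category.assoc, hx, Category.assoc])]
    exact key ..)
  refine ⟨r, fun {T₂} s y h => ?_, fun r' hr' => hu r' fun s h => hr' s _ _⟩
  have hs : Presieve.IsSeparatedFor (yoneda.obj Z.left) (R.pullback s.left).arrows :=
    (GrothendieckTopology.Subcanonical.isSheaf_of_isRepresentable (J := Scheme.fppfTopology)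
      (yoneda.obj Z.left) _ (Scheme.fppfTopology.pullback_stable s.left hR)).isSeparatedFor
  ext1
  refine hs.ext fun Y a ha => ?_
  let b : Over.mk (a ≫ T₂.hom) ⟶ T₂ := Over.homMk a
  have e := (hr (b ≫ s) ha).trans ((key _ _ (b ≫ y) _
    (by rw [Category.assoc, h, Category.assoc])).trans (hρ b s y h _))
  rw [Category.assoc] at e
  exact congr(($e).left)

end PrincipalBundle

end FrobBundle

namespace FrobBundle

/-! ### Points of contracted products -/

variable {S : Scheme.{u}} {G X M : Over S} [GrpObj G] (P : PrincipalBundle G X)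

namespace PrincipalBundle

/-- The fibre product `P ×_X T`, as a scheme over `S`. -/
def fib {T : Scheme.{u}} (τ : T ⟶ X.left) : Over S :=
  Over.mk (pullback.fst P.proj.left τ ≫ P.total.hom)

/-- The projection `P ×_X T ⟶ P`. -/
def fibFst {T : Scheme.{u}} (τ : T ⟶ X.left) : P.fib τ ⟶ P.total :=
  Over.homMk (pullback.fst P.proj.left τ)

/-- The point of `P ×_X T` with given components. -/
def fibLift {T : Scheme.{u}} (τ : T ⟶ X.left) {T' : Over S} (x : T' ⟶ P.total)
    (s : T'.left ⟶ T) (h : x.left ≫ P.proj.left = s ≫ τ) : T' ⟶ P.fib τ :=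
  Over.homMk (pullback.lift x.left s h) ((pullback.lift_fst_assoc _ _ _ _).trans (Over.w x))

/-- The projection `P ×_X T ⟶ T`. -/
def fibSnd {T : Scheme.{u}} (τ : T ⟶ X.left) : (P.fib τ).left ⟶ T := pullback.snd P.proj.left τ

theorem fib_condition {T : Scheme.{u}} (τ : T ⟶ X.left) :
    (P.fibFst τ).left ≫ P.proj.left = P.fibSnd τ ≫ τ := pullback.condition

theorem fibLift_fst {T : Scheme.{u}} (τ : T ⟶ X.left) {T' : Over S} (x : T' ⟶ P.total)
    (s : T'.left ⟶ T) (h : x.left ≫ P.proj.left = s ≫ τ) :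
    P.fibLift τ x s h ≫ P.fibFst τ = x := by
  ext1
  exact pullback.lift_fst _ _ _

theorem fibLift_snd {T : Scheme.{u}} (τ : T ⟶ X.left) {T' : Over S} (x : T' ⟶ P.total)
    (s : T'.left ⟶ T) (h : x.left ≫ P.proj.left = s ≫ τ) :
    (P.fibLift τ x s h).left ≫ P.fibSnd τ = s := pullback.lift_snd _ _ _

theorem fib_ext {T : Scheme.{u}} {τ : T ⟶ X.left} {T' : Over S} {a b : T' ⟶ P.fib τ}
    (h₁ : a ≫ P.fibFst τ = b ≫ P.fibFst τ) (h₂ : a.left ≫ P.fibSnd τ = b.left ≫ P.fibSnd τ) :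
    a = b := by
  ext1
  exact pullback.hom_ext congr(($h₁).left) h₂

theorem comp_fibLift {T : Scheme.{u}} (τ : T ⟶ X.left) {T' T₂ : Over S} (a : T₂ ⟶ T')
    (x : T' ⟶ P.total) (s : T'.left ⟶ T) (h : x.left ≫ P.proj.left = s ≫ τ)
    (h' : (a ≫ x).left ≫ P.proj.left = (a.left ≫ s) ≫ τ) :
    a ≫ P.fibLift τ x s h = P.fibLift τ (a ≫ x) (a.left ≫ s) h' := by
  apply P.fib_ext
  · rw [Category.assoc, fibLift_fst, fibLift_fst]
  · rw [Over.comp_left, Category.assoc, fibLift_snd, fibLift_snd]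

theorem fibLift_fst_snd {T : Scheme.{u}} (τ : T ⟶ X.left) :
    P.fibLift τ (P.fibFst τ) (P.fibSnd τ) (P.fib_condition τ) = 𝟙 _ := by
  apply P.fib_ext
  · rw [fibLift_fst, Category.id_comp]
  · rw [fibLift_snd, Over.id_left, Category.id_comp]

theorem comp_left_proj {T T' : Over S} (a : T' ⟶ T) {x : T ⟶ P.total} {s : T.left ⟶ X.left}
    (h : x.left ≫ P.proj.left = s) : (a ≫ x).left ≫ P.proj.left = a.left ≫ s := by
  rw [Over.comp_left, Category.assoc, h]

end PrincipalBundle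

open PrincipalBundle

/-- A `T`-valued point of the contracted product of `P` and `M`: a point of `X` together with an
equivariant morphism from the corresponding torsor over `T` to `M`. -/
structure ContrPt (α : PtAct G M) (T : Scheme.{u}) where
  /-- the underlying point of `X` -/
  base : T ⟶ X.left
  /-- the equivariant morphism -/
  hom : P.fib base ⟶ M
  equivariant : ∀ {T' : Over S} (g : T' ⟶ G) (x : T' ⟶ P.total) (s : T'.left ⟶ T)
    (h : x.left ≫ P.proj.left = s ≫ base),
    P.fibLift base (P.smul g x) s ((P.smul_left_proj g x).trans h) ≫ hom =
      α.act g (P.fibLift base x s h ≫ hom)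

namespace ContrPt

variable {P} {α : PtAct G M} {T : Scheme.{u}}

/-- The value of the equivariant morphism at a point of `P`. -/
def ev (q : ContrPt P α T) {T' : Over S} (x : T' ⟶ P.total) (s : T'.left ⟶ T)
    (h : x.left ≫ P.proj.left = s ≫ q.base) : T' ⟶ M := P.fibLift q.base x s h ≫ q.hom

theorem comp_ev (q : ContrPt P α T) {T' T₂ : Over S} (a : T₂ ⟶ T') (x : T' ⟶ P.total)
    (s : T'.left ⟶ T) (h : x.left ≫ P.proj.left = s ≫ q.base)
    (h' : (a ≫ x).left ≫ P.proj.left = (a.left ≫ s) ≫ q.base) :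
    a ≫ q.ev x s h = q.ev (a ≫ x) (a.left ≫ s) h' := by
  rw [ev, ← Category.assoc, comp_fibLift]
  rfl

theorem ev_smul (q : ContrPt P α T) {T' : Over S} (g : T' ⟶ G) (x : T' ⟶ P.total)
    (s : T'.left ⟶ T) (h : x.left ≫ P.proj.left = s ≫ q.base)
    (h' : (P.smul g x).left ≫ P.proj.left = s ≫ q.base) :
    q.ev (P.smul g x) s h' = α.act g (q.ev x s h) := q.equivariant g x s h

theorem ev_congr (q : ContrPt P α T) {T' : Over S} {x x' : T' ⟶ P.total} {s s' : T'.left ⟶ T}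
    (hx : x = x') (hs : s = s') (h : x.left ≫ P.proj.left = s ≫ q.base) :
    q.ev x s h = q.ev x' s' (hx ▸ hs ▸ h) := by
  subst hx hs
  rfl

theorem ev_congr_left {q q' : ContrPt P α T} (e : q = q') {T' : Over S} (x : T' ⟶ P.total)
    (s : T'.left ⟶ T) (h : x.left ≫ P.proj.left = s ≫ q.base) :
    q.ev x s h = q'.ev x s (e ▸ h) := by
  subst e
  rfl

theorem ext_ev {q q' : ContrPt P α T} (hb : q.base = q'.base)
    (h : ∀ {T' : Over S} (x : T' ⟶ P.total) (s : T'.left ⟶ T)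
      (h : x.left ≫ P.proj.left = s ≫ q.base) (h' : x.left ≫ P.proj.left = s ≫ q'.base),
      q.ev x s h = q'.ev x s h') : q = q' := by
  obtain ⟨b, m, hm⟩ := q
  obtain ⟨b', m', hm'⟩ := q'
  obtain rfl : b = b' := hb
  have := h (P.fibFst b) (P.fibSnd b) (P.fib_condition b) (P.fib_condition b)
  dsimp only [ev] at this
  rw [fibLift_fst_snd, Category.id_comp, Category.id_comp] at this
  obtain rfl : m = m' := this
  rfl

section mk'

variable (τ : T ⟶ X.left)
  (f : ∀ {T' : Over S} (x : T' ⟶ P.total) (s : T'.left ⟶ T)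
    (_ : x.left ≫ P.proj.left = s ≫ τ), T' ⟶ M)
  (hf : ∀ {T' T₂ : Over S} (a : T₂ ⟶ T') (x : T' ⟶ P.total) (s : T'.left ⟶ T)
    (h : x.left ≫ P.proj.left = s ≫ τ) (h' : (a ≫ x).left ≫ P.proj.left = (a.left ≫ s) ≫ τ),
    a ≫ f x s h = f (a ≫ x) (a.left ≫ s) h')
  (hf' : ∀ {T' : Over S} (g : T' ⟶ G) (x : T' ⟶ P.total) (s : T'.left ⟶ T)
    (h : x.left ≫ P.proj.left = s ≫ τ) (h' : (P.smul g x).left ≫ P.proj.left = s ≫ τ),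
    f (P.smul g x) s h' = α.act g (f x s h))

-- A natural family is determined by its value at the universal point of `P ×_X T`, as in the Yoneda
-- lemma.
include hf in
theorem fibLift_comp_universal {T' : Over S} (x : T' ⟶ P.total) (s : T'.left ⟶ T)
    (h : x.left ≫ P.proj.left = s ≫ τ) :
    P.fibLift τ x s h ≫ f (P.fibFst τ) (P.fibSnd τ) (P.fib_condition τ) = f x s h := by
  rw [hf _ _ _ _ (by rw [fibLift_fst, fibLift_snd, h])]
  congr 1
  · exact P.fibLift_fst τ x s h
  · exact P.fibLift_snd τ x s h

/-- A point of the contracted product, defined by a natural equivariant family of values. -/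
def mk' : ContrPt P α T where
  base := τ
  hom := f (P.fibFst τ) (P.fibSnd τ) (P.fib_condition τ)
  equivariant g x s h := by
    rw [fibLift_comp_universal τ f hf, fibLift_comp_universal τ f hf]
    exact hf' g x s h _

theorem ev_mk' {T' : Over S} (x : T' ⟶ P.total) (s : T'.left ⟶ T)
    (h : x.left ≫ P.proj.left = s ≫ τ) : (mk' τ f hf hf').ev x s h = f x s h :=
  fibLift_comp_universal τ f hf x s h

end mk'

theorem comp_ev_comp {T' : Scheme.{u}} (r : T' ⟶ T) (q : ContrPt P α T) {T₁ T₂ : Over S}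
    (a : T₂ ⟶ T₁) (x : T₁ ⟶ P.total) (s : T₁.left ⟶ T')
    (h : x.left ≫ P.proj.left = s ≫ r ≫ q.base)
    (h' : (a ≫ x).left ≫ P.proj.left = (a.left ≫ s) ≫ r ≫ q.base) :
    a ≫ q.ev x (s ≫ r) (h.trans (Category.assoc _ _ _).symm) =
      q.ev (a ≫ x) ((a.left ≫ s) ≫ r) (h'.trans (Category.assoc _ _ _).symm) := by
  rw [q.comp_ev _ _ _ _ (by rw [h', Category.assoc, Category.assoc, Category.assoc])]
  exact q.ev_congr rfl (Category.assoc _ _ _).symm _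

/-- The pullback of points of the contracted product. -/
def map {T' : Scheme.{u}} (r : T' ⟶ T) (q : ContrPt P α T) : ContrPt P α T' :=
  mk' (r ≫ q.base) (fun x s h => q.ev x (s ≫ r) (h.trans (Category.assoc _ _ _).symm))
    (comp_ev_comp r q) (fun _ _ _ _ _ => q.ev_smul _ _ _ _ _)

theorem ev_map {T' : Scheme.{u}} (r : T' ⟶ T) (q : ContrPt P α T) {T₂ : Over S} (x : T₂ ⟶ P.total)
    (s : T₂.left ⟶ T') (h : x.left ≫ P.proj.left = s ≫ (q.map r).base) :
    (q.map r).ev x s h = q.ev x (s ≫ r) (h.trans (Category.assoc _ _ _).symm) := by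
  exact ev_mk' _ _ (comp_ev_comp r q) (fun _ _ _ _ _ => q.ev_smul _ _ _ _ _) x s h

theorem base_map {T' : Scheme.{u}} (r : T' ⟶ T) (q : ContrPt P α T) :
    (q.map r).base = r ≫ q.base := rfl

end ContrPt

open ContrPt

variable (α : PtAct G M)

/-- The contracted product of `P` and `M`, as a functor. -/
def contr : Scheme.{u}ᵒᵖ ⥤ Type u where
  obj T := ContrPt P α T.unop
  map r := TypeCat.ofHom fun q => q.map r.unop
  map_id T := by
    ext q
    refine ext_ev (Category.id_comp _) fun x s h h' => ?_
    exact (q.ev_map _ x s h).trans (q.ev_congr rfl (Category.comp_id _) _)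
  map_comp r r' := by
    ext q
    refine ext_ev (Category.assoc _ _ _) fun x s h h' => ?_
    refine (q.ev_map _ x s h).trans ?_
    refine Eq.trans ?_ ((q.map r.unop).ev_map r'.unop x s h').symm
    refine Eq.trans ?_ (q.ev_map r.unop x _ _).symm
    exact q.ev_congr rfl (Category.assoc _ _ _).symm _

/-- The base points glue because `X` is an fppf sheaf, and the values of the equivariant morphism at
each point of `P` glue because `M` is one. Naturality and equivariance of the result follow from
uniqueness of glueing. -/
theorem contr_isSheaf : Presieve.IsSheaf Scheme.fppfTopology (contr P α) := by
  intro T R hR z hz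
  rw [Presieve.compatible_iff_sieveCompatible] at hz
  obtain ⟨z', hzz'⟩ : ∃ z' : ∀ {Y : Scheme.{u}} (r : Y ⟶ T), R r → ContrPt P α Y,
    ∀ {Y : Scheme.{u}} (r : Y ⟶ T) (hr : R r), z' r hr = z r hr :=
      ⟨fun r hr => z r hr, fun _ _ => rfl⟩
  have hz' {Y Y' : Scheme.{u}} (r : Y ⟶ T) (hr : R r) (s : Y' ⟶ Y) (r' : Y' ⟶ T) (hr' : R r')
      (e : s ≫ r = r') : z' r' hr' = (z' r hr).map s := by
    subst e
    rw [hzz', hzz']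
    exact hz r s hr
  have hs (Z : Scheme.{u}) : Presieve.IsSheafFor (yoneda.obj Z) R.arrows :=
    GrothendieckTopology.Subcanonical.isSheaf_of_isRepresentable (J := Scheme.fppfTopology)
      (yoneda.obj Z) R hR
  let b : Presieve.FamilyOfElements (yoneda.obj X.left) R.arrows := fun Y r hr => (z' r hr).base
  have hb : b.Compatible := by
    rw [Presieve.compatible_iff_sieveCompatible]
    intro Y Z r s hr
    exact congrArg ContrPt.base (hz' r hr s _ (R.downward_closed hr s) rfl)
  obtain ⟨τ, hτ, hτu⟩ := hs X.left b hb
  replace hτ {Y : Scheme.{u}} (r : Y ⟶ T) (hr : R r) : (z' r hr).base = r ≫ τ := (hτ r hr).symm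
  -- The value at `x` is glued along the pullback of the given sieve under `s`; on each member it is
  -- the value of the local element of the family.
  have hD {T' : Over S} (x : T' ⟶ P.total) (s : T'.left ⟶ T)
      (h : x.left ≫ P.proj.left = s ≫ τ) : ∃! m : T' ⟶ M,
        ∀ {T₂ : Over S} (r : T₂ ⟶ T') (hr : R (r.left ≫ s)),
          r ≫ m = (z' (r.left ≫ s) hr).ev (r ≫ x) (𝟙 _) (by
            rw [P.comp_left_proj r h, hτ, Category.id_comp, Category.assoc]) :=
    exists_glue_over (T := T') (M := M) (R := R.pullback s)
      (Scheme.fppfTopology.pullback_stable s hR)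
      (fun {T₂} r hr => (z' (r.left ≫ s) hr).ev (r ≫ x) (𝟙 _) (by
        have hr' : R (r.left ≫ s) := hr
        rw [P.comp_left_proj r h, hτ _ hr', Category.id_comp, Category.assoc]))
      (by
        rintro T₂ T₃ r (hr : R (r.left ≫ s)) a r' (hr' : R (r'.left ≫ s)) rfl
        have e := hz' (r.left ≫ s) hr a.left ((a ≫ r).left ≫ s) hr' (by simp)
        rw [ev_congr_left e, ev_map, comp_ev _ a _ _ _ (by
          rw [← Category.assoc, P.comp_left_proj _ h, hτ]; simp)]
        exact ev_congr _ (Category.assoc _ _ _) (by simp) _)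
  let D {T' : Over S} (x : T' ⟶ P.total) (s : T'.left ⟶ T)
      (h : x.left ≫ P.proj.left = s ≫ τ) : T' ⟶ M := (hD x s h).choose
  have hD₁ {T' : Over S} (x : T' ⟶ P.total) (s : T'.left ⟶ T)
      (h : x.left ≫ P.proj.left = s ≫ τ) {T₂ : Over S} (r : T₂ ⟶ T') (hr : R (r.left ≫ s)) :
      r ≫ D x s h = (z' (r.left ≫ s) hr).ev (r ≫ x) (𝟙 _) (by
        rw [P.comp_left_proj r h, hτ, Category.id_comp, Category.assoc]) :=
    (hD x s h).choose_spec.1 r hr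
  have hD₂ {T' : Over S} (x : T' ⟶ P.total) (s : T'.left ⟶ T)
      (h : x.left ≫ P.proj.left = s ≫ τ) (m : T' ⟶ M)
      (hm : ∀ {T₂ : Over S} (r : T₂ ⟶ T') (hr : R (r.left ≫ s)),
        r ≫ m = (z' (r.left ≫ s) hr).ev (r ≫ x) (𝟙 _) (by
          rw [P.comp_left_proj r h, hτ, Category.id_comp, Category.assoc])) : m = D x s h :=
    (hD x s h).choose_spec.2 m hm
  have hDcomp {T' T₂ : Over S} (a : T₂ ⟶ T') (x : T' ⟶ P.total) (s : T'.left ⟶ T)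
      (h : x.left ≫ P.proj.left = s ≫ τ)
      (h' : (a ≫ x).left ≫ P.proj.left = (a.left ≫ s) ≫ τ) :
      a ≫ D x s h = D (a ≫ x) (a.left ≫ s) h' := by
    refine hD₂ _ _ h' _ fun {T₃} r hr => ?_
    have e : (r ≫ a).left ≫ s = r.left ≫ a.left ≫ s := by simp
    have hr' : R ((r ≫ a).left ≫ s) := by rwa [e]
    rw [← Category.assoc, hD₁ x s h (r ≫ a) hr']
    have e' : z' ((r ≫ a).left ≫ s) hr' = z' (r.left ≫ a.left ≫ s) hr := by
      congr 1
    rw [ev_congr_left e']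
    exact ev_congr _ (Category.assoc _ _ _) rfl _
  have hDsmul {T' : Over S} (g : T' ⟶ G) (x : T' ⟶ P.total) (s : T'.left ⟶ T)
      (h : x.left ≫ P.proj.left = s ≫ τ) (h' : (P.smul g x).left ≫ P.proj.left = s ≫ τ) :
      D (P.smul g x) s h' = α.act g (D x s h) := by
    refine (hD₂ _ _ h' _ fun {T₃} r hr => ?_).symm
    rw [α.comp_act, hD₁ x s h r hr, ← ev_smul _ _ _ _ _ (by
      rw [P.smul_left_proj, P.comp_left_proj r h, hτ, Category.id_comp, Category.assoc])]
    exact ev_congr _ (P.comp_smul _ _ _).symm rfl _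
  let q : ContrPt P α T := mk' τ D hDcomp hDsmul
  refine ⟨q, fun Y r hr => ?_, fun (q' : ContrPt P α T) hq' => ?_⟩
  · refine Eq.trans ?_ (hzz' r hr)
    change ContrPt.map r q = z' r hr
    refine ext_ev (hτ r hr).symm fun {T'} x s h h' => ?_
    refine (ev_map r q x s h).trans ((ev_mk' ..).trans ?_)
    symm
    refine hD₂ _ _ (h.trans (Category.assoc _ _ _).symm) _ fun {T₂} a ha => ?_
    have e := hz' r hr (a.left ≫ s) (a.left ≫ s ≫ r) ha (Category.assoc _ _ _)
    rw [ev_congr_left e, ev_map]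
    refine (comp_ev (z' r hr) a x s h' ?_).trans (ev_congr _ rfl (Category.id_comp _).symm _)
    rw [P.comp_left_proj a h', Category.assoc]
  · replace hq' {Y : Scheme.{u}} (r : Y ⟶ T) (hr : R r) : ContrPt.map r q' = z' r hr := (hq' r hr).trans (hzz' r hr).symm
    have hbase : q'.base = τ :=
      hτu q'.base fun Y r hr => congrArg ContrPt.base (hq' r hr)
    change @Eq (ContrPt P α T) q' q
    refine ext_ev hbase fun {T'} x s h h' => ?_
    refine Eq.trans ?_ (ev_mk' ..).symm
    refine hD₂ _ _ h' _ fun {T₂} a ha => ?_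
    rw [← ev_congr_left (hq' _ ha) _ _ (by
      rw [P.comp_left_proj a h, base_map, Category.id_comp, Category.assoc]), ev_map]
    refine (comp_ev q' a x s h ?_).trans (ev_congr _ rfl (Category.id_comp _).symm _)
    rw [P.comp_left_proj a h, Category.assoc]

end FrobBundle

namespace FrobBundle

/-! ### Trivialisations of contracted products -/

open CartesianMonoidalCategory (fst snd lift)

variable {S : Scheme.{u}} {G X M : Over S} [GrpObj G]

namespace PrincipalBundle

variable (P : PrincipalBundle G X)

/-- A morphism `s : T' ⟶ T` of schemes, seen as a morphism over `S`. -/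
def overLift {T T' : Over S} (c : T ⟶ X) (x : T' ⟶ P.total) (s : T'.left ⟶ T.left)
    (h : x.left ≫ P.proj.left = s ≫ c.left) : T' ⟶ T :=
  Over.homMk s (by rw [← Over.w c, ← reassoc_of% h, Over.w, Over.w])

theorem overLift_comp {T T' : Over S} (c : T ⟶ X) (x : T' ⟶ P.total) (s : T'.left ⟶ T.left)
    (h : x.left ≫ P.proj.left = s ≫ c.left) : P.overLift c x s h ≫ c = x ≫ P.proj := by
  ext1
  exact h.symm

theorem comp_overLift {T T' T₂ : Over S} (a : T₂ ⟶ T') (c : T ⟶ X) (x : T' ⟶ P.total)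
    (s : T'.left ⟶ T.left) (h : x.left ≫ P.proj.left = s ≫ c.left)
    (h' : (a ≫ x).left ≫ P.proj.left = (a.left ≫ s) ≫ c.left) :
    a ≫ P.overLift c x s h = P.overLift c (a ≫ x) (a.left ≫ s) h' := by
  ext1
  rfl

theorem div_congr {T : Over S} {a a' b b' : T ⟶ P.total} (ha : a = a') (hb : b = b')
    (h : a ≫ P.proj = b ≫ P.proj) : P.div a b h = P.div a' b' (ha ▸ hb ▸ h) := by
  subst ha hb
  rfl

end PrincipalBundle

open PrincipalBundle ContrPt

variable {P : PrincipalBundle G X} (α : PtAct G M) {Y : Over S} (σ : Y ⟶ P.total)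

theorem ev_of_eq {α : PtAct G M} {T : Scheme.{u}} {τ : T ⟶ X.left}
    {f : ∀ {T' : Over S} (x : T' ⟶ P.total) (s : T'.left ⟶ T)
      (_ : x.left ≫ P.proj.left = s ≫ τ), T' ⟶ M} {hf hf'} {q : ContrPt P α T}
    (hq : q = mk' τ f hf hf') {T' : Over S} (x : T' ⟶ P.total) (s : T'.left ⟶ T)
    (h : x.left ≫ P.proj.left = s ≫ q.base) : q.ev x s h = f x s (by subst hq; exact h) := by
  subst hq
  exact ev_mk' _ _ hf hf' x s h

/-- The value at `x` of the equivariant morphism taking the value `m` at the point `σ(y)`, where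
`r = (m, y)`. -/
def trivVal {T' : Over S} (x : T' ⟶ P.total) (r : T' ⟶ M ⊗ Y)
    (h : x ≫ P.proj = (r ≫ snd M Y ≫ σ) ≫ P.proj) : T' ⟶ M :=
  α.act (P.div x (r ≫ snd M Y ≫ σ) h) (r ≫ fst M Y)

theorem trivVal_congr {T' : Over S} {x x' : T' ⟶ P.total} {r r' : T' ⟶ M ⊗ Y} (hx : x = x')
    (hr : r = r') (h : x ≫ P.proj = (r ≫ snd M Y ≫ σ) ≫ P.proj) :
    trivVal α σ x r h = trivVal α σ x' r' (hx ▸ hr ▸ h) := by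
  subst hx hr
  rfl

theorem comp_trivVal {T' T₂ : Over S} (a : T₂ ⟶ T') (x : T' ⟶ P.total) (r : T' ⟶ M ⊗ Y)
    (h : x ≫ P.proj = (r ≫ snd M Y ≫ σ) ≫ P.proj)
    (h' : (a ≫ x) ≫ P.proj = ((a ≫ r) ≫ snd M Y ≫ σ) ≫ P.proj) :
    a ≫ trivVal α σ x r h = trivVal α σ (a ≫ x) (a ≫ r) h' := by
  rw [trivVal, trivVal, α.comp_act, P.comp_div a _ (by rw [Category.assoc, h]; simp only [Category.assoc])]
  congr 1

theorem univ_aux {T' : Over S} (x : T' ⟶ P.total) (s : T'.left ⟶ (M ⊗ Y).left)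
    (h : x.left ≫ P.proj.left = s ≫ (snd M Y ≫ σ ≫ P.proj).left) :
    x ≫ P.proj = (P.overLift (snd M Y ≫ σ ≫ P.proj) x s h ≫ snd M Y ≫ σ) ≫ P.proj := by
  rw [Category.assoc, Category.assoc, overLift_comp]

/-- A section of `P` over `Y` trivialises the contracted product: the tautological point. -/
def univPt : ContrPt P α (M ⊗ Y).left :=
  mk' (snd M Y ≫ σ ≫ P.proj).left
    (fun x s h => trivVal α σ x (P.overLift (snd M Y ≫ σ ≫ P.proj) x s h) (univ_aux σ x s h))
    (fun a x s h h' => (comp_trivVal α σ a x _ _ (by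
        rw [P.comp_overLift a _ x s h h']; exact univ_aux σ _ _ h')).trans
      (trivVal_congr α σ rfl (P.comp_overLift a _ x s h h') _))
    (by
      intro T' g x s h h'
      dsimp only [trivVal]
      rw [← α.mul_act, ← P.div_smul_left g _ (by
        rw [P.smul_comp_proj]; exact univ_aux σ x s h)]
      rfl)

theorem base_univPt : (univPt α σ).base = (snd M Y ≫ σ ≫ P.proj).left := rfl

theorem ev_univPt {T' : Over S} (x : T' ⟶ P.total) (r : T' ⟶ M ⊗ Y)
    (h : x.left ≫ P.proj.left = r.left ≫ (univPt α σ).base)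
    (h' : x ≫ P.proj = (r ≫ snd M Y ≫ σ) ≫ P.proj) :
    (univPt α σ).ev x r.left h = trivVal α σ x r h' :=
  ev_of_eq (q := univPt α σ) rfl x r.left h

/-- An equivariant morphism is determined by its value at the section `σ`, and this value is
arbitrary. Evaluation at `σ` thus identifies the contracted product over `Y` with `M × Y`. -/
theorem existsUnique_univPt {T : Scheme.{u}} (y : T ⟶ Y.left) (q : ContrPt P α T)
    (hq : q.base = y ≫ (σ ≫ P.proj).left) :
    ∃! m : T ⟶ (M ⊗ Y).left, m ≫ (snd M Y).left = y ∧ (univPt α σ).map m = q := by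
  let T' : Over S := Over.mk (y ≫ Y.hom)
  let y' : T' ⟶ Y := Over.homMk y
  have hy' : (y' ≫ σ).left ≫ P.proj.left = 𝟙 T'.left ≫ q.base := by
    rw [Category.id_comp, hq]
    exact Category.assoc _ _ _
  let m : T' ⟶ M ⊗ Y := lift (q.ev (y' ≫ σ) (𝟙 _) hy') y'
  have hm₁ : m ≫ fst M Y = q.ev (y' ≫ σ) (𝟙 _) hy' := CartesianMonoidalCategory.lift_fst _ _
  have hm₂ : m ≫ snd M Y = y' := CartesianMonoidalCategory.lift_snd _ _
  have hm : m.left ≫ (snd M Y).left = y := by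
    rw [← Over.comp_left, hm₂]
    rfl
  refine ⟨m.left, ⟨hm, ?_⟩, ?_⟩
  · refine ext_ev ?_ fun {T₂} x s h h' => ?_
    · rw [base_map, base_univPt, hq, Over.comp_left, reassoc_of% hm]
    · rw [ev_map]
      let c : T₂ ⟶ T' := P.overLift (y' ≫ σ ≫ P.proj) x s (h'.trans (by rw [hq]; rfl))
      have hc : c ≫ y' ≫ σ ≫ P.proj = x ≫ P.proj := P.overLift_comp _ _ _ _
      have hx : x ≫ P.proj = ((c ≫ m) ≫ snd M Y ≫ σ) ≫ P.proj := by
        simp only [Category.assoc, reassoc_of% hm₂, hc]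
      have hx' : x ≫ P.proj = (c ≫ y' ≫ σ) ≫ P.proj := by
        simp only [Category.assoc, hc]
      refine (ev_univPt α σ x (c ≫ m) _ hx).trans ?_
      rw [trivVal, Category.assoc c m (fst M Y), hm₁, q.comp_ev c (y' ≫ σ) (𝟙 T'.left) hy'
        ((P.comp_left_proj c hy').trans (Category.assoc _ _ _).symm), ← ev_smul _ _ _ _ _
          ((P.smul_left_proj _ _).trans ((P.comp_left_proj c hy').trans (Category.assoc _ _ _).symm))]
      refine q.ev_congr ?_ (Category.comp_id _) _
      refine Eq.trans ?_ (P.div_smul x (c ≫ y' ≫ σ) hx')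
      congr 1
      exact P.div_congr rfl (by rw [Category.assoc, reassoc_of% hm₂]) _
  · rintro m' ⟨hm', hm''⟩
    let n : T' ⟶ M ⊗ Y := Over.homMk m' (by
      rw [← Over.w (snd M Y), reassoc_of% hm']
      rfl)
    have hn : n ≫ snd M Y = y' := by
      ext1
      exact hm'
    have e := ev_congr_left hm'' (y' ≫ σ) (𝟙 _) (by rw [hm'']; exact hy')
    have hσ : (y' ≫ σ) ≫ P.proj = (n ≫ snd M Y ≫ σ) ≫ P.proj := by
      simp only [Category.assoc, reassoc_of% hn]
    have e₂ : (univPt α σ).ev (y' ≫ σ) n.left (by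
        rw [hy', ← hm'', base_map, Category.id_comp]; rfl) = q.ev (y' ≫ σ) (𝟙 _) hy' := by
      rw [← e, ev_map]
      exact ev_congr _ rfl (Category.id_comp _).symm _
    rw [ev_univPt α σ _ _ _ hσ, trivVal, P.div_congr rfl (by rw [reassoc_of% hn]), P.div_self,
      α.one_act] at e₂
    have : n = m := by
      apply CartesianMonoidalCategory.hom_ext
      · rw [e₂, hm₁]
      · rw [hn, hm₂]
    exact congrArg CommaMorphism.left this

end FrobBundle

namespace FrobBundle

/-! ### Representability -/

open CartesianMonoidalCategory (fst snd lift)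

/-- A Zariski sheaf covered by representable open subfunctors is representable. Openness is phrased
on points: membership of a pullback is equivalent to landing in an open subset. -/
theorem exists_representing_of_cover {F : Scheme.{u}ᵒᵖ ⥤ Type u}
    (hF : Presieve.IsSheaf Scheme.fppfTopology F) {I : Type u} (Q : I → Subfunctor F)
    (hrep : ∀ i, ∃ Z : Scheme.{u}, ∃ z ∈ (Q i).obj (op Z), ∀ {T : Scheme.{u}},
      ∀ q ∈ (Q i).obj (op T), ∃! m : T ⟶ Z, F.map m.op z = q)
    (hopen : ∀ i {T : Scheme.{u}} (q : F.obj (op T)), ∃ O : T.Opens,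
      ∀ {T' : Scheme.{u}} (a : T' ⟶ T), F.map a.op q ∈ (Q i).obj (op T') ↔ ∀ x, a x ∈ O)
    (hcov : ∀ {T : Scheme.{u}} (q : F.obj (op T)) (x : T), ∃ i, ∃ U : T.Opens, x ∈ U ∧
      F.map U.ι.op q ∈ (Q i).obj (op U)) :
    ∃ (Z : Scheme.{u}) (z : F.obj (op Z)), ∀ {T : Scheme.{u}} (q : F.obj (op T)),
      ∃! m : T ⟶ Z, F.map m.op z = q := by
  have hF' : Presieve.IsSheaf Scheme.zariskiTopology F :=
    Presieve.isSheaf_of_le _ (Precoverage.toGrothendieck_mono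
      Scheme.zariskiPrecoverage_le_fppfPrecoverage) hF
  let F₁ : Sheaf Scheme.zariskiTopology.{u} (Type u) := ⟨F, (isSheaf_iff_isSheaf_of_type _ _).2 hF'⟩
  choose Z z hz hu using hrep
  let f (i : I) : yoneda.obj (Z i) ⟶ F₁.1 := yonedaEquiv.symm (z i)
  -- The pullback of the `i`-th chart along an element `q` over `T` is the open subscheme on which
  -- `q` belongs to the subfunctor.
  have hf (i : I) : IsOpenImmersion.presheaf (f i) := by
    refine MorphismProperty.relative.of_exists fun T g => ?_
    let q := yonedaEquiv g
    obtain ⟨O, hO⟩ := hopen i q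
    obtain ⟨m, hm, -⟩ := hu i (F.map O.ι.op q) ((hO O.ι).2 fun x => x.2)
    have hg {T' : Scheme.{u}} (a : T' ⟶ T) : g.app (op T') a = F.map a.op q := by
      have : g = yonedaEquiv.symm q := (Equiv.symm_apply_apply _ _).symm
      rw [this]
      rfl
    refine ⟨O, yoneda.map m, O.ι, ?_, inferInstance⟩
    refine IsPullback.of_forall_isPullback_app fun T' => ?_
    rw [Types.isPullback_iff]
    refine ⟨?_, fun (a b : T'.unop ⟶ O) h => ?_, fun (a : T'.unop ⟶ Z i) (b : T'.unop ⟶ T) h => ?_⟩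
    · ext a
      change F.map (a ≫ m).op (z i) = g.app _ (a ≫ O.ι)
      rw [hg, op_comp, op_comp, Functor.map_comp, Functor.map_comp]
      exact congrArg (F.map a.op) hm
    · exact (cancel_mono O.ι).1 h.2
    · have h' : F.map a.op (z i) = F.map b.op q := h.trans (hg b)
      have hb : ∀ x, b x ∈ O := (hO b).1 (h' ▸ (Q i).map _ (hz i))
      let c : T'.unop ⟶ O := IsOpenImmersion.lift O.ι b (by
        rintro _ ⟨x, rfl⟩
        simpa using hb x)
      have hc : c ≫ O.ι = b := IsOpenImmersion.lift_fac _ _ _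
      refine ⟨c, (hu i (F.map b.op q) ((hO b).2 hb)).unique ?_ h', hc⟩
      change F.map (c ≫ m).op (z i) = _
      rw [← hc, op_comp, op_comp, Functor.map_comp, Functor.map_comp]
      exact congrArg (F.map c.op) hm
  have : Presheaf.IsLocallySurjective Scheme.zariskiTopology (Sigma.desc f) := by
    constructor
    intro T q
    choose i U hxU hU using hcov q
    have hcover : TopologicalSpace.IsOpenCover U := by
      refine TopologicalSpace.IsOpenCover.mk ?_
      exact eq_top_iff.2 fun x _ => TopologicalSpace.Opens.mem_iSup.2 ⟨x, hxU x⟩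
    refine Scheme.zariskiTopology.superset_covering ?_
      (T.openCoverOfIsOpenCover U hcover).mem_grothendieckTopology
    rintro T' _ ⟨_, a, _, ⟨x : T⟩, rfl⟩
    change T' ⟶ (U x : Scheme.{u}) at a
    obtain ⟨m, hm, -⟩ := hu (i x) _ (hU x)
    refine ⟨(Sigma.ι (fun i => yoneda.obj (Z i)) (i x)).app _ (a ≫ m), ?_⟩
    have e := congr($(Sigma.ι_desc f (i x)).app (op T') (a ≫ m))
    refine e.trans ?_
    change F.map (a ≫ m).op (z _) = F.map (a ≫ (U x).ι).op q
    rw [op_comp, op_comp, Functor.map_comp, Functor.map_comp]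
    exact congrArg (F.map a.op) hm
  obtain ⟨Z', ⟨r⟩⟩ := Scheme.LocalRepresentability.isRepresentable (F := F₁) hf
  refine ⟨Z', r.homEquiv (𝟙 Z'), fun {T} q => ⟨r.homEquiv.symm q, ?_, fun m hm => ?_⟩⟩
  · change F₁.1.map _ _ = _
    rw [← r.homEquiv_comp, Category.comp_id, Equiv.apply_symm_apply]
  · rw [Equiv.eq_symm_apply, ← hm]
    change _ = F₁.1.map _ _
    rw [← r.homEquiv_comp, Category.comp_id]

variable {S : Scheme.{u}} {G X M : Over S} [GrpObj G] {P : PrincipalBundle G X} (α : PtAct G M)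

open PrincipalBundle ContrPt

/-- Over `Y` the section `σ` turns the contracted product into `M × Y`, and `Q` into the affine open
`W`; affine fppf descent along `Y ⟶ V` then represents `Q`. The cartesian square is recorded in
order to descend properties of `W ⟶ Y`. -/
theorem exists_affine_representing_of_section (Q : Subfunctor (contr P α))
    (hQ : Presieve.IsSheaf Scheme.fppfTopology Q.toFunctor) {V : X.left.Opens}
    (hV : IsAffineOpen V)
    (hQV : ∀ {T : Scheme.{u}} (q : ContrPt P α T), q ∈ Q.obj (op T) → ∀ x, q.base x ∈ V)
    {Y : Over S} [IsAffine Y.left] (σ : Y ⟶ P.total) (f : Y.left ⟶ V) [Flat f] [Surjective f]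
    [LocallyOfFinitePresentation f] (hf : f ≫ V.ι = (σ ≫ P.proj).left)
    {W : (M ⊗ Y).left.Opens} (hW : IsAffineOpen W)
    (hWQ : ∀ {T : Scheme.{u}} (m : T ⟶ (M ⊗ Y).left),
      (univPt α σ).map m ∈ Q.obj (op T) ↔ ∀ x, m x ∈ W) :
    ∃ (Z : Scheme.{u}) (_ : IsAffine Z) (z : ContrPt P α Z) (b : Z ⟶ V) (h : (W : Scheme.{u}) ⟶ Z),
      z ∈ Q.obj (op Z) ∧ b ≫ V.ι = z.base ∧ IsPullback h (W.ι ≫ (snd M Y).left) b f ∧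
      z.map h = (univPt α σ).map W.ι ∧
      ∀ {T : Scheme.{u}} (q : ContrPt P α T), q ∈ Q.obj (op T) → ∃! m : T ⟶ Z, z.map m = q := by
  have : IsAffine V := hV
  have : IsAffine W := hW
  have ht {T : Scheme.{u}} (q : Q.toFunctor.obj (op T)) :
      ∃ t : T ⟶ V, t ≫ V.ι = ContrPt.base (P := P) (α := α) q.1 :=
    ⟨IsOpenImmersion.lift V.ι _ (by
      rintro _ ⟨x, rfl⟩
      simpa using hQV _ q.2 x), IsOpenImmersion.lift_fac _ _ _⟩
  choose t ht using @ht
  have hw : (univPt α σ).map W.ι ∈ Q.obj (op (W : Scheme.{u})) := (hWQ W.ι).2 fun x => x.2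
  obtain ⟨Z, hZ, z, h, hpb, hz, hu⟩ := exists_affine_representing Q.toFunctor hQ t
    (by
      intro T T' s q
      rw [← cancel_mono V.ι, ht, Category.assoc, ht]
      rfl)
    f (W.ι ≫ (snd M Y).left) ⟨_, hw⟩
    (by
      rw [← cancel_mono V.ι]
      refine (ht _).trans ?_
      rw [Category.assoc, Category.assoc, hf]
      rfl)
    (by
      intro T y q hq
      have hq' : ContrPt.base (P := P) (α := α) q.1 = y ≫ (σ ≫ P.proj).left := by
        rw [← ht, hq, Category.assoc, hf]
      obtain ⟨m, ⟨hm₁, hm₂⟩, hm₃⟩ := existsUnique_univPt α σ y q.1 hq'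
      have hmW : ∀ x, m x ∈ W := (hWQ m).1 (hm₂ ▸ q.2)
      let n : T ⟶ W := IsOpenImmersion.lift W.ι m (by
        rintro _ ⟨x, rfl⟩
        simpa using hmW x)
      have hn : n ≫ W.ι = m := IsOpenImmersion.lift_fac _ _ _
      have key (n' : T ⟶ W) : (univPt α σ).map (n' ≫ W.ι) = ((univPt α σ).map W.ι).map n' :=
        congr($((contr P α).map_comp W.ι.op n'.op) (univPt α σ))
      refine ⟨n, ⟨by rw [reassoc_of% hn, hm₁], Subtype.ext ?_⟩, ?_⟩
      · change ((univPt α σ).map W.ι).map n = q.1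
        rw [← key, hn, hm₂]
      · rintro n' ⟨h₁, h₂⟩
        rw [← cancel_mono W.ι, hn]
        refine hm₃ _ ⟨by rw [Category.assoc, h₁], ?_⟩
        rw [key]
        exact congrArg Subtype.val h₂)
  refine ⟨Z, hZ, z.1, t z, h, z.2, ht z, hpb, congrArg Subtype.val hz, fun {T} q hq => ?_⟩
  obtain ⟨m, hm, hm'⟩ := hu ⟨q, hq⟩
  exact ⟨m, congrArg Subtype.val hm, fun m' h' => hm' m' (Subtype.ext h')⟩

end FrobBundle

namespace FrobBundle

/-! ### Lifting the Frobenius pullback of a principal bundle -/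

open CartesianMonoidalCategory (fst snd lift)

theorem isPullback_of_existsUnique {C : Type*} [Category C] {W A B Z : C} {a : W ⟶ A} {b : W ⟶ B}
    {f : A ⟶ Z} {g : B ⟶ Z} (w : a ≫ f = b ≫ g)
    (h : ∀ {T : C} (x : T ⟶ A) (y : T ⟶ B), x ≫ f = y ≫ g → ∃! l : T ⟶ W, l ≫ a = x ∧ l ≫ b = y) :
    IsPullback a b f g := by
  choose l hl hu using @h
  exact ⟨⟨w⟩, ⟨PullbackCone.IsLimit.mk w (fun s => l s.fst s.snd s.condition)
    (fun s => (hl s.fst s.snd s.condition).1) (fun s => (hl s.fst s.snd s.condition).2)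
    (fun s m h₁ h₂ => hu s.fst s.snd s.condition m ⟨h₁, h₂⟩)⟩⟩

theorem exists_mem_range_of_mem_fppfTopology {T : Scheme.{u}} {R : Sieve T}
    (hR : R ∈ Scheme.fppfTopology T) (x : T) :
    ∃ (T' : Scheme.{u}) (f : T' ⟶ T), R f ∧ ∃ y, f y = x := by
  have : Scheme.fppfPrecoverage.{u}.HasIsos :=
    ⟨fun {_ _} f _ => Scheme.Hom.singleton_mem_fppfPrecoverage f⟩
  obtain ⟨R', hR', hle⟩ :=
    Scheme.fppfPrecoverage.mem_toGrothendieck_iff_of_isStableUnderComposition.1 hR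
  rw [Precoverage.mem_iff_exists_zeroHypercover] at hR'
  obtain ⟨E, rfl⟩ := hR'
  obtain ⟨hE, -⟩ := (Scheme.ofArrows_mem_precoverage_iff ..).1 E.mem₀
  obtain ⟨a, y, rfl⟩ := hE x
  exact ⟨_, E.f a, hle _ _ ⟨a⟩, y, rfl⟩

/-- Membership is a condition on points of `T`, and an fppf covering is surjective on points. -/
theorem Subfunctor.isSheaf_of_isOpen {F : Scheme.{u}ᵒᵖ ⥤ Type u}
    (hF : Presieve.IsSheaf Scheme.fppfTopology F) (Q : Subfunctor F)
    (hopen : ∀ {T : Scheme.{u}} (q : F.obj (op T)), ∃ O : T.Opens,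
      ∀ {T' : Scheme.{u}} (a : T' ⟶ T), F.map a.op q ∈ Q.obj (op T') ↔ ∀ x, a x ∈ O) :
    Presieve.IsSheaf Scheme.fppfTopology Q.toFunctor := by
  rw [Subfunctor.isSheaf_iff _ hF]
  intro T q hq
  obtain ⟨O, hO⟩ := hopen q
  have h := hO (𝟙 T.unop)
  rw [op_id, F.map_id] at h
  refine h.2 fun x => ?_
  obtain ⟨T', f, hf, y, rfl⟩ := exists_mem_range_of_mem_fppfTopology hq x
  exact (hO f).1 hf y

variable {S : Scheme.{u}} {G H X : Over S} [GrpObj G] [GrpObj H]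

/-- The action of `G` on `H` by left translations through a homomorphism. -/
def homAct (F : G ⟶ H) [IsMonHom F] : PtAct G H where
  act g m := (g ≫ F) * m
  comp_act s g m := by rw [MonObj.comp_mul, Category.assoc]
  one_act m := by rw [MonObj.one_comp, one_mul]
  mul_act g h m := by rw [MonObj.mul_comp, mul_assoc]

/-- A torsor `P'` under `H` on a subscheme `X₀` of `X`, together with an equivariant morphism
to it from the restriction of a principal `G`-bundle `P`. -/
structure LiftDatum (P : PrincipalBundle G X) (F : G ⟶ H) [IsMonHom F] where
  /-- the subscheme -/
  X₀ : Over S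
  /-- the torsor -/
  P' : Over S
  /-- the inclusion -/
  j : X₀ ⟶ X
  mono : Mono j.left
  /-- the projection -/
  pr : P' ⟶ X₀
  /-- the action -/
  β : PtAct H P'
  act_pr : ∀ {T : Over S} (h : T ⟶ H) (z : T ⟶ P'), β.act h z ≫ pr = z ≫ pr
  simply_transitive : ∀ {T : Over S} (a b : T ⟶ P'), a ≫ pr = b ≫ pr →
    ∃! h : T ⟶ H, β.act h b = a
  /-- the equivariant morphism -/
  u : ∀ {T : Over S} (x : T ⟶ P.total) (x₀ : T ⟶ X₀), x ≫ P.proj = x₀ ≫ j → (T ⟶ P')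
  comp_u : ∀ {T T' : Over S} (s : T' ⟶ T) (x : T ⟶ P.total) (x₀ : T ⟶ X₀)
    (h : x ≫ P.proj = x₀ ≫ j) (h' : (s ≫ x) ≫ P.proj = (s ≫ x₀) ≫ j),
    s ≫ u x x₀ h = u (s ≫ x) (s ≫ x₀) h'
  u_pr : ∀ {T : Over S} (x : T ⟶ P.total) (x₀ : T ⟶ X₀) (h : x ≫ P.proj = x₀ ≫ j),
    u x x₀ h ≫ pr = x₀
  u_smul : ∀ {T : Over S} (g : T ⟶ G) (x : T ⟶ P.total) (x₀ : T ⟶ X₀)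
    (h : x ≫ P.proj = x₀ ≫ j) (h' : P.smul g x ≫ P.proj = x₀ ≫ j),
    u (P.smul g x) x₀ h' = β.act (g ≫ F) (u x x₀ h)

namespace LiftDatum

open PrincipalBundle ContrPt

variable {P : PrincipalBundle G X} {F : G ⟶ H} [IsMonHom F] (D : LiftDatum P F)

instance : Mono D.j.left := D.mono

theorem u_congr {T : Over S} {x x' : T ⟶ P.total} {x₀ x₀' : T ⟶ D.X₀} (hx : x = x')
    (hx₀ : x₀ = x₀') (h : x ≫ P.proj = x₀ ≫ D.j) : D.u x x₀ h = D.u x' x₀' (hx ▸ hx₀ ▸ h) := by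
  subst hx hx₀
  rfl

/-- The inclusion of `X₀` and a point of it, over `S`. -/
def pt₀ {T : Scheme.{u}} (x₀ : T ⟶ D.X₀.left) : Over.mk (x₀ ≫ D.X₀.hom) ⟶ D.X₀ := Over.homMk x₀

theorem pt_aux {T : Scheme.{u}} (q : ContrPt P (homAct F) T) (x₀ : T ⟶ D.X₀.left)
    (hq : q.base = x₀ ≫ D.j.left) {T₂ : Over S} (s : T₂ ⟶ Over.mk (x₀ ≫ D.X₀.hom))
    (x : T₂ ⟶ P.total) (h : x ≫ P.proj = s ≫ D.pt₀ x₀ ≫ D.j) :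
    x.left ≫ P.proj.left = s.left ≫ q.base := by
  rw [hq]
  exact congr(($h).left)

/-- The comparison of the contracted product over `X₀` with `P'`: the equivariant morphism `q` goes
to the point `q(x)⁻¹ u(x)`, which does not depend on the local point `x` of `P`. -/
theorem exists_pt {T : Scheme.{u}} (q : ContrPt P (homAct F) T) (x₀ : T ⟶ D.X₀.left)
    (hq : q.base = x₀ ≫ D.j.left) :
    ∃! z : Over.mk (x₀ ≫ D.X₀.hom) ⟶ D.P', ∀ {T₂ : Over S} (s : T₂ ⟶ Over.mk (x₀ ≫ D.X₀.hom))
      (x : T₂ ⟶ P.total) (h : x ≫ P.proj = s ≫ D.pt₀ x₀ ≫ D.j),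
      s ≫ z = D.β.act (q.ev x s.left (D.pt_aux q x₀ hq s x h))⁻¹
        (D.u x (s ≫ D.pt₀ x₀) (h.trans (Category.assoc _ _ _).symm)) := by
  refine P.exists_descent (D.pt₀ x₀ ≫ D.j) (fun s x h =>
    D.β.act (q.ev x s.left (D.pt_aux q x₀ hq s x h))⁻¹
        (D.u x (s ≫ D.pt₀ x₀) (h.trans (Category.assoc _ _ _).symm))) ?_ ?_
  · intro T₂ T₃ a s x h h'
    rw [D.β.comp_act, D.comp_u _ _ _ _ (by
      rw [Category.assoc, h]; simp only [Category.assoc]), GrpObj.comp_inv, q.comp_ev a _ _ _ (D.pt_aux q x₀ hq _ _ h')]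
    exact congrArg (D.β.act _) (D.u_congr rfl (Category.assoc _ _ _) _)
  · intro T₂ s g x h h'
    rw [q.ev_smul _ _ _ (D.pt_aux q x₀ hq s x h), D.u_smul _ _ _ (h.trans (Category.assoc _ _ _).symm),
      ← D.β.mul_act]
    congr 1
    change ((g ≫ F) * _)⁻¹ * _ = _
    -- The two factors coming from `g` cancel: `(F(g) q(x))⁻¹ F(g) = q(x)⁻¹`.
    group

theorem _root_.FrobBundle.PrincipalBundle.hom_ext_of_locally (P : PrincipalBundle G X)
    {T Z : Over S} (t : T ⟶ X) {a b : T ⟶ Z}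
    (h : ∀ {T₂ : Over S} (s : T₂ ⟶ T) (x : T₂ ⟶ P.total), x ≫ P.proj = s ≫ t → s ≫ a = s ≫ b) :
    a = b :=
  (P.exists_descent t (fun s _ _ => s ≫ b) (fun _ _ _ _ _ => Category.assoc _ _ _)
    (fun _ _ _ _ _ => rfl)).unique (fun s x hx => h s x hx) (fun _ _ _ => rfl)

theorem _root_.FrobBundle.ContrPt.map_comp_apply {M : Over S} {P : PrincipalBundle G X}
    {α : PtAct G M} {T T' T'' : Scheme.{u}} (a : T'' ⟶ T') (b : T' ⟶ T) (q : ContrPt P α T) :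
    q.map (a ≫ b) = (q.map b).map a := congr($((contr P α).map_comp b.op a.op) q)

/-- The point of `P'` defined by a point of the contracted product over `X₀`. -/
def pt {T : Scheme.{u}} (q : ContrPt P (homAct F) T) (x₀ : T ⟶ D.X₀.left)
    (hq : q.base = x₀ ≫ D.j.left) : Over.mk (x₀ ≫ D.X₀.hom) ⟶ D.P' := (D.exists_pt q x₀ hq).choose

theorem comp_pt {T : Scheme.{u}} (q : ContrPt P (homAct F) T) (x₀ : T ⟶ D.X₀.left)
    (hq : q.base = x₀ ≫ D.j.left) {T₂ : Over S} (s : T₂ ⟶ Over.mk (x₀ ≫ D.X₀.hom))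
    (x : T₂ ⟶ P.total) (h : x ≫ P.proj = s ≫ D.pt₀ x₀ ≫ D.j) :
    s ≫ D.pt q x₀ hq = D.β.act (q.ev x s.left (D.pt_aux q x₀ hq s x h))⁻¹
        (D.u x (s ≫ D.pt₀ x₀) (h.trans (Category.assoc _ _ _).symm)) :=
  (D.exists_pt q x₀ hq).choose_spec.1 s x h

theorem act_ev_comp_pt {T : Scheme.{u}} (q : ContrPt P (homAct F) T) (x₀ : T ⟶ D.X₀.left)
    (hq : q.base = x₀ ≫ D.j.left) {T₂ : Over S} (s : T₂ ⟶ Over.mk (x₀ ≫ D.X₀.hom))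
    (x : T₂ ⟶ P.total) (h : x ≫ P.proj = s ≫ D.pt₀ x₀ ≫ D.j) :
    D.β.act (q.ev x s.left (D.pt_aux q x₀ hq s x h)) (s ≫ D.pt q x₀ hq) =
      D.u x (s ≫ D.pt₀ x₀) (h.trans (Category.assoc _ _ _).symm) :=
  ((D.β.inv_act_eq_iff _ _ _).1 (D.comp_pt q x₀ hq s x h).symm).symm

theorem pt_congr {T : Scheme.{u}} {q q' : ContrPt P (homAct F) T} (e : q = q')
    {x₀ : T ⟶ D.X₀.left} (hq : q.base = x₀ ≫ D.j.left) :
    D.pt q x₀ hq = D.pt q' x₀ (e ▸ hq) := by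
  subst e
  rfl

theorem pt_pr {T : Scheme.{u}} (q : ContrPt P (homAct F) T) (x₀ : T ⟶ D.X₀.left)
    (hq : q.base = x₀ ≫ D.j.left) : D.pt q x₀ hq ≫ D.pr = D.pt₀ x₀ := by
  refine P.hom_ext_of_locally (D.pt₀ x₀ ≫ D.j) fun s x h => ?_
  rw [← Category.assoc, D.comp_pt q x₀ hq s x h, D.act_pr, D.u_pr]

theorem pt_map {T T' : Scheme.{u}} (r : T' ⟶ T) (q : ContrPt P (homAct F) T) (x₀ : T ⟶ D.X₀.left)
    (hq : q.base = x₀ ≫ D.j.left) (x₀' : T' ⟶ D.X₀.left) (hx₀ : x₀' = r ≫ x₀)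
    (hq' : (q.map r).base = x₀' ≫ D.j.left) :
    (D.pt (q.map r) x₀' hq').left = r ≫ (D.pt q x₀ hq).left := by
  subst hx₀
  let r' : Over.mk ((r ≫ x₀) ≫ D.X₀.hom) ⟶ Over.mk (x₀ ≫ D.X₀.hom) := Over.homMk r
  have hr : r' ≫ D.pt₀ x₀ = D.pt₀ (r ≫ x₀) := by
    ext1
    rfl
  have : r' ≫ D.pt q x₀ hq = D.pt (q.map r) _ hq' := by
    refine P.hom_ext_of_locally (D.pt₀ (r ≫ x₀) ≫ D.j) fun s x h => ?_
    rw [D.comp_pt _ _ _ _ _ h, ← Category.assoc, D.comp_pt q x₀ hq (s ≫ r') x (by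
      rw [h, ← hr]; simp only [Category.assoc])]
    have e₁ := (q.map r).ev_congr (x := x) (s := s.left) rfl rfl (D.pt_aux _ _ hq' _ _ h)
    have e₂ : (s ≫ r') ≫ D.pt₀ x₀ = s ≫ D.pt₀ (r ≫ x₀) := by rw [Category.assoc, hr]
    rw [D.u_congr rfl e₂, q.ev_map r x s.left (D.pt_aux _ _ hq' _ _ h)]
    rfl
  exact congr(($this.symm).left)

theorem pt_map_of_eq {T T' : Scheme.{u}} {r : T' ⟶ T} {q : ContrPt P (homAct F) T}
    {q' : ContrPt P (homAct F) T'} (e : q' = q.map r) {x₀ : T ⟶ D.X₀.left}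
    (hq : q.base = x₀ ≫ D.j.left) (x₀' : T' ⟶ D.X₀.left) (hx₀ : x₀' = r ≫ x₀)
    (hq' : q'.base = x₀' ≫ D.j.left) : (D.pt q' x₀' hq').left = r ≫ (D.pt q x₀ hq).left := by
  subst e
  exact D.pt_map r q x₀ hq x₀' hx₀ hq'

/-- The associated point of `P'` factors through the open subscheme `U`. -/
def FactorsThru (U : D.P'.left.Opens) {T : Scheme.{u}} (q : ContrPt P (homAct F) T) : Prop :=
  ∀ (T' : Scheme.{u}) (a : T' ⟶ T) (x₀ : T' ⟶ D.X₀.left)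
    (h : (q.map a).base = x₀ ≫ D.j.left) (t : T'), (D.pt (q.map a) x₀ h).left t ∈ U

theorem FactorsThru.map {D : LiftDatum P F} {U : D.P'.left.Opens} {T T₁ : Scheme.{u}}
    {q : ContrPt P (homAct F) T} (hq : D.FactorsThru U q) (r : T₁ ⟶ T) :
    D.FactorsThru U (q.map r) := by
  intro T' a x₀ h t
  have e : (q.map r).map a = q.map (a ≫ r) := (map_comp_apply a r q).symm
  rw [D.pt_congr e h]
  exact hq T' (a ≫ r) x₀ _ t

/-- The points of the contracted product whose associated point of `P'` factors through an open
subscheme. -/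
def sub (U : D.P'.left.Opens) : Subfunctor (contr P (homAct F)) where
  obj T := {q | D.FactorsThru U (T := T.unop) q}
  map r _ hq := FactorsThru.map hq r.unop

/-- The associated point of `P'` lives only on `T ×_X X₀`, but the inclusion of this scheme in `T`
is a closed bijection. The open locus where the point lies in `U` is therefore the trace of an open
subset of `T`. The last clause is needed to cover the contracted product. -/
theorem sub_isOpen [Surjective D.j.left] [IsClosedImmersion D.j.left] (U : D.P'.left.Opens)
    {T : Scheme.{u}} (q : ContrPt P (homAct F) T) : ∃ O : T.Opens,
      (∀ {T' : Scheme.{u}} (a : T' ⟶ T), q.map a ∈ (D.sub U).obj (op T') ↔ ∀ x, a x ∈ O) ∧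
      ∀ t, (D.pt (q.map (pullback.fst q.base D.j.left)) (pullback.snd _ _)
        pullback.condition).left t ∈ U → pullback.fst q.base D.j.left t ∈ O := by
  let i := pullback.fst q.base D.j.left
  have hb : (q.map i).base = pullback.snd q.base D.j.left ≫ D.j.left := pullback.condition
  let r : pullback q.base D.j.left ⟶ D.P'.left := (D.pt (q.map i) (pullback.snd _ _) hb).left
  refine ⟨⟨(i '' (r ⁻¹ᵁ U)ᶜ)ᶜ, ?_⟩, fun {T'} a => ⟨fun h x => ?_, fun h T₂ b x₀ hx₀ t => ?_⟩,
    fun t ht => ?_⟩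
  · rw [isOpen_compl_iff]
    exact i.isClosedEmbedding.isClosedMap _ (r ⁻¹ᵁ U).isOpen.isClosed_compl
  · rintro ⟨t₀, ht₀, hx⟩
    refine ht₀ ?_
    obtain ⟨t, rfl⟩ := (pullback.fst (a ≫ q.base) D.j.left).surjective x
    let c : pullback (a ≫ q.base) D.j.left ⟶ pullback q.base D.j.left :=
      pullback.lift (pullback.fst _ _ ≫ a) (pullback.snd _ _) (by
        rw [Category.assoc, pullback.condition])
    have hc : c ≫ i = pullback.fst _ _ ≫ a := pullback.lift_fst _ _ _
    have ht : c t = t₀ := by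
      apply i.isClosedEmbedding.injective
      rw [hx, ← Scheme.Hom.comp_apply, hc, Scheme.Hom.comp_apply]
    have e : ContrPt.map (pullback.fst (a ≫ q.base) D.j.left) (q.map a) = (q.map i).map c := by
      rw [← map_comp_apply, ← map_comp_apply, hc]
    have := h _ (pullback.fst (a ≫ q.base) D.j.left) (pullback.snd _ _) pullback.condition t
    rw [pt_map_of_eq D e hb _ (pullback.lift_snd _ _ _).symm pullback.condition] at this
    rw [← ht]
    exact this
  · have hx₀' : (b ≫ a) ≫ q.base = x₀ ≫ D.j.left := by
      rw [← hx₀, Category.assoc]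
      rfl
    let c : T₂ ⟶ pullback q.base D.j.left := pullback.lift (b ≫ a) x₀ hx₀'
    have hc : c ≫ i = b ≫ a := pullback.lift_fst _ _ _
    have e : ContrPt.map b (q.map a) = (q.map i).map c := by
      rw [← map_comp_apply, ← map_comp_apply, hc]
    rw [pt_map_of_eq D e hb _ (pullback.lift_snd _ _ _).symm]
    by_contra ht
    refine h (b t) ⟨c t, ht, ?_⟩
    rw [← Scheme.Hom.comp_apply, hc, Scheme.Hom.comp_apply]
  · rintro ⟨t', ht', e⟩
    exact ht' (i.isClosedEmbedding.injective e ▸ ht)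

end LiftDatum

end FrobBundle

namespace FrobBundle


/-! ### Representability of the contracted product with a group lifting the fibre -/

open CartesianMonoidalCategory (fst snd lift)

variable {S : Scheme.{u}} {G H X : Over S} [GrpObj G] [GrpObj H]

namespace LiftDatum

open PrincipalBundle ContrPt

variable {P : PrincipalBundle G X} {F : G ⟶ H} [IsMonHom F] (D : LiftDatum P F)

/-- In the trivialisation by `σ`, the pair `(h, y)` corresponds to the point `z` of `P'` determined
by `h z = u(σ y)`. -/
theorem act_pt_univPt {Y : Over S} (σ : Y ⟶ P.total) {T : Scheme.{u}} (x₀ : T ⟶ D.X₀.left)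
    (m : Over.mk (x₀ ≫ D.X₀.hom) ⟶ H ⊗ Y)
    (hq : ((univPt (homAct F) σ).map m.left).base = x₀ ≫ D.j.left)
    (h : (m ≫ snd H Y ≫ σ) ≫ P.proj = D.pt₀ x₀ ≫ D.j) :
    D.β.act (m ≫ fst H Y) (D.pt ((univPt (homAct F) σ).map m.left) x₀ hq) =
      D.u (m ≫ snd H Y ≫ σ) (D.pt₀ x₀) h := by
  have h₁ := D.act_ev_comp_pt _ x₀ hq (𝟙 _) (m ≫ snd H Y ≫ σ) (by rw [h, Category.id_comp])
  replace h₁ := h₁.trans (D.u_congr rfl (Category.id_comp _) _)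
  rw [Category.id_comp (D.pt _ x₀ hq)] at h₁
  rw [← h₁]
  congr 1
  have h₂ := ev_map m.left (univPt (homAct F) σ) (m ≫ snd H Y ≫ σ) (𝟙 _) (by
    rw [hq, Category.id_comp]
    exact congr(($h).left))
  refine Eq.trans ?_ h₂.symm
  rw [(univPt (homAct F) σ).ev_congr rfl (Category.id_comp m.left), ev_univPt (homAct F) σ _ m _ rfl,
    trivVal, P.div_self, (homAct F).one_act]

theorem act_cancel {M : Over S} (α : PtAct H M) {T : Over S} (h : T ⟶ H) {a b : T ⟶ M}
    (e : α.act h a = α.act h b) : a = b := by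
  rw [← (α.inv_act_eq_iff h (α.act h b) b).2 rfl, ← e, (α.inv_act_eq_iff h (α.act h a) a).2 rfl]

/-- Over `Y` the subfunctor of `U` is an open `W` of `H × Y` whose restriction to `X₀` is `U ×_V Y`,
an affine scheme. By `hj` the thickening `W` is affine too, and affine descent along `Y ⟶ V`
applies. -/
theorem exists_representing_sub [Surjective D.j.left] [IsClosedImmersion D.j.left]
    (hj : ∀ {W₀ W : Scheme.{u}} (i : W₀ ⟶ W) (q₀ : W₀ ⟶ D.X₀.left) (q : W ⟶ X.left),
      IsPullback i q₀ q D.j.left → IsAffine W₀ → IsAffine W)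
    {U : D.P'.left.Opens} (hU : IsAffineOpen U) {V : X.left.Opens} (hV : IsAffineOpen V)
    (hUV : ∀ x ∈ U, (D.pr ≫ D.j).left x ∈ V) {Y : Over S} [IsAffine Y.left] (σ : Y ⟶ P.total)
    (f : Y.left ⟶ V) [Flat f] [Surjective f] [LocallyOfFinitePresentation f]
    (hf : f ≫ V.ι = (σ ≫ P.proj).left) :
    ∃ Z : Scheme.{u}, ∃ z ∈ (D.sub U).obj (op Z), ∀ {T : Scheme.{u}},
      ∀ q ∈ (D.sub U).obj (op T), ∃! m : T ⟶ Z, (contr P (homAct F)).map m.op z = q := by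
  have : IsAffine V := hV
  have : IsAffine U := hU
  obtain ⟨W, hW, -⟩ := D.sub_isOpen U (univPt (homAct F) σ)
  let b₁ : (W : Scheme.{u}) ⟶ X.left := W.ι ≫ (snd H Y ≫ σ ≫ P.proj).left
  let W₀ : Scheme.{u} := pullback b₁ D.j.left
  let q₁ : ContrPt P (homAct F) W₀ :=
    (univPt (homAct F) σ).map (pullback.fst b₁ D.j.left ≫ W.ι)
  have hq₁ : q₁.base = pullback.snd b₁ D.j.left ≫ D.j.left := by
    rw [← pullback.condition, base_map, Category.assoc]
    rfl
  let z₁ := (D.pt q₁ _ hq₁).left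
  have hz₁ : z₁ ≫ D.pr.left = pullback.snd b₁ D.j.left := congr(($(D.pt_pr q₁ _ hq₁)).left)
  have hz₁U (t) : z₁ t ∈ U := by
    have h₁ := (hW (pullback.fst b₁ D.j.left ≫ W.ι)).2 fun x => (pullback.fst b₁ D.j.left x).2
    have e : q₁.map (𝟙 _) = q₁ := congr($((contr P (homAct F)).map_id (op W₀)) q₁)
    have h₂ := h₁ _ (𝟙 _) _ (by rw [e]; exact hq₁) t
    rwa [D.pt_congr e] at h₂
  let zU : W₀ ⟶ U := IsOpenImmersion.lift U.ι z₁ (by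
    rintro _ ⟨x, rfl⟩
    simpa using hz₁U x)
  have hzU : zU ≫ U.ι = z₁ := IsOpenImmersion.lift_fac _ _ _
  let c : (U : Scheme.{u}) ⟶ V := IsOpenImmersion.lift V.ι (U.ι ≫ (D.pr ≫ D.j).left) (by
    rintro _ ⟨x, rfl⟩
    rw [Scheme.Opens.range_ι]
    exact hUV _ x.2)
  have hc : c ≫ V.ι = U.ι ≫ D.pr.left ≫ D.j.left := IsOpenImmersion.lift_fac _ _ _
  let yW : W₀ ⟶ Y.left := pullback.fst b₁ D.j.left ≫ W.ι ≫ (snd H Y).left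
  have hyW : yW = (pullback.fst b₁ D.j.left ≫ W.ι) ≫ (snd H Y).left := (Category.assoc _ _ _).symm
  -- The identification of `W₀` with `U ×_V Y`.
  have hpb : IsPullback zU yW c f := by
    refine isPullback_of_existsUnique ?_ ?_
    · rw [← cancel_mono V.ι, Category.assoc, hc, reassoc_of% hzU, reassoc_of% hz₁, Category.assoc,
        hf, ← pullback.condition]
      simp only [b₁, yW, Category.assoc, Over.comp_left]
    · intro T z y hzy
      let x₀ : T ⟶ D.X₀.left := z ≫ U.ι ≫ D.pr.left
      have hx₀ : y ≫ (σ ≫ P.proj).left = x₀ ≫ D.j.left := by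
        rw [← hf, ← reassoc_of% hzy, hc]
        simp only [x₀, Category.assoc]
      let zo : Over.mk (x₀ ≫ D.X₀.hom) ⟶ D.P' := Over.homMk (z ≫ U.ι) (by
        rw [← Over.w D.pr]
        simp only [x₀, Category.assoc]
        rfl)
      have hzo : zo ≫ D.pr = D.pt₀ x₀ := by
        ext1
        exact Category.assoc _ _ _
      have hyw : y ≫ Y.hom = x₀ ≫ D.X₀.hom := by
        rw [← Over.w (σ ≫ P.proj), reassoc_of% hx₀, Over.w D.j]
      let yo : Over.mk (x₀ ≫ D.X₀.hom) ⟶ Y := Over.homMk y hyw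
      have hyo : (yo ≫ σ) ≫ P.proj = D.pt₀ x₀ ≫ D.j := by
        ext1
        exact (Category.assoc _ _ _).trans hx₀
      -- From `(z, y)` one recovers the element of `H` as the unique `h` with `h z = u(σ y)`.
      obtain ⟨h, hh, hhu⟩ := D.simply_transitive (D.u (yo ≫ σ) (D.pt₀ x₀) hyo) zo
        ((D.u_pr _ _ _).trans hzo.symm)
      let m : Over.mk (x₀ ≫ D.X₀.hom) ⟶ H ⊗ Y := lift h yo
      have hm₁ : m ≫ fst H Y = h := CartesianMonoidalCategory.lift_fst _ _
      have hm₂ : m ≫ snd H Y = yo := CartesianMonoidalCategory.lift_snd _ _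
      have hm₂' : m.left ≫ (snd H Y).left = y := congr(($hm₂).left)
      have hmb : ((univPt (homAct F) σ).map m.left).base = x₀ ≫ D.j.left := by
        rw [← hx₀, base_map, base_univPt, Over.comp_left, reassoc_of% hm₂']
      have hmσ : m ≫ snd H Y ≫ σ = yo ≫ σ := by rw [reassoc_of% hm₂]
      have hpt : D.pt _ x₀ hmb = zo := by
        apply act_cancel D.β h
        have e := D.act_pt_univPt σ x₀ m hmb (by rw [hmσ, hyo])
        rw [hm₁, D.u_congr hmσ rfl] at e
        rw [e, hh]
      -- The associated point of `m` is `z`, which lies in `U`, so `m` lands in `W` by the defining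
      -- property of `W`.
      have hmW : ∀ x, m.left x ∈ W := by
        refine (hW m.left).1 fun T' a x₀' hx₀' t => ?_
        have hx : x₀' = a ≫ x₀ := by
          rw [← cancel_mono D.j.left, ← hx₀', base_map, hmb]
          exact (Category.assoc _ _ _).symm
        rw [pt_map_of_eq D rfl hmb _ hx hx₀', hpt]
        exact (z (a t)).2
      let l : T ⟶ W := IsOpenImmersion.lift W.ι m.left (by
        rintro _ ⟨x, rfl⟩
        simpa using hmW x)
      have hl : l ≫ W.ι = m.left := IsOpenImmersion.lift_fac _ _ _
      let l₀ : T ⟶ W₀ := pullback.lift l x₀ (by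
        rw [reassoc_of% hl, ← hx₀, Over.comp_left, reassoc_of% hm₂'])
      have hl₁ : l₀ ≫ pullback.fst b₁ D.j.left = l := pullback.lift_fst _ _ _
      have hl₂ : l₀ ≫ pullback.snd b₁ D.j.left = x₀ := pullback.lift_snd _ _ _
      have key (l' : T ⟶ W₀) (m' : T ⟶ (H ⊗ Y).left)
          (h₁ : l' ≫ pullback.fst b₁ D.j.left ≫ W.ι = m')
          (h₂ : l' ≫ pullback.snd b₁ D.j.left = x₀)
          (hb : ((univPt (homAct F) σ).map m').base = x₀ ≫ D.j.left) :
          (D.pt ((univPt (homAct F) σ).map m') x₀ hb).left = l' ≫ z₁ := by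
        refine pt_map_of_eq D ?_ hq₁ x₀ h₂.symm hb
        rw [← h₁, map_comp_apply]
      refine ⟨l₀, ⟨?_, ?_⟩, ?_⟩
      · rw [← cancel_mono U.ι, Category.assoc, hzU, ← key l₀ m.left
          (by rw [reassoc_of% hl₁, hl]) hl₂ hmb, hpt]
        rfl
      · rw [reassoc_of% hl₁, reassoc_of% hl, hm₂']
      · rintro l' ⟨h₁, h₂⟩
        have h₃ : l' ≫ pullback.snd b₁ D.j.left = x₀ := by
          rw [← hz₁, ← hzU, Category.assoc, reassoc_of% h₁]
        rw [hyW, ← Category.assoc] at h₂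
        let m' : Over.mk (x₀ ≫ D.X₀.hom) ⟶ H ⊗ Y :=
          Over.homMk (l' ≫ pullback.fst b₁ D.j.left ≫ W.ι) (by
            rw [← Over.w (snd H Y)]
            exact (Category.assoc _ _ _).symm.trans ((congrArg (· ≫ Y.hom) h₂).trans hyw))
        have hm' : m' ≫ snd H Y = yo := by
          ext1
          exact h₂
        have hmσ' : m' ≫ snd H Y ≫ σ = yo ≫ σ := by rw [reassoc_of% hm']
        have hmb' : ((univPt (homAct F) σ).map m'.left).base = x₀ ≫ D.j.left := by
          rw [← hx₀, base_map, base_univPt, Over.comp_left]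
          exact (Category.assoc _ _ _).symm.trans (congrArg (· ≫ (σ ≫ P.proj).left) h₂)
        have e : D.pt _ x₀ hmb' = zo := by
          ext1
          rw [key l' m'.left rfl h₃ hmb', ← hzU, reassoc_of% h₁]
          rfl
        have hmm : m' = m := by
          apply CartesianMonoidalCategory.hom_ext
          · rw [hm₁]
            apply hhu
            have e' := D.act_pt_univPt σ x₀ m' hmb' (by rw [hmσ', hyo])
            rw [e, D.u_congr hmσ' rfl] at e'
            exact e'
          · rw [hm', hm₂]
        apply pullback.hom_ext
        · rw [hl₁, ← cancel_mono W.ι, hl, ← hmm, Category.assoc]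
          rfl
        · rw [h₃, hl₂]
  have : IsAffine W₀ := .of_isIso hpb.isoPullback.hom
  have hWaff : IsAffineOpen W := hj _ _ b₁ (IsPullback.of_hasPullback b₁ D.j.left) this
  have hsheaf : Presieve.IsSheaf Scheme.fppfTopology (D.sub U).toFunctor :=
    Subfunctor.isSheaf_of_isOpen (contr_isSheaf P _) _ fun q =>
      ⟨_, (D.sub_isOpen U q).choose_spec.1⟩
  obtain ⟨Z, -, z, b, h, hz, -, -, -, hu⟩ := exists_affine_representing_of_section (homAct F)
    (D.sub U) hsheaf hV (fun {T} q hq x => by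
      obtain ⟨t, rfl⟩ := (pullback.fst q.base D.j.left).surjective x
      have h₁ := hq _ (pullback.fst q.base D.j.left) (pullback.snd _ _) pullback.condition t
      have h₂ := congr(($(D.pt_pr (q.map (pullback.fst q.base D.j.left)) (pullback.snd _ _)
        pullback.condition)).left)
      have h₃ : pullback.fst q.base D.j.left ≫ q.base =
          (D.pt (q.map (pullback.fst q.base D.j.left)) (pullback.snd _ _)
            pullback.condition).left ≫ (D.pr ≫ D.j).left := by
        rw [pullback.condition]
        exact (congrArg (· ≫ D.j.left) h₂.symm).trans (Category.assoc _ _ _)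
      rw [← Scheme.Hom.comp_apply, h₃, Scheme.Hom.comp_apply]
      exact hUV _ h₁) σ f hf hWaff hW
  exact ⟨Z, z, hz, hu⟩

end LiftDatum

end FrobBundle

namespace FrobBundle


/-! ### The lifted bundle -/

open CartesianMonoidalCategory (fst snd lift)

variable {S : Scheme.{u}} {G H X : Over S} [GrpObj G] [GrpObj H]

open PrincipalBundle ContrPt

/-- The affine opens of `P'` lying over affine opens of `X` on which `P` acquires a section after an
affine fppf cover form a cover of `P'`, and their subfunctors cover the contracted product. -/
theorem LiftDatum.exists_representing {P : PrincipalBundle G X} {F : G ⟶ H} [IsMonHom F]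
    (D : LiftDatum P F) [Surjective D.j.left] [IsClosedImmersion D.j.left]
    (hj : ∀ {W₀ W : Scheme.{u}} (i : W₀ ⟶ W) (q₀ : W₀ ⟶ D.X₀.left) (q : W ⟶ X.left),
      IsPullback i q₀ q D.j.left → IsAffine W₀ → IsAffine W) :
    ∃ (Z : Scheme.{u}) (z : ContrPt P (homAct F) Z), ∀ {T : Scheme.{u}}
      (q : ContrPt P (homAct F) T), ∃! m : T ⟶ Z, z.map m = q := by
  let I := {U : D.P'.left.Opens // ∃ Z : Scheme.{u}, ∃ z ∈ (D.sub U).obj (op Z),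
    ∀ {T : Scheme.{u}}, ∀ q ∈ (D.sub U).obj (op T), ∃! m : T ⟶ Z,
      (contr P (homAct F)).map m.op z = q}
  refine exists_representing_of_cover (contr_isSheaf P (homAct F)) (fun U : I => D.sub U.1)
    (fun U => U.2) (fun U T q => (D.sub_isOpen U.1 q).imp fun O h => h.1) ?_
  intro T (q : ContrPt P (homAct F) T) x
  obtain ⟨t, rfl⟩ := (pullback.fst q.base D.j.left).surjective x
  have h₂ := congr(($(D.pt_pr (q.map (pullback.fst q.base D.j.left)) (pullback.snd _ _)
    pullback.condition)).left)
  have h₃ : pullback.fst q.base D.j.left ≫ q.base =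
      (D.pt (q.map (pullback.fst q.base D.j.left)) (pullback.snd _ _)
        pullback.condition).left ≫ (D.pr ≫ D.j).left := by
    rw [pullback.condition]
    exact (congrArg (· ≫ D.j.left) h₂.symm).trans (Category.assoc _ _ _)
  obtain ⟨V, Y, f, s, hV, hY, _, _, _, hxV, -, hs⟩ := exists_affine_section P.proj.left
    P.locally_trivial (U := ⊤) (x := q.base (pullback.fst q.base D.j.left t)) trivial
  rw [← Scheme.Hom.comp_apply, h₃, Scheme.Hom.comp_apply] at hxV
  obtain ⟨_, ⟨U, hU, rfl⟩, hxU, hUV⟩ := D.P'.left.isBasis_affineOpens.exists_subset_of_mem_open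
    (show _ ∈ (D.pr ≫ D.j).left ⁻¹ᵁ V from hxV) (TopologicalSpace.Opens.isOpen _)
  let Yo : Over S := Over.mk (s ≫ P.total.hom)
  have : IsAffine Yo.left := hY
  have hU' := D.exists_representing_sub hj hU hV hUV (Y := Yo) (Over.homMk s) f hs.symm
  obtain ⟨O, hO, hO'⟩ := D.sub_isOpen U q
  exact ⟨⟨U, hU'⟩, O, hO' t hxU, (hO O.ι).2 fun y => y.2⟩

/-- The twisted form `Z` of `H` classifying equivariant morphisms from a principal `G`-bundle. -/
structure TwistedForm (P : PrincipalBundle G X) (F : G ⟶ H) [IsMonHom F] where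
  /-- the total space -/
  total : Over S
  /-- the projection -/
  proj : total ⟶ X
  /-- the equivariant morphism corresponding to a point -/
  ev : ∀ {T : Over S} (n : T ⟶ total) (x : T ⟶ P.total), x ≫ P.proj = n ≫ proj → (T ⟶ H)
  comp_ev : ∀ {T T' : Over S} (s : T' ⟶ T) (n : T ⟶ total) (x : T ⟶ P.total)
    (h : x ≫ P.proj = n ≫ proj) (h' : (s ≫ x) ≫ P.proj = (s ≫ n) ≫ proj),
    s ≫ ev n x h = ev (s ≫ n) (s ≫ x) h'
  ev_smul : ∀ {T : Over S} (g : T ⟶ G) (n : T ⟶ total) (x : T ⟶ P.total)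
    (h : x ≫ P.proj = n ≫ proj) (h' : P.smul g x ≫ P.proj = n ≫ proj),
    ev n (P.smul g x) h' = (g ≫ F) * ev n x h
  exists_lift : ∀ {T : Over S} (c : T ⟶ X) (e : ∀ {T₂ : Over S} (s : T₂ ⟶ T) (x : T₂ ⟶ P.total),
      x ≫ P.proj = s ≫ c → (T₂ ⟶ H)),
    (∀ {T₂ T₃ : Over S} (a : T₃ ⟶ T₂) (s : T₂ ⟶ T) (x : T₂ ⟶ P.total)
      (h : x ≫ P.proj = s ≫ c) (h' : (a ≫ x) ≫ P.proj = (a ≫ s) ≫ c),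
      a ≫ e s x h = e (a ≫ s) (a ≫ x) h') →
    (∀ {T₂ : Over S} (g : T₂ ⟶ G) (s : T₂ ⟶ T) (x : T₂ ⟶ P.total)
      (h : x ≫ P.proj = s ≫ c) (h' : P.smul g x ≫ P.proj = s ≫ c),
      e s (P.smul g x) h' = (g ≫ F) * e s x h) →
    ∃ n : T ⟶ total, n ≫ proj = c ∧ ∀ {T₂ : Over S} (s : T₂ ⟶ T) (x : T₂ ⟶ P.total)
      (h : x ≫ P.proj = s ≫ c) (h' : x ≫ P.proj = (s ≫ n) ≫ proj), ev (s ≫ n) x h' = e s x h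
  hom_ext : ∀ {T : Over S} (a b : T ⟶ total), a ≫ proj = b ≫ proj →
    (∀ {T₂ : Over S} (s : T₂ ⟶ T) (x : T₂ ⟶ P.total) (h : x ≫ P.proj = (s ≫ a) ≫ proj)
      (h' : x ≫ P.proj = (s ≫ b) ≫ proj), ev (s ≫ a) x h = ev (s ≫ b) x h') → a = b

theorem exists_twistedForm {P : PrincipalBundle G X} {F : G ⟶ H} [IsMonHom F] {Z : Scheme.{u}}
    (z : ContrPt P (homAct F) Z) (hz : ∀ {T : Scheme.{u}} (q : ContrPt P (homAct F) T),
      ∃! m : T ⟶ Z, z.map m = q) : Nonempty (TwistedForm P F) := by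
  refine ⟨
    { total := Over.mk (z.base ≫ X.hom)
      proj := Over.homMk z.base
      ev n x h := z.ev x n.left congr(($h).left)
      comp_ev s n x h h' := z.comp_ev s x n.left _ _
      ev_smul g n x h h' := z.ev_smul g x n.left _ _
      exists_lift := ?_
      hom_ext := ?_ }⟩
  · intro T c e he he'
    have hov {T₂ T₃ : Over S} (a : T₃ ⟶ T₂) (x : T₂ ⟶ P.total) (s : T₂.left ⟶ T.left)
        (h : x.left ≫ P.proj.left = s ≫ c.left)
        (h' : (a ≫ x).left ≫ P.proj.left = (a.left ≫ s) ≫ c.left) :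
        a ≫ e (P.overLift c x s h) x (P.overLift_comp c x s h).symm =
          e (P.overLift c (a ≫ x) (a.left ≫ s) h') (a ≫ x) (P.overLift_comp _ _ _ _).symm :=
      he a _ x _ (P.overLift_comp c (a ≫ x) (a.left ≫ s) h').symm
    let q : ContrPt P (homAct F) T.left := mk' c.left
      (fun x s h => e (P.overLift c x s h) x (P.overLift_comp c x s h).symm) hov
      (fun g x s h h' => he' g _ x _ _)
    obtain ⟨m, hm, -⟩ := hz q
    have hm' : m ≫ z.base = c.left := congrArg ContrPt.base hm
    refine ⟨Over.homMk m ?_, ?_, ?_⟩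
    · exact (Category.assoc _ _ _).symm.trans ((congrArg (· ≫ X.hom) hm').trans (Over.w c))
    · ext1
      exact hm'
    · intro T₂ s x h h'
      have hq : x.left ≫ P.proj.left = s.left ≫ q.base := congr(($h).left)
      have hq' : x.left ≫ P.proj.left = s.left ≫ (z.map m).base := by rw [hm, hq]
      refine (z.ev_map m x s.left hq').symm.trans ((ev_congr_left hm _ _ hq').trans ?_)
      exact ev_of_eq (q := q) rfl x s.left hq
  · intro T a b hab h
    ext1
    refine (hz (z.map a.left)).unique rfl ?_
    have hb : a.left ≫ z.base = b.left ≫ z.base := congr(($hab).left)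
    refine ext_ev hb.symm fun {T'} x s h₁ h₂ => ?_
    rw [ev_map, ev_map]
    have h₁' : x.left ≫ P.proj.left =
      s ≫ (b ≫ (Over.homMk z.base : Over.mk (z.base ≫ X.hom) ⟶ X)).left := h₁
    have h₂' : x.left ≫ P.proj.left =
      s ≫ (a ≫ (Over.homMk z.base : Over.mk (z.base ≫ X.hom) ⟶ X)).left := h₂
    exact (h (P.overLift _ x s h₂') x ((P.overLift_comp _ x s h₂').symm.trans
      (Category.assoc _ _ _).symm) (((P.overLift_comp _ x s h₁').symm.trans
      (Category.assoc _ _ _).symm))).symm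

/-! ### The torsor structure on a twisted form -/

namespace TwistedForm

variable {P : PrincipalBundle G X} {F : G ⟶ H} [IsMonHom F] (Z : TwistedForm P F)

theorem ev_congr {T : Over S} {n n' : T ⟶ Z.total} {x x' : T ⟶ P.total} (hn : n = n')
    (hx : x = x') (h : x ≫ P.proj = n ≫ Z.proj) : Z.ev n x h = Z.ev n' x' (hn ▸ hx ▸ h) := by
  subst hn hx
  rfl

/-- Right translation commutes with the left translations by `F(g)`, hence preserves equivariance.
The inverse in `n(x) h⁻¹` turns it into a left action. -/
theorem exists_act {T : Over S} (h : T ⟶ H) (n : T ⟶ Z.total) :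
    ∃ n' : T ⟶ Z.total, n' ≫ Z.proj = n ≫ Z.proj ∧ ∀ {T₂ : Over S} (s : T₂ ⟶ T)
      (x : T₂ ⟶ P.total) (hx : x ≫ P.proj = (s ≫ n) ≫ Z.proj)
      (hx' : x ≫ P.proj = (s ≫ n') ≫ Z.proj),
      Z.ev (s ≫ n') x hx' = Z.ev (s ≫ n) x hx * (s ≫ h)⁻¹ := by
  obtain ⟨n', hn', h'⟩ := Z.exists_lift (n ≫ Z.proj)
    (fun s x hx => Z.ev (s ≫ n) x (hx.trans (Category.assoc _ _ _).symm) * (s ≫ h)⁻¹)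
    (by
      intro T₂ T₃ a s x hx hx'
      rw [MonObj.comp_mul, Z.comp_ev a _ x _ (by
        rw [hx']; simp only [Category.assoc]), GrpObj.comp_inv]
      rw [Z.ev_congr (Category.assoc a s n).symm rfl, Category.assoc a s h])
    (by
      intro T₂ g s x hx hx'
      rw [Z.ev_smul g _ x (hx.trans (Category.assoc _ _ _).symm), mul_assoc])
  exact ⟨n', hn', fun s x hx hx' => h' s x (hx.trans (Category.assoc _ _ _)) hx'⟩

/-- The action of `H` on a twisted form. -/
def actFun {T : Over S} (h : T ⟶ H) (n : T ⟶ Z.total) : T ⟶ Z.total := (Z.exists_act h n).choose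

theorem actFun_proj {T : Over S} (h : T ⟶ H) (n : T ⟶ Z.total) :
    Z.actFun h n ≫ Z.proj = n ≫ Z.proj := (Z.exists_act h n).choose_spec.1

theorem comp_actFun_proj {T T₂ : Over S} (s : T₂ ⟶ T) (h : T ⟶ H) (n : T ⟶ Z.total) :
    (s ≫ Z.actFun h n) ≫ Z.proj = (s ≫ n) ≫ Z.proj := by
  rw [Category.assoc, actFun_proj, Category.assoc]

theorem ev_comp_actFun {T : Over S} (h : T ⟶ H) (n : T ⟶ Z.total) {T₂ : Over S} (s : T₂ ⟶ T)
    (x : T₂ ⟶ P.total) (hx' : x ≫ P.proj = (s ≫ Z.actFun h n) ≫ Z.proj) :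
    Z.ev (s ≫ Z.actFun h n) x hx' =
      Z.ev (s ≫ n) x (hx'.trans (Z.comp_actFun_proj s h n)) * (s ≫ h)⁻¹ :=
  (Z.exists_act h n).choose_spec.2 s x _ hx'

/-- The action of `H` on a twisted form. -/
def ptAct : PtAct H Z.total where
  act := Z.actFun
  comp_act s g m := by
    refine Z.hom_ext _ _ ?_ fun {T₂} r x h h' => ?_
    · rw [comp_actFun_proj, actFun_proj]
    · rw [Z.ev_comp_actFun _ _ r x h', Z.ev_congr (Category.assoc r s _).symm rfl h,
        ev_comp_actFun, Z.ev_congr (Category.assoc r s m) rfl, Category.assoc r s g]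
  one_act m := by
    refine Z.hom_ext _ _ (Z.actFun_proj _ _) fun {T₂} r x h h' => ?_
    rw [Z.ev_comp_actFun _ _ r x h, MonObj.comp_one, inv_one, mul_one]
  mul_act g h m := by
    refine Z.hom_ext _ _ ?_ fun {T₂} r x hx hx' => ?_
    · rw [actFun_proj, actFun_proj, actFun_proj]
    · rw [Z.ev_comp_actFun _ _ r x hx, Z.ev_comp_actFun _ _ r x hx', Z.ev_comp_actFun,
        MonObj.comp_mul, mul_inv_rev, mul_assoc]

/-- The equation `a(x) = b(x) h⁻¹` forces `h = a(x)⁻¹ b(x)`. This expression is unchanged when `x`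
is translated by `G`, so it descends. -/
theorem existsUnique_actFun {T : Over S} (a b : T ⟶ Z.total) (hab : a ≫ Z.proj = b ≫ Z.proj) :
    ∃! h : T ⟶ H, Z.actFun h b = a := by
  have ha {T₂ : Over S} {s : T₂ ⟶ T} {x : T₂ ⟶ P.total} (hx : x ≫ P.proj = s ≫ b ≫ Z.proj) :
    x ≫ P.proj = (s ≫ a) ≫ Z.proj := by rw [hx, Category.assoc, hab]
  have hb {T₂ : Over S} {s : T₂ ⟶ T} {x : T₂ ⟶ P.total} (hx : x ≫ P.proj = s ≫ b ≫ Z.proj) :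
    x ≫ P.proj = (s ≫ b) ≫ Z.proj := by rw [hx, Category.assoc]
  obtain ⟨h, hh, hu⟩ := P.exists_descent (b ≫ Z.proj)
    (fun s x hx => (Z.ev (s ≫ a) x (ha hx))⁻¹ * Z.ev (s ≫ b) x (hb hx))
    (by
      intro T₂ T₃ r s x hx hx'
      rw [MonObj.comp_mul, GrpObj.comp_inv, Z.comp_ev r _ x (ha hx) ((ha hx').trans (by
        simp only [Category.assoc])), Z.comp_ev r _ x (hb hx) ((hb hx').trans (by
        simp only [Category.assoc])), Z.ev_congr (Category.assoc r s a) rfl,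
        Z.ev_congr (Category.assoc r s b) rfl])
    (by
      intro T₂ s g x hx hx'
      rw [Z.ev_smul g _ x (ha hx), Z.ev_smul g _ x (hb hx)]
      group)
  refine ⟨h, ?_, fun h' hh' => hu h' fun s x hx => ?_⟩
  · refine Z.hom_ext _ _ ((Z.actFun_proj _ _).trans hab.symm) fun {T₂} s x hx hx' => ?_
    rw [Z.ev_comp_actFun _ _ s x hx, hh s x (hx.trans (by rw [comp_actFun_proj, Category.assoc]))]
    group
  · subst hh'
    rw [Z.ev_comp_actFun]
    group

/-- A point `s` of `P` defines the equivariant morphism `x ↦ F(x / s)`. Hence the twisted form has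
sections wherever `P` does, which gives its local triviality. -/
theorem exists_hom_from_total : ∃ n : P.total ⟶ Z.total, n ≫ Z.proj = P.proj := by
  obtain ⟨n, hn, -⟩ := Z.exists_lift P.proj (fun s x hx => P.div x s hx ≫ F)
    (by
      intro T₂ T₃ a s x hx hx'
      rw [← Category.assoc, P.comp_div a hx hx'])
    (by
      intro T₂ g s x hx hx'
      rw [P.div_smul_left g hx, MonObj.mul_comp])
  exact ⟨n, hn⟩

/-- A twisted form of `H` as a principal `H`-bundle. -/
def bundle : PrincipalBundle H X where
  total := Z.total
  action := Z.ptAct.toModObj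
  proj := Z.proj
  smul_proj g t := by
    rw [Z.ptAct.lift_toModObj]
    exact Z.actFun_proj g t
  simply_transitive a b hab := by
    obtain ⟨h, hh, hu⟩ := Z.existsUnique_actFun a b hab
    refine ⟨h, ?_, fun h' hh' => hu h' ?_⟩
    · exact (Z.ptAct.lift_toModObj h b).trans hh
    · exact (Z.ptAct.lift_toModObj h' b).symm.trans hh'
  locally_trivial := by
    obtain ⟨n, hn⟩ := Z.exists_hom_from_total
    refine Scheme.fppfTopology.superset_covering ?_ P.locally_trivial
    rintro Y y ⟨W, a, b, hb, hab⟩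
    obtain ⟨⟩ := hb
    refine ⟨_, a ≫ n.left, _, ⟨⟩, ?_⟩
    rw [← hab, Category.assoc, ← hn]
    rfl

theorem bundle_smul {T : Over S} (h : T ⟶ H) (n : T ⟶ Z.total) :
    Z.bundle.smul h n = Z.actFun h n := Z.ptAct.lift_toModObj h n

end TwistedForm

/-! ### Comparison of the twisted form with the given torsor over `X₀` -/

namespace LiftDatum

variable {P : PrincipalBundle G X} {F : G ⟶ H} [IsMonHom F] (D : LiftDatum P F)

/-- The element `h` of `H` with `h • b = a`. -/
def div {T : Over S} (a b : T ⟶ D.P') (h : a ≫ D.pr = b ≫ D.pr) : T ⟶ H :=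
  (D.simply_transitive a b h).choose

theorem div_act {T : Over S} (a b : T ⟶ D.P') (h : a ≫ D.pr = b ≫ D.pr) :
    D.β.act (D.div a b h) b = a := (D.simply_transitive a b h).choose_spec.1

theorem eq_div {T : Over S} {a b : T ⟶ D.P'} (h : a ≫ D.pr = b ≫ D.pr) {g : T ⟶ H}
    (hg : D.β.act g b = a) : g = D.div a b h := (D.simply_transitive a b h).choose_spec.2 g hg

theorem u_pr' {T : Over S} (x : T ⟶ P.total) (z : T ⟶ D.P') (h : x ≫ P.proj = (z ≫ D.pr) ≫ D.j) :
    D.u x (z ≫ D.pr) h ≫ D.pr = z ≫ D.pr := D.u_pr _ _ _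

/-- A point `z` of `P'` is sent to the equivariant morphism whose value at `x` is the element `h`
with `h z = u(x)`. -/
theorem exists_toTwistedForm (Z : TwistedForm P F) :
    ∃ v : D.P' ⟶ Z.total, v ≫ Z.proj = D.pr ≫ D.j ∧ ∀ {T : Over S} (z : T ⟶ D.P')
      (x : T ⟶ P.total) (h : x ≫ P.proj = (z ≫ D.pr) ≫ D.j) (h' : x ≫ P.proj = (z ≫ v) ≫ Z.proj),
      D.β.act (Z.ev (z ≫ v) x h') z = D.u x (z ≫ D.pr) h := by
  have ha {T₂ : Over S} {s : T₂ ⟶ D.P'} {x : T₂ ⟶ P.total} (hx : x ≫ P.proj = s ≫ D.pr ≫ D.j) :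
    x ≫ P.proj = (s ≫ D.pr) ≫ D.j := by rw [hx, Category.assoc]
  obtain ⟨v, hv, h⟩ := Z.exists_lift (D.pr ≫ D.j)
    (fun s x hx => D.div (D.u x (s ≫ D.pr) (ha hx)) s (D.u_pr' x s (ha hx)))
    (by
      intro T₂ T₃ a s x hx hx'
      apply D.eq_div
      rw [← D.β.comp_act, D.div_act, D.comp_u a x _ (ha hx) ((ha hx').trans (by
        simp only [Category.assoc])), D.u_congr rfl (Category.assoc a s _)])
    (by
      intro T₂ g s x hx hx'
      symm
      apply D.eq_div
      rw [D.β.mul_act, D.div_act, D.u_smul g x _ (ha hx)])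
  refine ⟨v, hv, fun z x hx hx' => ?_⟩
  rw [h z x (hx.trans (Category.assoc _ _ _)) hx', D.div_act]

/-- The inverse construction sends a point `n` over `X₀` to the descended point `n(x)⁻¹ u(x)` of
`P'`. Equivariance holds because `k (h z) = u(x)` amounts to `k = n(x) h⁻¹`. -/
theorem exists_isPullback_twistedForm (Z : TwistedForm P F) :
    ∃ v : D.P' ⟶ Z.total, IsPullback v D.pr Z.proj D.j ∧
      ∀ {T : Over S} (h : T ⟶ H) (z : T ⟶ D.P'), D.β.act h z ≫ v = Z.actFun h (z ≫ v) := by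
  obtain ⟨v, hv, hu⟩ := D.exists_toTwistedForm Z
  refine ⟨v, isPullback_of_existsUnique hv ?_, ?_⟩
  · intro T n x₀ hn
    have ha {T₂ : Over S} {s : T₂ ⟶ T} {x : T₂ ⟶ P.total} (hx : x ≫ P.proj = s ≫ x₀ ≫ D.j) :
      x ≫ P.proj = (s ≫ x₀) ≫ D.j := by rw [hx, Category.assoc]
    have hb {T₂ : Over S} {s : T₂ ⟶ T} {x : T₂ ⟶ P.total} (hx : x ≫ P.proj = s ≫ x₀ ≫ D.j) :
      x ≫ P.proj = (s ≫ n) ≫ Z.proj := by rw [hx, Category.assoc, hn]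
    obtain ⟨z, hz, hzu⟩ := P.exists_descent (x₀ ≫ D.j)
      (fun s x hx => D.β.act (Z.ev (s ≫ n) x (hb hx))⁻¹ (D.u x (s ≫ x₀) (ha hx)))
      (by
        intro T₂ T₃ r s x hx hx'
        rw [D.β.comp_act, GrpObj.comp_inv, Z.comp_ev r _ x (hb hx) ((hb hx').trans (by
          simp only [Category.assoc])), D.comp_u r x _ (ha hx) ((ha hx').trans (by
          simp only [Category.assoc])), Z.ev_congr (Category.assoc r s n) rfl,
          D.u_congr rfl (Category.assoc r s x₀)])
      (by
        intro T₂ s g x hx hx'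
        rw [Z.ev_smul g _ x (hb hx), D.u_smul g x _ (ha hx), ← D.β.mul_act]
        congr 1
        group)
    have hzpr : z ≫ D.pr = x₀ := by
      refine P.hom_ext_of_locally (x₀ ≫ D.j) fun s x hx => ?_
      rw [← Category.assoc, hz s x hx, D.act_pr, D.u_pr]
    refine ⟨z, ⟨?_, hzpr⟩, ?_⟩
    · refine Z.hom_ext _ _ ?_ fun {T₂} s x hx hx' => ?_
      · rw [Category.assoc, hv, reassoc_of% hzpr, hn]
      · have h₁ : x ≫ P.proj = ((s ≫ z) ≫ v) ≫ Z.proj := by rw [hx, Category.assoc s z v]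
        have h₂ : x ≫ P.proj = ((s ≫ z) ≫ D.pr) ≫ D.j := by
          rw [h₁, Category.assoc _ v, hv]; simp only [Category.assoc]
        have h₃ : x ≫ P.proj = s ≫ x₀ ≫ D.j := by rw [hx', Category.assoc, hn]
        have e := hu (s ≫ z) x h₂ h₁
        rw [D.u_congr rfl (show (s ≫ z) ≫ D.pr = s ≫ x₀ by rw [Category.assoc, hzpr])] at e
        have e' := (D.β.inv_act_eq_iff _ _ _).1 (hz s x h₃).symm
        rw [Z.ev_congr (Category.assoc s z v).symm rfl]
        have h₄ : D.u x (s ≫ x₀) (ha h₃) ≫ D.pr = (s ≫ z) ≫ D.pr := by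
          rw [D.u_pr, Category.assoc, hzpr]
        exact (D.eq_div h₄ e).trans (D.eq_div h₄ e'.symm).symm
    · rintro z' ⟨h₁, h₂⟩
      refine hzu z' fun s x hx => ?_
      symm
      rw [D.β.inv_act_eq_iff]
      have h₃ : x ≫ P.proj = ((s ≫ z') ≫ v) ≫ Z.proj := by
        rw [Category.assoc s z' v, h₁]
        exact hb hx
      have h₄ : x ≫ P.proj = ((s ≫ z') ≫ D.pr) ≫ D.j := by
        rw [h₃, Category.assoc _ v, hv]; simp only [Category.assoc]
      have e := hu (s ≫ z') x h₄ h₃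
      rw [D.u_congr rfl (show (s ≫ z') ≫ D.pr = s ≫ x₀ by rw [Category.assoc, h₂]),
        Z.ev_congr (show (s ≫ z') ≫ v = s ≫ n by rw [Category.assoc, h₁]) rfl] at e
      exact e.symm
  · intro T h z
    refine Z.hom_ext _ _ ?_ fun {T₂} s x hx hx' => ?_
    · rw [Category.assoc, hv, Z.actFun_proj, Category.assoc, hv, ← Category.assoc, D.act_pr,
        Category.assoc]
    · rw [Z.ev_comp_actFun h _ s x hx']
      have h₁ : x ≫ P.proj = ((s ≫ z) ≫ v) ≫ Z.proj := by
        rw [hx', Z.comp_actFun_proj, Category.assoc s z v]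
      have h₂ : x ≫ P.proj = ((s ≫ z) ≫ D.pr) ≫ D.j := by
        rw [h₁, Category.assoc _ v, hv]; simp only [Category.assoc]
      have h₃ : x ≫ P.proj = ((s ≫ D.β.act h z) ≫ v) ≫ Z.proj := by
        rw [hx, Category.assoc s _ v]
      have h₄ : x ≫ P.proj = ((s ≫ D.β.act h z) ≫ D.pr) ≫ D.j := by
        rw [h₃, Category.assoc _ v, hv]; simp only [Category.assoc]
      have h₅ : (s ≫ D.β.act h z) ≫ D.pr = (s ≫ z) ≫ D.pr := by
        rw [Category.assoc, D.act_pr, Category.assoc]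
      have e := hu (s ≫ z) x h₂ h₁
      have e' := hu (s ≫ D.β.act h z) x h₄ h₃
      rw [D.u_congr rfl h₅] at e'
      have h₆ : D.u x ((s ≫ z) ≫ D.pr) h₂ ≫ D.pr = (s ≫ z) ≫ D.pr := D.u_pr _ _ _
      rw [Z.ev_congr (Category.assoc s _ v).symm rfl hx,
        Z.ev_congr (Category.assoc s z v).symm rfl, eq_mul_inv_iff_mul_eq]
      refine (D.eq_div h₆ ?_).trans (D.eq_div h₆ e).symm
      rw [D.β.mul_act, ← D.β.comp_act]
      exact e'

theorem exists_bundle [Surjective D.j.left] [IsClosedImmersion D.j.left]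
    (hj : ∀ {W₀ W : Scheme.{u}} (i : W₀ ⟶ W) (q₀ : W₀ ⟶ D.X₀.left) (q : W ⟶ X.left),
      IsPullback i q₀ q D.j.left → IsAffine W₀ → IsAffine W) :
    ∃ (Q : PrincipalBundle H X) (v : D.P' ⟶ Q.total),
      IsPullback v.left D.pr.left Q.proj.left D.j.left ∧
      ∀ {T : Over S} (h : T ⟶ H) (z : T ⟶ D.P'), D.β.act h z ≫ v = Q.smul h (z ≫ v) := by
  obtain ⟨_, z, hz⟩ := D.exists_representing hj
  obtain ⟨Z⟩ := exists_twistedForm z hz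
  obtain ⟨v, hpb, hv⟩ := D.exists_isPullback_twistedForm Z
  exact ⟨Z.bundle, v, hpb.map (Over.forget S), fun h z => (hv h z).trans (Z.bundle_smul h _).symm⟩

end LiftDatum

end FrobBundle

namespace FrobBundle


/-! ### Points of a group scheme along the inclusion of a fibre -/

open CartesianMonoidalCategory (fst snd lift)

theorem absFrobenius_naturality (p : ℕ) [Fact p.Prime] {X Y : Scheme.{u}} (f : X ⟶ Y)
    (hX : (p : Γ(X, ⊤)) = 0) (hY : (p : Γ(Y, ⊤)) = 0) :
    f ≫ absFrobenius p Y hY = absFrobenius p X hX ≫ f := by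
  refine Scheme.Hom.ext (by rfl) fun U => ?_
  rw [Scheme.Hom.comp_app, Scheme.Hom.comp_app]
  ext x
  refine (congrArg (fun φ : Γ(X, f ⁻¹ᵁ U) ⟶ Γ(X, f ⁻¹ᵁ U) => φ.hom (f.app U (x ^ p)))
    (X.presheaf.map_id (op (f ⁻¹ᵁ U)))).trans ?_
  exact map_pow (f.app U).hom x p

theorem overFrobenius_naturality (p : ℕ) [Fact p.Prime] {k : Type u} [Field k] [CharP k p]
    {T Y : Over (Spec (.of k))} (s : T ⟶ Y) :
    (Over.map (frobPoint p)).map s ≫ overFrobenius p Y = overFrobenius p T ≫ s := by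
  ext1
  exact absFrobenius_naturality p s.left (natCast_section_over p T) (natCast_section_over p Y)

theorem transpose_relFrobenius (p : ℕ) [Fact p.Prime] {k : Type u} [Field k] [CharP k p]
    (X : Over (Spec (.of k))) :
    transpose (frobPoint p) (relFrobenius p X) = overFrobenius p X :=
  Equiv.symm_apply_apply _ _

variable {S S' : Scheme.{u}} (f : S' ⟶ S)

theorem transpose_left {G : Over S} {T : Over S'} (g : T ⟶ (Over.pullback f).obj G) :
    (transpose f g).left = g.left ≫ pullback.fst G.hom f := by
  rw [transpose, Adjunction.homEquiv_counit]
  simp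

theorem transpose_bijective {G : Over S} {T : Over S'} :
    Function.Bijective (transpose f : (T ⟶ (Over.pullback f).obj G) → _) :=
  ((Over.mapPullbackAdj f).homEquiv T G).symm.bijective

/-- The morphism `φ : G' ⟶ H` over `f : S' ⟶ S` identifies the group scheme `G'` with the base
change of `H` along `f`. -/
structure IsFibre {G' : Over S'} [GrpObj G'] {H : Over S} [GrpObj H]
    (φ : (Over.map f).obj G' ⟶ H) : Prop where
  bijective : ∀ T : Over S', Function.Bijective fun g : T ⟶ G' => (Over.map f).map g ≫ φ
  map_mul : ∀ {T : Over S'} (g h : T ⟶ G'), (Over.map f).map (g * h) ≫ φ =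
    ((Over.map f).map g ≫ φ) * ((Over.map f).map h ≫ φ)

theorem IsFibre.map_one {G' : Over S'} [GrpObj G'] {H : Over S} [GrpObj H]
    {φ : (Over.map f).obj G' ⟶ H} (hφ : IsFibre f φ) (T : Over S') :
    (Over.map f).map (1 : T ⟶ G') ≫ φ = 1 :=
  (MonoidHom.mk' (fun g : T ⟶ G' => (Over.map f).map g ≫ φ) hφ.map_mul).map_one

/-- Both groups of points are compared with points of one group scheme `G` over a third base,
through multiplicative bijections; `φ` corresponds to the identity up to the canonical isomorphisms
`e`. -/
theorem isFibre_of_transpose {R : Scheme.{u}} {G' : Over S'} [GrpObj G'] {H : Over S} [GrpObj H]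
    {φ : (Over.map f).obj G' ⟶ H} {G : Over R} [GrpObj G] (E E' : Over S' → Over R)
    (e : ∀ T, E' T ≅ E T) (t : ∀ {T : Over S'}, (T ⟶ G') → (E T ⟶ G))
    (ht : ∀ T : Over S', Function.Bijective (t (T := T)))
    (t_mul : ∀ {T : Over S'} (g h : T ⟶ G'), t (g * h) = t g * t h)
    (t' : ∀ {T : Over S'}, ((Over.map f).obj T ⟶ H) → (E' T ⟶ G))
    (ht' : ∀ T : Over S', Function.Bijective (t' (T := T)))
    (t'_mul : ∀ {T : Over S'} (g h : (Over.map f).obj T ⟶ H), t' (g * h) = t' g * t' h)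
    (h : ∀ {T : Over S'} (g : T ⟶ G'), t' ((Over.map f).map g ≫ φ) = (e T).hom ≫ t g) :
    IsFibre f φ where
  bijective T := by
    have : (fun g : T ⟶ G' => t' ((Over.map f).map g ≫ φ)) =
      (fun g => (e T).hom ≫ g) ∘ t := funext fun g => h g
    refine (Function.Bijective.of_comp_iff' (ht' T) _).1 ?_
    refine (this ▸ Function.Bijective.comp ?_ (ht T) :)
    exact ((e T).symm.homFromEquiv (Z := G)).bijective
  map_mul {T} g k := by
    apply (ht' T).1
    rw [h, t_mul, t'_mul, h, h, MonObj.comp_mul]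

theorem isFibre_pullback {R : Scheme.{u}} (a : S ⟶ R) (c : S' ⟶ R) (hc : f ≫ a = c) {G : Over R}
    [GrpObj G] (φ : (Over.map f).obj ((Over.pullback c).obj G) ⟶ (Over.pullback a).obj G)
    (h : φ.left ≫ pullback.fst G.hom a = pullback.fst G.hom c) : IsFibre f φ := by
  refine isFibre_of_transpose f (fun T => (Over.map c).obj T)
    (fun T => (Over.map a).obj ((Over.map f).obj T))
    (fun T => Over.isoMk (Iso.refl _) (by
      change 𝟙 _ ≫ T.hom ≫ c = (T.hom ≫ f) ≫ a
      rw [Category.id_comp, Category.assoc, hc]))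
    (transpose c) (fun T => transpose_bijective c) (transpose_mul c) (transpose a)
    (fun T => transpose_bijective a) (transpose_mul a) ?_
  intro T g
  ext1
  refine (transpose_left a _).trans (Eq.trans ?_ (Category.id_comp _).symm)
  refine Eq.trans ?_ (transpose_left c g).symm
  exact (Category.assoc _ _ _).trans (congrArg (g.left ≫ ·) h)

theorem isFibre_pullback_pullback {R R' : Scheme.{u}} (a : S ⟶ R) (d : R ⟶ R') {Q : Scheme.{u}}
    (b : S' ⟶ Q) (c : Q ⟶ R') (hc : (f ≫ a) ≫ d = b ≫ c) {G : Over R'} [GrpObj G]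
    (φ : (Over.map f).obj ((Over.pullback b).obj ((Over.pullback c).obj G)) ⟶
      (Over.pullback a).obj ((Over.pullback d).obj G))
    (h : φ.left ≫ pullback.fst (pullback.snd G.hom d) a ≫ pullback.fst G.hom d =
      pullback.fst (pullback.snd G.hom c) b ≫ pullback.fst G.hom c) : IsFibre f φ := by
  refine isFibre_of_transpose f (fun T => (Over.map c).obj ((Over.map b).obj T))
    (fun T => (Over.map d).obj ((Over.map a).obj ((Over.map f).obj T)))
    (fun T => Over.isoMk (Iso.refl _) (by
      change 𝟙 _ ≫ (T.hom ≫ b) ≫ c = ((T.hom ≫ f) ≫ a) ≫ d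
      rw [Category.id_comp, Category.assoc, ← hc, Category.assoc, Category.assoc, Category.assoc]))
    (fun g => transpose c (transpose b g))
    (fun T => (transpose_bijective c).comp (transpose_bijective b))
    (fun g h => by rw [transpose_mul, transpose_mul])
    (fun g => transpose d (transpose a g))
    (fun T => (transpose_bijective d).comp (transpose_bijective a))
    (fun g h => by rw [transpose_mul, transpose_mul]) ?_
  intro T g
  ext1
  refine Eq.trans ?_ (Category.id_comp _).symm
  have h₁ : (transpose c (transpose b g)).left =
      g.left ≫ pullback.fst (pullback.snd G.hom c) b ≫ pullback.fst G.hom c := by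
    rw [transpose_left, transpose_left, Category.assoc]
    rfl
  refine Eq.trans ?_ h₁.symm
  rw [transpose_left, transpose_left, Category.assoc, Over.comp_left, Category.assoc]
  exact congrArg (g.left ≫ ·) h

section

variable {p : ℕ} [Fact p.Prime] {k : Type u} [Field k] [CharP k p] {A : Type u} [CommRing A]
  [Algebra (WittVector p k) A] {ε : A →+* k}
  (hε : ε.comp (algebraMap (WittVector p k) A) = WittVector.constantCoeff)
  (G : Over (Spec (.of (WittVector p k))))

theorem isFibre_fibreIncl [GrpObj G] : IsFibre (specRes ε) (fibreIncl hε G) :=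
  isFibre_pullback _ _ _ (specRes_specAlg hε) _ (pullback.lift_fst _ _ _)

/-- Both iterated base changes have as points certain points of `G`. The two resulting structure
morphisms agree since the Frobenius of `W(k)` reduces to that of `k`. -/
theorem isFibre_twistFibreIncl [GrpObj G] : IsFibre (specRes ε) (twistFibreIncl hε G) := by
  refine isFibre_pullback_pullback _ _ _ _ _ ?_ _ ?_
  · rw [specRes_specAlg hε, closedPoint_frobWitt]
  · have e₁ : (twistFibreIncl hε G).left ≫ pullback.fst (wittTwist p G).hom (specAlg p A) =
      pullback.lift _ _ (twistFibreIncl_aux G) := pullback.lift_fst _ _ _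
    refine (Category.assoc _ _ _).symm.trans
      ((congrArg (· ≫ pullback.fst G.hom (frobWitt p)) e₁).trans ?_)
    exact pullback.lift_fst _ _ _

end

end FrobBundle

namespace FrobBundle


/-! ### Bundles on a fibre as torsors over the base -/

open CartesianMonoidalCategory (fst snd lift)

variable {S S' : Scheme.{u}} (f : S' ⟶ S)

/-- A scheme over `S` with a morphism to a scheme over `S'`, as a scheme over `S'`. -/
def overSource {T : Over S} {Y : Over S'} (z : T ⟶ (Over.map f).obj Y) : Over S' :=
  Over.mk (z.left ≫ Y.hom)

/-- The identity of `T`. -/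
def overSourceIso {T : Over S} {Y : Over S'} (z : T ⟶ (Over.map f).obj Y) :
    T ≅ (Over.map f).obj (overSource f z) :=
  Over.isoMk (Iso.refl _) (by
    refine (Category.id_comp _).trans ?_
    exact (Category.assoc _ _ _).trans (Over.w z))

/-- The point `z`, as a morphism over `S'`. -/
def overSourceHom {T : Over S} {Y : Over S'} (z : T ⟶ (Over.map f).obj Y) : overSource f z ⟶ Y :=
  Over.homMk z.left

theorem overSource_fac {T : Over S} {Y : Over S'} (z : T ⟶ (Over.map f).obj Y) :
    (overSourceIso f z).hom ≫ (Over.map f).map (overSourceHom f z) = z := by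
  ext1
  exact Category.id_comp _

theorem over_map_injective {T Y : Over S'} {a b : T ⟶ Y}
    (h : (Over.map f).map a = (Over.map f).map b) : a = b := by
  ext1
  exact congr(($h).left)

variable {f} {G : Over S'} [GrpObj G] {H : Over S} [GrpObj H] {φ : (Over.map f).obj G ⟶ H}
  (hφ : IsFibre f φ)

namespace IsFibre

include hφ in
theorem exists_eq {T : Over S} {T₁ : Over S'} (c : T ≅ (Over.map f).obj T₁) (h : T ⟶ H) :
    ∃ g : T₁ ⟶ G, h = c.hom ≫ (Over.map f).map g ≫ φ := by
  obtain ⟨g, hg⟩ := (hφ.bijective T₁).2 (c.inv ≫ h)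
  exact ⟨g, by rw [← Iso.inv_comp_eq, ← hg]⟩

/-- The point of `G` corresponding to a point of `H`. -/
def point {T : Over S} {T₁ : Over S'} (c : T ≅ (Over.map f).obj T₁) (h : T ⟶ H) : T₁ ⟶ G :=
  (hφ.exists_eq c h).choose

theorem point_spec {T : Over S} {T₁ : Over S'} (c : T ≅ (Over.map f).obj T₁) (h : T ⟶ H) :
    h = c.hom ≫ (Over.map f).map (hφ.point c h) ≫ φ := (hφ.exists_eq c h).choose_spec

theorem eq_point {T : Over S} {T₁ : Over S'} (c : T ≅ (Over.map f).obj T₁) (h : T ⟶ H)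
    {g : T₁ ⟶ G} (hg : h = c.hom ≫ (Over.map f).map g ≫ φ) : g = hφ.point c h := by
  apply (hφ.bijective T₁).1
  rw [← cancel_epi c.hom]
  exact hg.symm.trans (hφ.point_spec c h)

variable {X : Over S'} (Q : PrincipalBundle G X)

/-- The action of `H` on a principal bundle under its fibre. -/
def actFun {T : Over S} (h : T ⟶ H) (z : T ⟶ (Over.map f).obj Q.total) :
    T ⟶ (Over.map f).obj Q.total :=
  (overSourceIso f z).hom ≫
    (Over.map f).map (Q.smul (hφ.point (overSourceIso f z) h) (overSourceHom f z))

/-- A point of `Q` gives its source a structure over `S'`, through which points of `H` become points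
of `G`. The action so defined may be computed with any other presentation over `S'`, which reduces
the action axioms to those of `Q`. -/
theorem actFun_eq {T : Over S} {T₁ : Over S'} (c : T ⟶ (Over.map f).obj T₁) (g : T₁ ⟶ G)
    (z : T₁ ⟶ Q.total) {h : T ⟶ H} (hh : h = c ≫ (Over.map f).map g ≫ φ)
    {w : T ⟶ (Over.map f).obj Q.total} (hw : w = c ≫ (Over.map f).map z) :
    hφ.actFun Q h w = c ≫ (Over.map f).map (Q.smul g z) := by
  let d : overSource f w ⟶ T₁ := Over.homMk c.left (by
    subst hw
    change c.left ≫ T₁.hom = (c.left ≫ z.left) ≫ Q.total.hom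
    rw [Category.assoc, Over.w])
  have hd : (overSourceIso f w).hom ≫ (Over.map f).map d = c := by
    ext1
    exact Category.id_comp _
  have hz : overSourceHom f w = d ≫ z := by
    subst hw
    ext1
    rfl
  have hg : d ≫ g = hφ.point (overSourceIso f w) h := by
    apply hφ.eq_point
    rw [hh, ← hd, Functor.map_comp]
    simp only [Category.assoc]
  rw [actFun, ← hg, hz, ← Q.comp_smul, Functor.map_comp, reassoc_of% hd]

/-- The action of `H` on a principal bundle under its fibre. -/
def ptAct : PtAct H ((Over.map f).obj Q.total) where
  act := hφ.actFun Q
  comp_act s h z := by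
    rw [hφ.actFun_eq Q (s ≫ (overSourceIso f z).hom) (hφ.point (overSourceIso f z) h)
      (overSourceHom f z) (h := s ≫ h) (w := s ≫ z)]
    · rw [actFun, Category.assoc]
    · conv_lhs => rw [hφ.point_spec (overSourceIso f z) h]
      simp only [Category.assoc]
    · rw [Category.assoc, overSource_fac]
  one_act z := by
    rw [hφ.actFun_eq Q (overSourceIso f z).hom 1 (overSourceHom f z) (h := 1)
      (by rw [hφ.map_one, MonObj.comp_one]) (overSource_fac f z).symm]
    exact (congrArg _ (congrArg _ (lift_one_smul _))).trans (overSource_fac f z)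
  mul_act g h z := by
    have hg := hφ.point_spec (overSourceIso f z) g
    have hh := hφ.point_spec (overSourceIso f z) h
    rw [hφ.actFun_eq Q (overSourceIso f z).hom _ _ hh (overSource_fac f z).symm,
      hφ.actFun_eq Q (overSourceIso f z).hom _ _ hg rfl,
      hφ.actFun_eq Q (overSourceIso f z).hom
        (hφ.point (overSourceIso f z) g * hφ.point (overSourceIso f z) h) (overSourceHom f z)
        (h := g * h) ?_ (overSource_fac f z).symm, Q.mul_smul]
    rw [hφ.map_mul, MonObj.comp_mul, ← hg, ← hh]

theorem actFun_proj {T : Over S} (h : T ⟶ H) (z : T ⟶ (Over.map f).obj Q.total) :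
    hφ.actFun Q h z ≫ (Over.map f).map Q.proj = z ≫ (Over.map f).map Q.proj := by
  rw [actFun, Category.assoc, ← Functor.map_comp, Q.smul_comp_proj, Functor.map_comp,
    reassoc_of% (overSource_fac f z)]

theorem existsUnique_actFun {T : Over S} (a b : T ⟶ (Over.map f).obj Q.total)
    (hab : a ≫ (Over.map f).map Q.proj = b ≫ (Over.map f).map Q.proj) :
    ∃! h : T ⟶ H, hφ.actFun Q h b = a := by
  let c := overSourceIso f b
  have hab' : a.left ≫ Q.proj.left = b.left ≫ Q.proj.left := congr(($hab).left)
  let a₁ : overSource f b ⟶ Q.total := Over.homMk a.left (by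
    change _ = b.left ≫ Q.total.hom
    rw [← Over.w Q.proj]
    exact (Category.assoc _ _ _).symm.trans ((congrArg (· ≫ X.hom) hab').trans (Category.assoc _ _ _)))
  have ha : c.hom ≫ (Over.map f).map a₁ = a := by
    ext1
    exact Category.id_comp _
  have h₁ : a₁ ≫ Q.proj = overSourceHom f b ≫ Q.proj := by
    ext1
    exact hab'
  obtain ⟨g, hg, hu⟩ := Q.simply_transitive _ _ h₁
  refine ⟨c.hom ≫ (Over.map f).map g ≫ φ, ?_, fun h hh => ?_⟩
  · refine (hφ.actFun_eq Q c.hom g (overSourceHom f b) rfl (overSource_fac f b).symm).trans ?_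
    rw [← ha]
    exact congrArg _ (congrArg _ hg)
  · rw [hφ.point_spec c h, hu (hφ.point c h)]
    apply over_map_injective f
    rw [← cancel_epi c.hom]
    exact hh.trans ha.symm

end IsFibre

/-! ### The relative Frobenius of a principal bundle -/

section

variable (p : ℕ) [Fact p.Prime] {k : Type u} [Field k] [CharP k p] {G X : Over (Spec (.of k))}
  [GrpObj G] (P : PrincipalBundle G X)

/-- The relative Frobenius `P ⟶ F_X^* P` of a principal bundle. -/
def PrincipalBundle.relFrob : P.total ⟶ pbTotal (frobPoint p) (overFrobenius p X) P :=
  pbLift (frobPoint p) (overFrobenius p X) P (overFrobenius p P.total) P.proj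
    (overFrobenius_naturality p P.proj).symm

theorem PrincipalBundle.relFrob_fst : (Over.map (frobPoint p)).map (P.relFrob p) ≫
    pbFst (frobPoint p) (overFrobenius p X) P = overFrobenius p P.total := pbLift_fst ..

theorem PrincipalBundle.relFrob_snd :
    P.relFrob p ≫ pbSnd (frobPoint p) (overFrobenius p X) P = P.proj := pbLift_snd ..

/-- Absolute Frobenius commutes with every morphism, in particular with the action. This exhibits
`F_X^* P` as the bundle induced from `P` along the relative Frobenius of `G`. -/
theorem PrincipalBundle.smul_relFrob {T : Over (Spec (.of k))} (g : T ⟶ G) (x : T ⟶ P.total) :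
    P.smul g x ≫ P.relFrob p = lift (g ≫ relFrobenius p G) (x ≫ P.relFrob p) ≫
      pbSMul (frobPoint p) (overFrobenius p X) P := by
  apply pb_ext
  · rw [lift_pbSMul_fst, Functor.map_comp, Functor.map_comp, Category.assoc, Category.assoc,
      transpose_comp, transpose_relFrobenius, relFrob_fst, overFrobenius_naturality,
      overFrobenius_naturality, overFrobenius_naturality]
    exact P.comp_smul _ _ _
  · rw [lift_pbSMul_snd, Category.assoc, Category.assoc, relFrob_snd, P.smul_comp_proj]

end

end FrobBundle

namespace FrobBundle


/-! ### Lifting principal bundles along a thickening -/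

open CartesianMonoidalCategory (fst snd lift)

section

variable {S S' : Scheme.{u}} {f : S' ⟶ S} {G₁ H₁ X : Over S'} [GrpObj G₁] [GrpObj H₁]
  {G H Y : Over S} [GrpObj G] [GrpObj H] {φ : (Over.map f).obj G₁ ⟶ G}
  {ψ : (Over.map f).obj H₁ ⟶ H} (hφ : IsFibre f φ) (hψ : IsFibre f ψ) {i : (Over.map f).obj X ⟶ Y}
  (P : PrincipalBundle G₁ X) (PA : PrincipalBundle G Y) (Q : PrincipalBundle H₁ X)

/-- A morphism of bundles as a morphism of torsors along `i`. -/
structure BundleMap (φ : (Over.map f).obj G₁ ⟶ G) (i : (Over.map f).obj X ⟶ Y) where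
  /-- the morphism -/
  hom : (Over.map f).obj P.total ⟶ PA.total
  isPullback : IsPullback hom.left P.proj.left PA.proj.left i.left
  hom_smul : ∀ {T : Over S'} (g : T ⟶ G₁) (t : T ⟶ P.total),
    (Over.map f).map (P.smul g t) ≫ hom = PA.smul ((Over.map f).map g ≫ φ) ((Over.map f).map t ≫ hom)

variable {P PA} (u : BundleMap P PA φ i)

namespace BundleMap

/-- The point of `P` with given images in `PA` and `X`. -/
def pt {T : Over S} (x : T ⟶ PA.total) (x₀ : T ⟶ (Over.map f).obj X) (h : x ≫ PA.proj = x₀ ≫ i) :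
    T ⟶ (Over.map f).obj P.total :=
  Over.homMk (u.isPullback.lift x.left x₀.left congr(($h).left)) (by
    have e := u.isPullback.lift_fst x.left x₀.left congr(($h).left)
    have e' : u.hom.left ≫ PA.total.hom = ((Over.map f).obj P.total).hom := Over.w u.hom
    rw [← e', reassoc_of% e, Over.w])

theorem pt_hom {T : Over S} (x : T ⟶ PA.total) (x₀ : T ⟶ (Over.map f).obj X)
    (h : x ≫ PA.proj = x₀ ≫ i) : u.pt x x₀ h ≫ u.hom = x := by
  ext1
  exact u.isPullback.lift_fst _ _ _

theorem pt_proj {T : Over S} (x : T ⟶ PA.total) (x₀ : T ⟶ (Over.map f).obj X)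
    (h : x ≫ PA.proj = x₀ ≫ i) : u.pt x x₀ h ≫ (Over.map f).map P.proj = x₀ := by
  ext1
  exact u.isPullback.lift_snd _ _ _

theorem hom_ext {T : Over S} {a b : T ⟶ (Over.map f).obj P.total} (h : a ≫ u.hom = b ≫ u.hom)
    (h' : a ≫ (Over.map f).map P.proj = b ≫ (Over.map f).map P.proj) : a = b := by
  ext1
  exact u.isPullback.hom_ext congr(($h).left) congr(($h').left)

theorem comp_pt {T T' : Over S} (s : T' ⟶ T) (x : T ⟶ PA.total) (x₀ : T ⟶ (Over.map f).obj X)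
    (h : x ≫ PA.proj = x₀ ≫ i) (h' : (s ≫ x) ≫ PA.proj = (s ≫ x₀) ≫ i) :
    s ≫ u.pt x x₀ h = u.pt (s ≫ x) (s ≫ x₀) h' := by
  apply u.hom_ext
  · rw [Category.assoc, pt_hom, pt_hom]
  · rw [Category.assoc, pt_proj, pt_proj]

-- A point lying over `X` and its translate can be presented simultaneously by data over `S'`, so
-- that equivariance over `S'` can be applied to points over `S`.
include hφ in
theorem exists_pt_smul {T : Over S} (g : T ⟶ G) (x : T ⟶ PA.total) (x₀ : T ⟶ (Over.map f).obj X)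
    (h : x ≫ PA.proj = x₀ ≫ i) (h' : PA.smul g x ≫ PA.proj = x₀ ≫ i) :
    ∃ (T₁ : Over S') (c : T ≅ (Over.map f).obj T₁) (g₁ : T₁ ⟶ G₁) (x₁ : T₁ ⟶ P.total),
      g = c.hom ≫ (Over.map f).map g₁ ≫ φ ∧ u.pt x x₀ h = c.hom ≫ (Over.map f).map x₁ ∧
      u.pt (PA.smul g x) x₀ h' = c.hom ≫ (Over.map f).map (P.smul g₁ x₁) := by
  have hc := overSource_fac f (u.pt x x₀ h)
  have hg := hφ.point_spec (overSourceIso f (u.pt x x₀ h)) g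
  refine ⟨_, overSourceIso f (u.pt x x₀ h), hφ.point _ g, _, hg, hc.symm, ?_⟩
  apply u.hom_ext
  · rw [pt_hom, Category.assoc, u.hom_smul, PA.comp_smul, ← hg, reassoc_of% hc, pt_hom]
  · rw [pt_proj, Category.assoc, ← Functor.map_comp, P.smul_comp_proj, Functor.map_comp,
      reassoc_of% hc, pt_proj]

/-- The equivariant morphism to an `H₁`-bundle and the bundle `PA` define a lifting problem. -/
def liftDatum [Mono i.left] {F₁ : G₁ ⟶ H₁} (F : G ⟶ H) [IsMonHom F]
    (hF : φ ≫ F = (Over.map f).map F₁ ≫ ψ) (r : P.total ⟶ Q.total) (hr : r ≫ Q.proj = P.proj)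
    (hr' : ∀ {T : Over S'} (g : T ⟶ G₁) (x : T ⟶ P.total),
      P.smul g x ≫ r = Q.smul (g ≫ F₁) (x ≫ r)) : LiftDatum PA F where
  X₀ := (Over.map f).obj X
  P' := (Over.map f).obj Q.total
  j := i
  mono := inferInstance
  pr := (Over.map f).map Q.proj
  β := hψ.ptAct Q
  act_pr h z := hψ.actFun_proj Q h z
  simply_transitive a b hab := hψ.existsUnique_actFun Q a b hab
  u x x₀ h := u.pt x x₀ h ≫ (Over.map f).map r
  comp_u s x x₀ h h' := by rw [← Category.assoc, u.comp_pt s x x₀ h h']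
  u_pr x x₀ h := by rw [Category.assoc, ← Functor.map_comp, hr, u.pt_proj]
  u_smul g x x₀ h h' := by
    obtain ⟨T₁, c, g₁, x₁, hg, hx, hx'⟩ := u.exists_pt_smul hφ g x x₀ h h'
    rw [hx', Category.assoc, ← Functor.map_comp, hr']
    refine (hψ.actFun_eq Q c.hom (g₁ ≫ F₁) (x₁ ≫ r) ?_ ?_).symm
    · rw [hg, Category.assoc, Category.assoc, hF, Functor.map_comp, Category.assoc]
    · rw [hx, Category.assoc, Functor.map_comp]

end BundleMap

end

/-! ### The lift of the Frobenius pullback of a principal bundle -/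

section

variable {p : ℕ} [Fact p.Prime] {k : Type u} [Field k] [CharP k p]
  {A : Type u} [CommRing A] {ε : A →+* k}

theorem augmentation_surjective [Algebra (WittVector p k) A]
    (hε : ε.comp (algebraMap (WittVector p k) A) = WittVector.constantCoeff) :
    Function.Surjective ε := by
  intro x
  -- The Teichmüller representative is a preimage of `x` in `W(k)`.
  refine ⟨algebraMap (WittVector p k) A (WittVector.teichmuller p x), ?_⟩
  rw [← RingHom.comp_apply, hε]
  exact WittVector.teichmuller_coeff_zero p x

/-- The kernel is a proper ideal, so it lies in the maximal ideal, which is the Jacobson radical and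
nilpotent in an Artinian local ring. -/
theorem exists_ker_pow_eq_bot [IsLocalRing A] [IsArtinianRing A] (ε : A →+* k) :
    ∃ m : ℕ, RingHom.ker ε ^ m = ⊥ := by
  obtain ⟨m, hm⟩ := IsArtinianRing.isNilpotent_jacobson_bot (R := A)
  refine ⟨m, le_bot_iff.1 ?_⟩
  refine (Ideal.pow_right_mono ?_ m).trans hm.le
  rw [IsLocalRing.jacobson_eq_maximalIdeal ⊥ bot_ne_top]
  exact IsLocalRing.le_maximalIdeal (RingHom.ker_ne_top ε)

theorem exists_bundle_lift [Algebra (WittVector p k) A] [IsLocalRing A] [IsArtinianRing A]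
    {G : Over (Spec (.of (WittVector p k)))} [GrpObj G]
    (hε : ε.comp (algebraMap (WittVector p k) A) = WittVector.constantCoeff)
    {F : overAlg p A G ⟶ overAlg p A (wittTwist p G)} (hF : IsFrobeniusLifting hε F)
    {X : Over (Spec (.of k))} {XA : Over (Spec (.of A))}
    {i : (Over.map (specRes ε)).obj X ⟶ XA} (hi : IsDeformation ε i)
    (P : PrincipalBundle (specialFibre p G) X) (PA : PrincipalBundle (overAlg p A G) XA)
    (h : PrincipalBundle.IsPullbackOf (specRes ε) (fibreIncl hε G) i P PA) :
    ∃ PA' : PrincipalBundle (overAlg p A (wittTwist p G)) XA,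
      PrincipalBundle.IsPullbackOf (specRes ε) (twistFibreIncl hε G) i
        (P.frobeniusPullback p) PA' := by
  obtain ⟨u, hu, hu'⟩ := h
  have := hF.isMonHom
  obtain ⟨m, hm⟩ := exists_ker_pow_eq_bot ε
  have hsurj : Function.Surjective (CommRingCat.ofHom ε) := augmentation_surjective hε
  have : Surjective i.left := surjective_of_isPullback hi.isPullback hsurj hm
  have : IsClosedImmersion i.left := isClosedImmersion_of_isPullback hi.isPullback hsurj
  let u' : BundleMap P PA (fibreIncl hε G) i := ⟨u, hu, hu'⟩
  -- The lifting problem is posed for `F_X^* P` with the relative Frobenius of `P` as equivariant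
  -- morphism. The hypothesis on the special fibre of `F` is precisely its compatibility with the
  -- groups over `A`.
  let D : LiftDatum PA F := u'.liftDatum (isFibre_fibreIncl hε G) (isFibre_twistFibreIncl hε G)
    (P.frobeniusPullback p) F hF.restrict (P.relFrob p) (P.relFrob_snd p) (P.smul_relFrob p)
  have : Surjective D.j.left := ‹Surjective i.left›
  have : IsClosedImmersion D.j.left := ‹IsClosedImmersion i.left›
  obtain ⟨PA', v, hv, hv'⟩ := D.exists_bundle (by
    intro W₀ W a q₀ q hpb hW₀
    -- A base change of `X ⟶ X_A` is also a base change of `Spec k ⟶ Spec A`.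
    exact isAffine_of_isPullback (hpb.paste_vert hi.isPullback) hsurj Fact.out
      (CharP.cast_eq_zero k p) hm)
  refine ⟨PA', v, hv, fun {T} g t => ?_⟩
  refine Eq.trans ?_ (hv' _ _)
  refine congrArg (· ≫ v) ?_
  have := (isFibre_twistFibreIncl hε G).actFun_eq (P.frobeniusPullback p) (𝟙 _) g t
    (Category.id_comp _).symm (Category.id_comp _).symm
  exact ((Category.id_comp _).symm.trans this.symm)

end

end FrobBundle

namespace FrobBundle


/-! ### Sections and morphisms of sheaves of modules -/

variable {X Y : Scheme.{u}}

/-- The restriction of functions. -/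
def res (X : Scheme.{u}) {U V : X.Opens} (h : V ≤ U) : Γ(X, U) →+* Γ(X, V) :=
  (X.presheaf.map (homOfLE h).op).hom

/-- The restriction of sections of a module. -/
def mres (M : X.Modules) {U V : X.Opens} (h : V ≤ U) : Γ(M, U) →+ Γ(M, V) :=
  (M.presheaf.map (homOfLE h).op).hom

theorem res_res {U V W : X.Opens} (h : V ≤ U) (h' : W ≤ V) (s : Γ(X, U)) :
    res X h' (res X h s) = res X (h'.trans h) s := presheaf_map_map_apply X h h' s

theorem res_refl {U : X.Opens} (h : U ≤ U) (s : Γ(X, U)) : res X h s = s :=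
  congr($(X.presheaf.map_id (op U)) s)

theorem mres_mres (M : X.Modules) {U V W : X.Opens} (h : V ≤ U) (h' : W ≤ V) (s : Γ(M, U)) :
    mres M h' (mres M h s) = mres M (h'.trans h) s :=
  congr($(M.presheaf.map_comp (homOfLE h).op (homOfLE h').op) s).symm

theorem mres_refl (M : X.Modules) {U : X.Opens} (h : U ≤ U) (s : Γ(M, U)) : mres M h s = s :=
  congr($(M.presheaf.map_id (op U)) s)

theorem mres_smul (M : X.Modules) {U V : X.Opens} (h : V ≤ U) (r : Γ(X, U)) (s : Γ(M, U)) :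
    mres M h (r • s) = res X h r • mres M h s := M.map_smul (homOfLE h) r s

theorem app_res (f : X ⟶ Y) {U V : Y.Opens} (h : V ≤ U) (s : Γ(Y, U)) :
    f.app V (res Y h s) = res X (f.preimage_mono h) (f.app U s) := app_map_apply f h s

theorem app_mres {M N : X.Modules} (φ : M ⟶ N) {U V : X.Opens} (h : V ≤ U) (s : Γ(M, U)) :
    φ.app V (mres M h s) = mres N h (φ.app U s) :=
  congr($(φ.mapPresheaf.naturality (homOfLE h).op) s)

/-- A morphism of sheaves of modules, given on sections. -/
theorem exists_modules_hom (M N : X.Modules) (f : ∀ U : X.Opens, Γ(M, U) →ₗ[Γ(X, U)] Γ(N, U))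
    (hf : ∀ {U V : X.Opens} (h : V ≤ U) (s : Γ(M, U)), mres N h (f U s) = f V (mres M h s)) :
    ∃ φ : M ⟶ N, ∀ U s, φ.app U s = f U s := by
  refine ⟨⟨PresheafOfModules.homMk
    { app := fun U => AddCommGrpCat.ofHom (f U.unop).toAddMonoidHom
      naturality := ?_ } fun U r m => (f U.unop).map_smul r m⟩, fun U s => rfl⟩
  intro U V i
  ext s
  exact (hf i.unop.le s).symm

theorem mres_ext_of_cover (M : X.Modules) {I : Type*} {U : X.Opens} (V : I → X.Opens)
    (hV : U ≤ ⨆ a, V a) {s t : Γ(M, U)}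
    (h : ∀ a, mres M (inf_le_left : U ⊓ V a ≤ U) s = mres M inf_le_left t) : s = t := by
  refine TopCat.Sheaf.eq_of_locally_eq' (C := Ab) ⟨M.presheaf, M.isSheaf⟩ (fun a => U ⊓ V a) U
    (fun a => homOfLE inf_le_left) ?_ s t h
  rw [← inf_iSup_eq]
  exact le_inf le_rfl hV

theorem exists_mres_glue (M : X.Modules) {I : Type*} {U : X.Opens} (V : I → X.Opens)
    (hV : U ≤ ⨆ a, V a) (s : ∀ a, Γ(M, U ⊓ V a))
    (h : ∀ a b, mres M (inf_le_left : (U ⊓ V a) ⊓ (U ⊓ V b) ≤ _) (s a) =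
      mres M inf_le_right (s b)) :
    ∃ t : Γ(M, U), ∀ a, mres M inf_le_left t = s a := by
  refine (TopCat.Sheaf.existsUnique_gluing' (C := Ab) ⟨M.presheaf, M.isSheaf⟩ (fun a => U ⊓ V a) U
    (fun a => homOfLE inf_le_left) ?_ s h).exists
  rw [← inf_iSup_eq]
  exact le_inf le_rfl hV

/-- The value on a section is glued from the values on its restrictions to the members of the cover;
uniqueness of glueing yields linearity and naturality. -/
theorem exists_modules_hom_of_cover (M N : X.Modules) {I : Type*} (V : I → X.Opens)
    (hV : ⨆ a, V a = ⊤) (f : ∀ (a : I) (U : X.Opens), U ≤ V a → Γ(M, U) →ₗ[Γ(X, U)] Γ(N, U))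
    (hf : ∀ (a b : I) {U U' : X.Opens} (hU : U ≤ V a) (hU' : U' ≤ V b) (h : U' ≤ U) (s : Γ(M, U)),
      mres N h (f a U hU s) = f b U' hU' (mres M h s)) :
    ∃ φ : M ⟶ N, ∀ a U hU s, φ.app U s = f a U hU s := by
  have hV' (U : X.Opens) : U ≤ ⨆ a, V a := hV ▸ le_top
  have key (U : X.Opens) (s : Γ(M, U)) : ∃ t : Γ(N, U), ∀ a, mres N inf_le_left t =
      f a (U ⊓ V a) inf_le_right (mres M inf_le_left s) := by
    refine exists_mres_glue N V (hV' U) _ fun a b => ?_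
    rw [hf a a _ (inf_le_left.trans inf_le_right), hf b a _ (inf_le_left.trans inf_le_right),
      mres_mres, mres_mres]
  choose g hg using key
  have hgu (U : X.Opens) (s : Γ(M, U)) (t : Γ(N, U)) (h : ∀ a, mres N inf_le_left t =
      f a (U ⊓ V a) inf_le_right (mres M inf_le_left s)) : g U s = t :=
    mres_ext_of_cover N V (hV' U) fun a => by rw [hg, h]
  obtain ⟨φ, hφ⟩ := exists_modules_hom M N (fun U =>
    { toFun := g U
      map_add' := fun s t => hgu U _ _ fun a => by rw [map_add, hg, hg, map_add, map_add]
      map_smul' := fun r s => hgu U _ _ fun a => by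
        rw [RingHom.id_apply, mres_smul, hg, mres_smul, map_smul] }) (by
      intro U V' h s
      symm
      refine hgu V' _ _ fun a => ?_
      have e := congrArg (mres N (inf_le_inf_right (V a) h)) (hg U s a)
      rw [mres_mres, hf a a _ inf_le_right, mres_mres] at e
      change mres N _ (mres N h (g U s)) = _
      rw [mres_mres, e, mres_mres])
  refine ⟨φ, fun a U hU s => ?_⟩
  rw [hφ]
  refine hgu U _ _ fun b => ?_
  rw [hf a b]

/-! ### Frames -/

variable {n : ℕ}

/-- The isomorphism given by a frame. -/
def frameEquiv {M : X.Modules} {U : X.Opens} {e : Fin n → Γ(M, U)} (he : IsFrame M U e)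
    {V : X.Opens} (hV : V ≤ U) : (Fin n → Γ(X, V)) ≃ₗ[Γ(X, V)] Γ(M, V) :=
  LinearEquiv.ofBijective (Fintype.linearCombination Γ(X, V) fun i => mres M hV (e i)) (he V hV)

theorem frameEquiv_apply {M : X.Modules} {U : X.Opens} {e : Fin n → Γ(M, U)} (he : IsFrame M U e)
    {V : X.Opens} (hV : V ≤ U) (r : Fin n → Γ(X, V)) :
    frameEquiv he hV r = ∑ i, r i • mres M hV (e i) := rfl

theorem frameEquiv_single {M : X.Modules} {U : X.Opens} {e : Fin n → Γ(M, U)} (he : IsFrame M U e)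
    {V : X.Opens} (hV : V ≤ U) (i : Fin n) :
    frameEquiv he hV (Pi.single i 1) = mres M hV (e i) := by
  rw [frameEquiv_apply, Finset.sum_eq_single i]
  · simp
  · intro j _ hj
    simp [hj]
  · simp

theorem mres_frameEquiv {M : X.Modules} {U : X.Opens} {e : Fin n → Γ(M, U)} (he : IsFrame M U e)
    {V W : X.Opens} (hV : V ≤ U) (hW : W ≤ V) (r : Fin n → Γ(X, V)) :
    mres M hW (frameEquiv he hV r) = frameEquiv he (hW.trans hV) fun i => res X hW (r i) := by
  rw [frameEquiv_apply, frameEquiv_apply, map_sum]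
  refine Finset.sum_congr rfl fun i _ => ?_
  rw [mres_smul, mres_mres]

theorem IsFrame.restrict {M : X.Modules} {U : X.Opens} {e : Fin n → Γ(M, U)} (he : IsFrame M U e)
    {V : X.Opens} (hV : V ≤ U) : IsFrame M V fun i => mres M hV (e i) := by
  intro W hW
  convert he W (hW.trans hV) using 5 with r i
  exact mres_mres M hV hW _

/-- The transition relation of frames over the members of a covering. -/
def HasTransition (M : X.Modules) {I : Type*} (V : I → X.Opens)
    (t : ∀ a b, Matrix (Fin n) (Fin n) Γ(X, V a ⊓ V b)) (e : ∀ a, Fin n → Γ(M, V a)) : Prop :=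
  ∀ a b j, mres M (inf_le_right : V a ⊓ V b ≤ V b) (e b j) =
    ∑ i, t a b i j • mres M inf_le_left (e a i)

/-- The module `M` is universal among the modules with sections `e` satisfying the transition
relations. -/
structure IsGlued (M : X.Modules) {I : Type*} (V : I → X.Opens)
    (t : ∀ a b, Matrix (Fin n) (Fin n) Γ(X, V a ⊓ V b)) (e : ∀ a, Fin n → Γ(M, V a)) : Prop where
  hasTransition : HasTransition M V t e
  existsUnique : ∀ (N : X.Modules) (d : ∀ a, Fin n → Γ(N, V a)), HasTransition N V t d →
    ∃! φ : M ⟶ N, ∀ a j, φ.app (V a) (e a j) = d a j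

/-- A bundle with its frames is presented by generators and transition relations. This universal
form is stable under the left adjoint `pullback`, which has no direct description on sections. -/
theorem isGlued_of_isFrame {M : X.Modules} {I : Type*} {V : I → X.Opens} (hV : ⨆ a, V a = ⊤)
    {t : ∀ a b, Matrix (Fin n) (Fin n) Γ(X, V a ⊓ V b)} {e : ∀ a, Fin n → Γ(M, V a)}
    (he : ∀ a, IsFrame M (V a) (e a)) (ht : HasTransition M V t e) : IsGlued M V t e where
  hasTransition := ht
  existsUnique N d hd := by
    let f (a : I) (U : X.Opens) (h : U ≤ V a) : Γ(M, U) →ₗ[Γ(X, U)] Γ(N, U) :=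
      (Fintype.linearCombination Γ(X, U) fun i => mres N h (d a i)) ∘ₗ (frameEquiv (he a) h).symm
    have hf₁ (a : I) (U : X.Opens) (h : U ≤ V a) (r : Fin n → Γ(X, U)) :
        f a U h (frameEquiv (he a) h r) = ∑ i, r i • mres N h (d a i) := by
      simp only [f, LinearMap.comp_apply, LinearEquiv.coe_coe, LinearEquiv.symm_apply_apply]
      rfl
    have hf₂ (a : I) (U : X.Opens) (h : U ≤ V a) (i : Fin n) :
        f a U h (mres M h (e a i)) = mres N h (d a i) := by
      rw [← frameEquiv_single (he a) h, hf₁, Finset.sum_eq_single i]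
      · simp
      · intro j _ hj
        simp [hj]
      · simp
    -- The maps defined by different frames agree because `e` and `d` satisfy the same transition
    -- relations.
    have hf₃ (a b : I) (U : X.Opens) (ha : U ≤ V a) (hb : U ≤ V b) : f a U ha = f b U hb := by
      apply LinearMap.ext
      intro s
      obtain ⟨r, rfl⟩ := (frameEquiv (he b) hb).surjective s
      rw [hf₁, frameEquiv_apply, map_sum]
      refine Finset.sum_congr rfl fun j _ => ?_
      rw [map_smul]
      congr 1
      have hU : U ≤ V a ⊓ V b := le_inf ha hb
      have e₁ := congrArg (mres M hU) (ht a b j)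
      have e₂ := congrArg (mres N hU) (hd a b j)
      rw [mres_mres, map_sum] at e₁ e₂
      rw [e₁, e₂, map_sum]
      refine Finset.sum_congr rfl fun i _ => ?_
      rw [mres_smul, mres_smul, map_smul, mres_mres, mres_mres, hf₂]
    obtain ⟨φ, hφ⟩ := exists_modules_hom_of_cover M N V hV f (by
      intro a b U U' hU hU' h s
      rw [hf₃ b a U' hU' (h.trans hU)]
      obtain ⟨r, rfl⟩ := (frameEquiv (he a) hU).surjective s
      rw [hf₁, mres_frameEquiv, hf₁, map_sum]
      refine Finset.sum_congr rfl fun j _ => ?_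
      rw [mres_smul, mres_mres])
    refine ⟨φ, fun a j => ?_, fun ψ hψ => ?_⟩
    · have := hf₂ a (V a) le_rfl j
      rwa [mres_refl, mres_refl, ← hφ] at this
    · ext U s
      refine mres_ext_of_cover N V (hV ▸ le_top) fun a => ?_
      rw [← app_mres, ← app_mres, hφ a _ inf_le_right]
      obtain ⟨r, hr⟩ := (frameEquiv (he a) inf_le_right).surjective (mres M inf_le_left s)
      rw [← hr, hf₁, frameEquiv_apply, map_sum]
      refine Finset.sum_congr rfl fun j _ => ?_
      rw [ψ.app_smul, app_mres, hψ]

theorem IsGlued.nonempty_iso {M M' : X.Modules} {I : Type*} {V : I → X.Opens}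
    {t : ∀ a b, Matrix (Fin n) (Fin n) Γ(X, V a ⊓ V b)} {e : ∀ a, Fin n → Γ(M, V a)}
    {e' : ∀ a, Fin n → Γ(M', V a)} (h : IsGlued M V t e) (h' : IsGlued M' V t e') :
    Nonempty (M ≅ M') := by
  obtain ⟨φ, hφ, -⟩ := h.existsUnique M' e' h'.hasTransition
  obtain ⟨ψ, hψ, -⟩ := h'.existsUnique M e h.hasTransition
  refine ⟨φ, ψ, (h.existsUnique M e h.hasTransition).unique (fun a j => ?_) fun a j => rfl,
    (h'.existsUnique M' e' h'.hasTransition).unique (fun a j => ?_) fun a j => rfl⟩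
  · exact (congrArg _ (hφ a j)).trans (hψ a j)
  · exact (congrArg _ (hψ a j)).trans (hφ a j)

/-! ### Pullbacks of sections -/

/-- The pullback of sections of a module. -/
def pullSec (f : X ⟶ Y) (M : Y.Modules) (U : Y.Opens) :
    Γ(M, U) →+ Γ((Scheme.Modules.pullback f).obj M, f ⁻¹ᵁ U) :=
  (((Scheme.Modules.pullbackPushforwardAdjunction f).unit.app M).app U).hom

theorem pullSec_smul (f : X ⟶ Y) (M : Y.Modules) (U : Y.Opens) (r : Γ(Y, U)) (s : Γ(M, U)) :
    pullSec f M U (r • s) = f.app U r • pullSec f M U s :=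
  ((Scheme.Modules.pullbackPushforwardAdjunction f).unit.app M).app_smul r s

theorem pullSec_mres (f : X ⟶ Y) (M : Y.Modules) {U V : Y.Opens} (h : V ≤ U) (s : Γ(M, U)) :
    pullSec f M V (mres M h s) = mres _ (f.preimage_mono h) (pullSec f M U s) :=
  app_mres ((Scheme.Modules.pullbackPushforwardAdjunction f).unit.app M) h s

theorem existsUnique_hom_pullback (f : X ⟶ Y) (M : Y.Modules) (N : X.Modules)
    (ψ : M ⟶ (Scheme.Modules.pushforward f).obj N) :
    ∃! φ : (Scheme.Modules.pullback f).obj M ⟶ N,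
      ∀ U (s : Γ(M, U)), φ.app (f ⁻¹ᵁ U) (pullSec f M U s) = ψ.app U s := by
  let adj := Scheme.Modules.pullbackPushforwardAdjunction f
  have key (φ : (Scheme.Modules.pullback f).obj M ⟶ N) (U) (s : Γ(M, U)) :
      φ.app (f ⁻¹ᵁ U) (pullSec f M U s) = (adj.homEquiv M N φ).app U s := by
    rw [Adjunction.homEquiv_unit]
    rfl
  refine ⟨(adj.homEquiv M N).symm ψ, fun U s => ?_, fun φ hφ => ?_⟩
  · rw [key, Equiv.apply_symm_apply]
  · rw [Equiv.eq_symm_apply]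
    ext U s
    exact (key φ U s).symm.trans (hφ U s)

theorem HasTransition.pullback (f : X ⟶ Y) {M : Y.Modules} {I : Type*} {V : I → Y.Opens}
    {t : ∀ a b, Matrix (Fin n) (Fin n) Γ(Y, V a ⊓ V b)} {e : ∀ a, Fin n → Γ(M, V a)}
    (h : HasTransition M V t e) :
    HasTransition ((Scheme.Modules.pullback f).obj M) (fun a => f ⁻¹ᵁ V a)
      (fun a b => (t a b).map (f.app (V a ⊓ V b))) fun a i => pullSec f M (V a) (e a i) := by
  intro a b j
  have := congrArg (pullSec f M _) (h a b j)
  rw [pullSec_mres, map_sum] at this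
  refine this.trans (Finset.sum_congr rfl fun i _ => ?_)
  rw [pullSec_smul, pullSec_mres]
  rfl

/-- By adjunction, maps from the pullback to `N` are maps from `M` to the pushforward of `N`, and a
transition relation in the pushforward is the pulled-back relation in `N`. -/
theorem IsGlued.pullback (f : X ⟶ Y) {M : Y.Modules} {I : Type*} {V : I → Y.Opens}
    {t : ∀ a b, Matrix (Fin n) (Fin n) Γ(Y, V a ⊓ V b)} {e : ∀ a, Fin n → Γ(M, V a)}
    (h : IsGlued M V t e) : IsGlued ((Scheme.Modules.pullback f).obj M) (fun a => f ⁻¹ᵁ V a)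
      (fun a b => (t a b).map (f.app (V a ⊓ V b))) fun a i => pullSec f M (V a) (e a i) where
  hasTransition := h.hasTransition.pullback f
  existsUnique N d hd := by
    obtain ⟨ψ, hψ, hu⟩ := h.existsUnique ((Scheme.Modules.pushforward f).obj N) d hd
    obtain ⟨φ, hφ, hφu⟩ := existsUnique_hom_pullback f M N ψ
    refine ⟨φ, fun a j => (hφ _ _).trans (hψ a j), fun φ' hφ' => hφu φ' ?_⟩
    let ψ' : M ⟶ (Scheme.Modules.pushforward f).obj N :=
      (Scheme.Modules.pullbackPushforwardAdjunction f).unit.app M ≫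
        (Scheme.Modules.pushforward f).map φ'
    have : ψ' = ψ := hu ψ' fun a j => hφ' a j
    intro U s
    rw [← this]
    rfl

end FrobBundle

namespace FrobBundle

/-! ### Glueing of free modules along a cocycle -/

theorem res_ext_of_cover (X : Scheme.{u}) {I : Type u} {U : X.Opens} (W : I → X.Opens)
    (hW : ∀ i, W i ≤ U) (hU : U ≤ ⨆ i, W i) {s t : Γ(X, U)}
    (h : ∀ i, res X (hW i) s = res X (hW i) t) : s = t :=
  TopCat.Sheaf.eq_of_locally_eq' X.sheaf W U (fun i => homOfLE (hW i)) hU s t h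

theorem exists_res_glue (X : Scheme.{u}) {I : Type u} {U : X.Opens} (W : I → X.Opens)
    (hW : ∀ i, W i ≤ U) (hU : U ≤ ⨆ i, W i) (s : ∀ i, Γ(X, W i))
    (h : ∀ i j, res X (inf_le_left : W i ⊓ W j ≤ _) (s i) = res X inf_le_right (s j)) :
    ∃ t : Γ(X, U), ∀ i, res X (hW i) t = s i :=
  (TopCat.Sheaf.existsUnique_gluing' X.sheaf W U (fun i => homOfLE (hW i)) hU s h).exists

section Glue

variable {X : Scheme.{u}} {n : ℕ} {I : Type u} (V : I → X.Opens)
  (t : ∀ a b, Matrix (Fin n) (Fin n) Γ(X, V a ⊓ V b))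

/-- The cocycle condition. -/
structure IsCocycle : Prop where
  one : ∀ a, t a a = 1
  mul : ∀ (a b c : I) (O : X.Opens) (ha : O ≤ V a) (hb : O ≤ V b) (hc : O ≤ V c),
    (t a c).map (res X (le_inf ha hc)) =
      (t a b).map (res X (le_inf ha hb)) * (t b c).map (res X (le_inf hb hc))

/-- The sections of the module with transition functions `t`. -/
def glueSections (O : X.Opens) : AddSubgroup (∀ a, Fin n → Γ(X, O ⊓ V a)) where
  carrier := {s | ∀ (a b : I) (i : Fin n),
    res X (inf_le_inf_left O inf_le_left : O ⊓ (V a ⊓ V b) ≤ O ⊓ V a) (s a i) =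
      ∑ j, res X inf_le_right (t a b i j) * res X (inf_le_inf_left O inf_le_right) (s b j)}
  add_mem' {s s'} hs hs' a b i := by
    simp only [Pi.add_apply, map_add, mul_add, Finset.sum_add_distrib]
    rw [hs, hs']
  zero_mem' a b i := by simp
  neg_mem' {s} hs a b i := by
    simp only [Pi.neg_apply, map_neg, mul_neg, Finset.sum_neg_distrib]
    rw [hs]

variable {V t}

theorem glueSections_spec {O : X.Opens} (s : glueSections V t O) {a b : I} {W : X.Opens}
    (hO : W ≤ O) (ha : W ≤ V a) (hb : W ≤ V b) (i : Fin n) :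
    res X (le_inf hO ha) (s.1 a i) =
      ∑ j, res X (le_inf ha hb) (t a b i j) * res X (le_inf hO hb) (s.1 b j) := by
  have := congrArg (res X (le_inf hO (le_inf ha hb))) (s.2 a b i)
  rw [res_res, map_sum] at this
  refine this.trans (Finset.sum_congr rfl fun j _ => ?_)
  rw [map_mul, res_res, res_res]

instance (O : X.Opens) : Module Γ(X, O) (glueSections V t O) where
  smul r s := ⟨fun a i => res X inf_le_left r * s.1 a i, fun a b i => by
    rw [map_mul, s.2 a b i, Finset.mul_sum]
    refine Finset.sum_congr rfl fun j _ => ?_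
    rw [map_mul, res_res, res_res]
    exact mul_left_comm _ _ _⟩
  one_smul s := Subtype.ext (funext fun a => funext fun i => by
    change res X _ 1 * s.1 a i = _
    rw [map_one, one_mul])
  mul_smul r r' s := Subtype.ext (funext fun a => funext fun i => by
    change res X _ (r * r') * s.1 a i = res X _ r * (res X _ r' * s.1 a i)
    rw [map_mul, mul_assoc])
  smul_zero r := Subtype.ext (funext fun a => funext fun i => mul_zero _)
  smul_add r s s' := Subtype.ext (funext fun a => funext fun i => mul_add _ _ _)
  add_smul r r' s := Subtype.ext (funext fun a => funext fun i => by
    change res X _ (r + r') * s.1 a i = res X _ r * s.1 a i + res X _ r' * s.1 a i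
    rw [map_add, add_mul])
  zero_smul s := Subtype.ext (funext fun a => funext fun i => by
    change res X _ 0 * s.1 a i = 0
    rw [map_zero, zero_mul])

variable (V t)

/-- The restriction of sections. -/
def glueRes {O O' : X.Opens} (h : O' ≤ O) : glueSections V t O →+ glueSections V t O' where
  toFun s := ⟨fun a i => res X (inf_le_inf_right _ h) (s.1 a i), fun a b i => by
    rw [res_res, glueSections_spec s (inf_le_left.trans h) (inf_le_right.trans inf_le_left)
      (inf_le_right.trans inf_le_right)]
    refine Finset.sum_congr rfl fun j _ => ?_
    rw [res_res]⟩
  map_zero' := Subtype.ext (funext fun a => funext fun i => map_zero _)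
  map_add' s s' := Subtype.ext (funext fun a => funext fun i => map_add _ _ _)

theorem glueRes_smul {O O' : X.Opens} (h : O' ≤ O) (r : Γ(X, O)) (s : glueSections V t O) :
    glueRes V t h (r • s) = res X h r • glueRes V t h s := by
  refine Subtype.ext (funext fun a => funext fun i => ?_)
  change res X _ (res X _ r * s.1 a i) = res X _ (res X _ r) * res X _ (s.1 a i)
  rw [map_mul, res_res, res_res]

/-- The presheaf of sections. -/
def gluePresheaf : TopCat.Presheaf Ab.{u} X where
  obj O := AddCommGrpCat.of (glueSections V t O.unop)
  map h := AddCommGrpCat.ofHom (glueRes V t h.unop.le)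
  map_id O := by
    ext s
    exact res_refl _ _
  map_comp h h' := by
    ext s
    exact (res_res _ _ _).symm

theorem isSheaf_gluePresheaf : (gluePresheaf V t).IsSheaf := by
  rw [TopCat.Presheaf.isSheaf_iff_isSheafUniqueGluing]
  intro J U s hs
  have hs' (j j' : J) (a : I) (i : Fin n) (W : X.Opens) (h : W ≤ U j) (h' : W ≤ U j')
      (ha : W ≤ V a) : res X (le_inf h ha) ((s j).1 a i) = res X (le_inf h' ha) ((s j').1 a i) := by
    have e := congrArg (fun z : glueSections V t (U j ⊓ U j') =>
      res X (le_inf (le_inf h h') ha) (z.1 a i)) (hs j j')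
    exact ((res_res _ _ _).symm.trans e).trans (res_res _ _ _)
  have hU (a : I) : iSup U ⊓ V a ≤ ⨆ j, U j ⊓ V a := by rw [iSup_inf_eq]
  have key (a : I) (i : Fin n) : ∃ r : Γ(X, iSup U ⊓ V a),
      ∀ j, res X (inf_le_inf_right _ (le_iSup U j)) r = (s j).1 a i := by
    refine exists_res_glue X (fun j => U j ⊓ V a) _ (hU a) _ fun j j' => ?_
    exact hs' j j' a i _ (inf_le_left.trans inf_le_left) (inf_le_right.trans inf_le_left)
      (inf_le_left.trans inf_le_right)
  choose r hr using key
  refine ⟨⟨r, fun a b i => ?_⟩, fun j => Subtype.ext (funext fun a => funext fun i => hr a i j),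
    fun z hz => Subtype.ext (funext fun a => funext fun i => ?_)⟩
  · refine res_ext_of_cover X (fun j => U j ⊓ (V a ⊓ V b))
      (fun j => inf_le_inf_right _ (le_iSup U j)) (by rw [iSup_inf_eq]) fun j => ?_
    have e := glueSections_spec (s j) (inf_le_left : U j ⊓ (V a ⊓ V b) ≤ U j)
      (inf_le_right.trans inf_le_left) (inf_le_right.trans inf_le_right) i
    rw [← hr, res_res] at e
    rw [res_res, e, map_sum]
    refine Finset.sum_congr rfl fun k _ => ?_
    rw [← hr, map_mul, res_res, res_res, res_res]
  · refine res_ext_of_cover X (fun j => U j ⊓ V a) (fun j => inf_le_inf_right _ (le_iSup U j))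
      (hU a) fun j => ?_
    rw [hr]
    exact congrArg (fun z : glueSections V t (U j) => z.1 a i) (hz j)

instance (O : X.Opensᵒᵖ) : Module (X.ringCatSheaf.obj.obj O) ((gluePresheaf V t).obj O) :=
  inferInstanceAs (Module Γ(X, O.unop) (glueSections V t O.unop))

/-- The module obtained by glueing. -/
def glueModule : X.Modules where
  val := PresheafOfModules.ofPresheaf (R := X.ringCatSheaf.obj) (gluePresheaf V t)
    fun _ _ h r s => glueRes_smul V t h.unop.le r s
  isSheaf := isSheaf_gluePresheaf V t

/-- The components of a section. -/
def glueComp (a : I) {O : X.Opens} (hO : O ≤ V a) :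
    Γ(glueModule V t, O) →ₗ[Γ(X, O)] (Fin n → Γ(X, O)) where
  toFun s i := res X (le_inf le_rfl hO) ((s : glueSections V t O).1 a i)
  map_add' s s' := funext fun i => map_add _ _ _
  map_smul' r s := funext fun i => by
    change res X _ (res X _ r * _) = r * _
    rw [map_mul, res_res, res_refl]

theorem glueComp_mres (a : I) {O O' : X.Opens} (hO : O ≤ V a) (h : O' ≤ O)
    (s : Γ(glueModule V t, O)) (i : Fin n) :
    glueComp V t a (h.trans hO) (mres _ h s) i = res X h (glueComp V t a hO s i) :=
  (res_res _ _ _).trans (res_res _ _ _).symm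

theorem glueComp_eq_sum (a b : I) {O : X.Opens} (ha : O ≤ V a) (hb : O ≤ V b)
    (s : Γ(glueModule V t, O)) (i : Fin n) :
    glueComp V t a ha s i = ∑ j, res X (le_inf ha hb) (t a b i j) * glueComp V t b hb s j :=
  glueSections_spec (s : glueSections V t O) le_rfl ha hb i

variable {V t}

/-- Inside `V b` a section is determined by its `b`-component through `s_a = t_ab s_b`. Conversely
any `r` extends to the family `t_ab r`, which is compatible by the cocycle condition. -/
theorem bijective_glueComp (h : IsCocycle V t) (b : I) {O : X.Opens} (hO : O ≤ V b) :
    Function.Bijective (glueComp V t b hO) := by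
  constructor
  · intro s s' hs
    refine Subtype.ext (funext fun a => funext fun i => ?_)
    have e := glueSections_spec (s : glueSections V t O) (inf_le_left : O ⊓ V a ≤ O) inf_le_right
      (inf_le_left.trans hO) i
    have e' := glueSections_spec (s' : glueSections V t O) (inf_le_left : O ⊓ V a ≤ O) inf_le_right
      (inf_le_left.trans hO) i
    rw [res_refl] at e e'
    rw [e, e']
    refine Finset.sum_congr rfl fun j _ => ?_
    congr 1
    have := congrArg (res X (inf_le_left : O ⊓ V a ≤ O)) (congrFun hs j)
    exact ((res_res _ _ _).symm.trans this).trans (res_res _ _ _)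
  · intro r
    have key (a : I) (i j : Fin n) (W : X.Opens) (a' : I) (ha : W ≤ V a) (ha' : W ≤ V a')
        (hb : W ≤ V b) : res X (le_inf ha hb) (t a b i j) =
        ∑ k, res X (le_inf ha ha') (t a a' i k) * res X (le_inf ha' hb) (t a' b k j) :=
      congr($(h.mul a a' b W ha ha' hb) i j)
    let s : glueSections V t O := ⟨fun a i => ∑ j, res X (le_inf inf_le_right
      (inf_le_left.trans hO)) (t a b i j) * res X inf_le_left (r j), fun a a' i => by
        rw [map_sum]
        simp only [map_sum, map_mul, res_res, Finset.mul_sum]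
        rw [Finset.sum_comm]
        refine Finset.sum_congr rfl fun j _ => ?_
        rw [key a i j _ a' (inf_le_right.trans inf_le_left) (inf_le_right.trans inf_le_right)
          (inf_le_left.trans hO), Finset.sum_mul]
        refine Finset.sum_congr rfl fun k _ => ?_
        rw [mul_assoc]⟩
    refine ⟨s, funext fun i => ?_⟩
    change res X (le_inf le_rfl hO) (s.1 b i) = _
    simp only [s, map_sum, map_mul, res_res, h.one]
    rw [Finset.sum_eq_single i]
    · rw [Matrix.one_apply_eq, map_one, one_mul, res_refl]
    · intro j _ hj
      rw [Matrix.one_apply_ne hj.symm, map_zero, zero_mul]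
    · simp

theorem exists_isFrame_of_isCocycle (h : IsCocycle V t) :
    ∃ (M : X.Modules) (e : ∀ a, Fin n → Γ(M, V a)), (∀ a, IsFrame M (V a) (e a)) ∧
      HasTransition M V t e := by
  choose e he using fun a j => (bijective_glueComp h a le_rfl).2 (Pi.single j 1)
  have he' (a : I) (j : Fin n) (O : X.Opens) (hO : O ≤ V a) :
      glueComp V t a hO (mres _ hO (e a j)) = Pi.single j 1 := by
    funext i
    rw [glueComp_mres V t a le_rfl hO, he, Pi.single_apply, Pi.single_apply, apply_ite (res X hO),
      map_one, map_zero]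
  refine ⟨glueModule V t, e, fun a O hO => ?_, fun a b j => ?_⟩
  · have e₁ : glueComp V t a hO ∘
        (fun r : Fin n → Γ(X, O) => ∑ i, r i • mres (glueModule V t) hO (e a i)) = id := by
      funext r
      change glueComp V t a hO (∑ i, r i • mres (glueModule V t) hO (e a i)) = r
      rw [map_sum]
      simp only [map_smul, he']
      exact (pi_eq_sum_univ' r).symm
    exact ((bijective_glueComp h a hO).of_comp_iff' _).1 (e₁ ▸ Function.bijective_id)
  · apply (bijective_glueComp h a inf_le_left).1
    rw [map_sum]
    simp only [map_smul, he']
    funext i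
    rw [glueComp_eq_sum V t a b inf_le_left inf_le_right, he']
    simp [Pi.single_apply, res_refl]

end Glue

end FrobBundle

namespace FrobBundle

/-! ### Pullbacks of sections along a composition -/

variable {T Y X : Scheme.{u}}

/-- The isomorphism `pullbackComp` is the mate of the identity on pushforwards, so it transports the
unit of the composite adjunction to the unit for `t ≫ q`. -/
theorem pullSec_comp (t : T ⟶ Y) (q : Y ⟶ X) (M : X.Modules) (U : X.Opens) (s : Γ(M, U)) :
    ((Scheme.Modules.pullbackComp t q).hom.app M).app (t ⁻¹ᵁ q ⁻¹ᵁ U)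
      (pullSec t ((Scheme.Modules.pullback q).obj M) (q ⁻¹ᵁ U) (pullSec q M U s)) =
    pullSec (t ≫ q) M U s := by
  have e := unit_conjugateEquiv ((Scheme.Modules.pullbackPushforwardAdjunction q).comp
    (Scheme.Modules.pullbackPushforwardAdjunction t))
    (Scheme.Modules.pullbackPushforwardAdjunction (t ≫ q))
    (Scheme.Modules.pullbackComp t q).inv M
  rw [Scheme.Modules.conjugateEquiv_pullbackComp_inv] at e
  have e₁ := congrArg (fun z => (z.app U) s) e
  change pullSec t ((Scheme.Modules.pullback q).obj M) (q ⁻¹ᵁ U) (pullSec q M U s) =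
    ((Scheme.Modules.pullbackComp t q).inv.app M).app (t ⁻¹ᵁ q ⁻¹ᵁ U)
      (pullSec (t ≫ q) M U s) at e₁
  rw [e₁]
  have e₂ := congrArg (fun z => z.app (t ⁻¹ᵁ q ⁻¹ᵁ U) (pullSec (t ≫ q) M U s))
    ((Scheme.Modules.pullbackComp t q).inv_hom_id_app M)
  exact e₂

/-- The pullback of sections of `q^* M` to sections of `h^* M`, where `h = q ∘ t`. -/
def pbHom (t : T ⟶ Y) (q : Y ⟶ X) (h : T ⟶ X) (w : t ≫ q = h) (M : X.Modules) :
    (Scheme.Modules.pullback q).obj M ⟶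
      (Scheme.Modules.pushforward t).obj ((Scheme.Modules.pullback h).obj M) :=
  (Scheme.Modules.pullbackPushforwardAdjunction t).unit.app _ ≫
    (Scheme.Modules.pushforward t).map
      ((Scheme.Modules.pullbackComp t q ≪≫ Scheme.Modules.pullbackCongr w).hom.app M)

/-- The pullback of sections of `q^* M` to sections of `h^* M`, where `h = q ∘ t`. -/
def pbSec (t : T ⟶ Y) (q : Y ⟶ X) (h : T ⟶ X) (w : t ≫ q = h) (M : X.Modules) (U : Y.Opens) :
    Γ((Scheme.Modules.pullback q).obj M, U) →+ Γ((Scheme.Modules.pullback h).obj M, t ⁻¹ᵁ U) :=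
  ((pbHom t q h w M).app U).hom

theorem preimage_preimage_le {t : T ⟶ Y} {q : Y ⟶ X} {h : T ⟶ X} (w : t ≫ q = h) (U : X.Opens) :
    t ⁻¹ᵁ q ⁻¹ᵁ U ≤ h ⁻¹ᵁ U := by
  subst w
  exact le_rfl

theorem pbSec_pullSec (t : T ⟶ Y) (q : Y ⟶ X) (h : T ⟶ X) (w : t ≫ q = h) (M : X.Modules)
    (U : X.Opens) (s : Γ(M, U)) :
    pbSec t q h w M (q ⁻¹ᵁ U) (pullSec q M U s) =
      mres ((Scheme.Modules.pullback h).obj M) (preimage_preimage_le w U) (pullSec h M U s) := by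
  subst w
  refine Eq.trans ?_ (mres_refl ((Scheme.Modules.pullback (t ≫ q)).obj M)
    (le_refl ((t ≫ q) ⁻¹ᵁ U)) (pullSec (t ≫ q) M U s)).symm
  refine Eq.trans ?_ (pullSec_comp t q M U s)
  have : (Scheme.Modules.pullbackComp t q ≪≫ Scheme.Modules.pullbackCongr rfl).hom.app M =
      (Scheme.Modules.pullbackComp t q).hom.app M := Category.comp_id _
  unfold pbSec pbHom
  rw [this]
  rfl

theorem pbSec_smul (t : T ⟶ Y) (q : Y ⟶ X) (h : T ⟶ X) (w : t ≫ q = h) (M : X.Modules)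
    (U : Y.Opens) (r : Γ(Y, U)) (s : Γ((Scheme.Modules.pullback q).obj M, U)) :
    pbSec t q h w M U (r • s) = t.app U r • pbSec t q h w M U s :=
  (pbHom t q h w M).app_smul r s

theorem pbSec_mres (t : T ⟶ Y) (q : Y ⟶ X) (h : T ⟶ X) (w : t ≫ q = h) (M : X.Modules)
    {U V : Y.Opens} (hV : V ≤ U) (s : Γ((Scheme.Modules.pullback q).obj M, U)) :
    pbSec t q h w M V (mres _ hV s) =
      mres ((Scheme.Modules.pullback h).obj M) (t.preimage_mono hV)
        (pbSec t q h w M U s) :=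
  app_mres (pbHom t q h w M) hV s

theorem pbSec_comp {T' : Scheme.{u}} (s : T' ⟶ T) (t : T ⟶ Y) (q : Y ⟶ X) (h : T ⟶ X)
    (h' : T' ⟶ X) (w : t ≫ q = h) (w' : s ≫ h = h') (w'' : (s ≫ t) ≫ q = h') (M : X.Modules)
    (U : Y.Opens) (z : Γ((Scheme.Modules.pullback q).obj M, U)) :
    pbSec s h h' w' M (t ⁻¹ᵁ U) (pbSec t q h w M U z) = pbSec (s ≫ t) q h' w'' M U z := by
  subst w w'
  let a : (Scheme.Modules.pullback q).obj M ⟶ (Scheme.Modules.pushforward (s ≫ t)).obj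
      ((Scheme.Modules.pullback (s ≫ t ≫ q)).obj M) :=
    pbHom t q _ rfl M ≫ (Scheme.Modules.pushforward t).map (pbHom s (t ≫ q) _ rfl M)
  let b := pbHom (s ≫ t) q (s ≫ t ≫ q) w'' M
  let c : M ⟶ (Scheme.Modules.pushforward q).obj ((Scheme.Modules.pushforward (s ≫ t)).obj
      ((Scheme.Modules.pullback (s ≫ t ≫ q)).obj M)) :=
    (Scheme.Modules.pullbackPushforwardAdjunction q).unit.app M ≫
      (Scheme.Modules.pushforward q).map b
  have : a = b := by
    -- Morphisms out of `q^* M` are determined by their values on pulled-back sections, where both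
    -- sides are the pullback along the total composite.
    refine (existsUnique_hom_pullback q M _ c).unique (fun U z => ?_) fun U z => rfl
    refine Eq.trans ?_ (pbSec_pullSec (s ≫ t) q _ w'' M U z).symm
    change pbSec s (t ≫ q) _ rfl M _ (pbSec t q _ rfl M (q ⁻¹ᵁ U) (pullSec q M U z)) = _
    rw [pbSec_pullSec, pbSec_mres]
    refine (congrArg _ (pbSec_pullSec s (t ≫ q) _ rfl M U z)).trans ?_
    exact mres_mres _ _ _ _
  exact congrArg (fun f => f.app U z) this

/-! ### Pullbacks of frames -/

variable {n : ℕ}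

theorem IsFrame.of_iso {M N : X.Modules} (φ : M ≅ N) {U : X.Opens} {e : Fin n → Γ(M, U)}
    (he : IsFrame M U e) : IsFrame N U fun i => φ.hom.app U (e i) := by
  intro V hV
  have hb : Function.Bijective (φ.hom.app V) :=
    ConcreteCategory.bijective_of_isIso (φ.hom.app V)
  convert hb.comp (he V hV) using 1
  funext r
  change _ = φ.hom.app V (∑ i, r i • mres M hV (e i))
  rw [map_sum]
  refine Finset.sum_congr rfl fun i _ => ?_
  rw [φ.hom.app_smul, app_mres]
  rfl

theorem exists_hasTransition {M : X.Modules} {I : Type*} {V : I → X.Opens}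
    {e : ∀ a, Fin n → Γ(M, V a)} (he : ∀ a, IsFrame M (V a) (e a)) :
    ∃ t, HasTransition M V t e := by
  refine ⟨fun a b i j => (frameEquiv (he a) inf_le_left).symm (mres M inf_le_right (e b j)) i,
    fun a b j => ?_⟩
  exact ((frameEquiv (he a) inf_le_left).apply_symm_apply _).symm

theorem frameEquiv_ext {M : X.Modules} {U : X.Opens} {e : Fin n → Γ(M, U)} (he : IsFrame M U e)
    {V : X.Opens} (hV : V ≤ U) {r r' : Fin n → Γ(X, V)}
    (h : ∑ i, r i • mres M hV (e i) = ∑ i, r' i • mres M hV (e i)) : r = r' :=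
  (frameEquiv he hV).injective h

theorem HasTransition.mres {M : X.Modules} {I : Type*} {V : I → X.Opens}
    {t : ∀ a b, Matrix (Fin n) (Fin n) Γ(X, V a ⊓ V b)} {e : ∀ a, Fin n → Γ(M, V a)}
    (ht : HasTransition M V t e) (a b : I) {O : X.Opens} (ha : O ≤ V a) (hb : O ≤ V b) (j : Fin n) :
    mres M hb (e b j) = ∑ i, res X (le_inf ha hb) (t a b i j) • FrobBundle.mres M ha (e a i) := by
  have := congrArg (FrobBundle.mres M (le_inf ha hb)) (ht a b j)
  rw [mres_mres, map_sum] at this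
  refine this.trans (Finset.sum_congr rfl fun i _ => ?_)
  rw [mres_smul, mres_mres]

/-- Coordinates in a frame are unique, so the relations for `(a, b)` and `(b, c)` compose to the one
for `(a, c)`. -/
theorem HasTransition.isCocycle {M : X.Modules} {I : Type u} {V : I → X.Opens}
    {t : ∀ a b, Matrix (Fin n) (Fin n) Γ(X, V a ⊓ V b)} {e : ∀ a, Fin n → Γ(M, V a)}
    (he : ∀ a, IsFrame M (V a) (e a)) (ht : HasTransition M V t e) : IsCocycle V t where
  one a := by
    ext i j
    have h := ht a a j
    have := frameEquiv_ext (he a) inf_le_left (r := fun i => t a a i j)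
      (r' := Pi.single j 1) (h.symm.trans (frameEquiv_single (he a) inf_le_left j).symm)
    rw [congrFun this i, Matrix.one_apply, Pi.single_apply]
  mul a b c O ha hb hc := by
    ext i j
    rw [Matrix.map_apply, Matrix.mul_apply]
    refine congrFun (frameEquiv_ext (he a) ha (r := fun i => res X (le_inf ha hc) (t a c i j))
      (r' := fun i => ∑ k, res X (le_inf ha hb) (t a b i k) * res X (le_inf hb hc) (t b c k j))
      ?_) i
    rw [← ht.mres a c ha hc, ht.mres b c hb hc]
    simp only [ht.mres a b ha hb, Finset.smul_sum, Finset.sum_smul]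
    rw [Finset.sum_comm]
    refine Finset.sum_congr rfl fun k _ => Finset.sum_congr rfl fun l _ => ?_
    rw [smul_smul, mul_comm]

theorem IsCocycle.pullback (f : Y ⟶ X) {I : Type u} {V : I → X.Opens}
    {t : ∀ a b, Matrix (Fin n) (Fin n) Γ(X, V a ⊓ V b)} (h : IsCocycle V t) :
    IsCocycle (fun a => f ⁻¹ᵁ V a) fun a b => (t a b).map (f.app (V a ⊓ V b)) where
  one a := by
    rw [h.one]
    exact Matrix.map_one _ (map_zero _) (map_one _)
  mul a b c O ha hb hc := by
    ext i j
    let W : X.Opens := V a ⊓ V b ⊓ V c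
    have hW : O ≤ f ⁻¹ᵁ W := le_inf (le_inf ha hb) hc
    let φ : Γ(X, W) →+* Γ(Y, O) := (res Y hW).comp (f.app W).hom
    have hφ {U : X.Opens} (hU : W ≤ U) (z : Γ(X, U)) :
        φ (res X hU z) = res Y (hW.trans (f.preimage_mono hU)) (f.app U z) :=
      (congrArg (res Y hW) (app_res f hU z)).trans (res_res _ _ _)
    have e := h.mul a b c W (inf_le_left.trans inf_le_left) (inf_le_left.trans inf_le_right)
      inf_le_right
    have e' : res X (le_inf (inf_le_left.trans inf_le_left) inf_le_right) (t a c i j) =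
      ∑ k, res X inf_le_left (t a b i k) *
        res X (le_inf (inf_le_left.trans inf_le_right) inf_le_right) (t b c k j) := congr($e i j)
    have e'' := congrArg φ e'
    rw [map_sum, hφ] at e''
    refine e''.trans (Finset.sum_congr rfl fun k _ => ?_)
    rw [map_mul, hφ, hφ]
    rfl

/-- The pulled-back cocycle glues to a module with genuine frames. That module and the pullback of
`M` share a universal property, and the resulting isomorphism matches the frames with the
pulled-back sections. -/
theorem isFrame_pullSec (f : Y ⟶ X) {M : X.Modules} {I : Type u} {V : I → X.Opens}
    (hV : ⨆ a, V a = ⊤) {e : ∀ a, Fin n → Γ(M, V a)} (he : ∀ a, IsFrame M (V a) (e a)) (a : I) :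
    IsFrame ((Scheme.Modules.pullback f).obj M) (f ⁻¹ᵁ V a)
      fun i => pullSec f M (V a) (e a i) := by
  obtain ⟨t, ht⟩ := exists_hasTransition he
  have hg := (isGlued_of_isFrame hV he ht).pullback f
  obtain ⟨N, e', he', ht'⟩ := exists_isFrame_of_isCocycle ((ht.isCocycle he).pullback f)
  have hg' := isGlued_of_isFrame (M := N) (V := fun a => f ⁻¹ᵁ V a)
    (by rw [← Scheme.Hom.preimage_iSup, hV]; rfl) he' ht'
  obtain ⟨φ, hφ, -⟩ := hg'.existsUnique _ _ hg.hasTransition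
  obtain ⟨ψ, hψ, -⟩ := hg.existsUnique _ _ hg'.hasTransition
  let iso : N ≅ (Scheme.Modules.pullback f).obj M :=
    ⟨φ, ψ, (hg'.existsUnique _ _ hg'.hasTransition).unique
      (fun a j => (congrArg _ (hφ a j)).trans (hψ a j)) fun a j => rfl,
      (hg.existsUnique _ _ hg.hasTransition).unique
      (fun a j => (congrArg _ (hψ a j)).trans (hφ a j)) fun a j => rfl⟩
  have := (he' a).of_iso iso
  convert this using 2 with i
  exact (hφ a i).symm

theorem isFrame_pbSec (t : T ⟶ Y) (q : Y ⟶ X) (h : T ⟶ X) (w : t ≫ q = h) {M : X.Modules}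
    {e : Fin n → Γ((Scheme.Modules.pullback q).obj M, ⊤)}
    (he : IsFrame ((Scheme.Modules.pullback q).obj M) ⊤ e) :
    IsFrame ((Scheme.Modules.pullback h).obj M) ⊤ fun i => pbSec t q h w M ⊤ (e i) :=
  (isFrame_pullSec t (I := PUnit) (V := fun _ => ⊤) (ciSup_const) (fun _ => he)
    PUnit.unit).of_iso
    ((Scheme.Modules.pullbackComp t q ≪≫ Scheme.Modules.pullbackCongr w).app M)

end FrobBundle

namespace FrobBundle

/-! ### The matrices of frames at the points of a principal bundle -/

section Frames

variable {X : Scheme.{u}} {n : ℕ} {M : X.Modules} {U : X.Opens} {e : Fin n → Γ(M, U)}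

theorem IsFrame.ext (he : IsFrame M U e) {r r' : Fin n → Γ(X, U)}
    (h : ∑ i, r i • e i = ∑ i, r' i • e i) : r = r' := by
  apply frameEquiv_ext he le_rfl
  simpa only [mres_refl] using h

theorem IsFrame.exists_eq (he : IsFrame M U e) (s : Γ(M, U)) :
    ∃ r : Fin n → Γ(X, U), s = ∑ i, r i • e i := by
  obtain ⟨r, hr⟩ := (frameEquiv he le_rfl).surjective s
  refine ⟨r, ?_⟩
  rw [← hr, frameEquiv_apply]
  simp only [mres_refl]

theorem IsFrame.existsUnique_matrix (he : IsFrame M U e) (s : Fin n → Γ(M, U)) :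
    ∃! m : Matrix (Fin n) (Fin n) Γ(X, U), ∀ j, s j = ∑ i, m i j • e i := by
  choose r hr using fun j => he.exists_eq (s j)
  refine ⟨fun i j => r j i, hr, fun m hm => ?_⟩
  ext i j
  exact congrFun (he.ext (r := fun i => m i j) (r' := r j) ((hm j).symm.trans (hr j))) i

theorem sum_smul_sum_smul {R N : Type*} [CommRing R] [AddCommGroup N] [Module R N]
    (m m' : Matrix (Fin n) (Fin n) R) (e : Fin n → N) (j : Fin n) :
    ∑ i, m i j • ∑ l, m' l i • e l = ∑ l, (m' * m) l j • e l := by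
  simp only [Finset.smul_sum, Matrix.mul_apply, Finset.sum_smul]
  rw [Finset.sum_comm]
  refine Finset.sum_congr rfl fun k _ => Finset.sum_congr rfl fun l _ => ?_
  rw [smul_smul, mul_comm]

theorem IsFrame.isUnit_matrix (he : IsFrame M U e) {e' : Fin n → Γ(M, U)} (he' : IsFrame M U e')
    {m : Matrix (Fin n) (Fin n) Γ(X, U)} (hm : ∀ j, e' j = ∑ i, m i j • e i) : IsUnit m := by
  obtain ⟨m', hm', -⟩ := he'.existsUnique_matrix e
  obtain ⟨m₀, h₀, hu⟩ := he.existsUnique_matrix e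
  have h₁ : m * m' = 1 := by
    refine (hu _ fun j => ?_).trans (hu _ fun j => ?_).symm
    · rw [← sum_smul_sum_smul, hm' j]
      simp only [← hm]
    · simp [Matrix.one_apply]
  exact (Matrix.isUnit_iff_isUnit_det m).2
    (IsUnit.of_mul_eq_one _ (by rw [← Matrix.det_mul, h₁, Matrix.det_one]))

end Frames

/-! ### Coordinates of local frames at points of the reduction -/

section BundlePoints

open CategoryTheory Limits

variable {S : Scheme.{u}} {G X : Over S} [GrpObj G] {n : ℕ} (Q : PrincipalBundle G X)
  (E : X.left.Modules) (e : Fin n → Γ((Scheme.Modules.pullback Q.proj.left).obj E, ⊤))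

/-- The matrix `m` expresses the sections `f` of `E` in the frame `e` at the point `x`. -/
def IsFrameMatrix {V : X.left.Opens} (f : Fin n → Γ(E, V)) {T : Over S} (x : T ⟶ Q.total)
    (h : T.left ⟶ X.left) (w : x.left ≫ Q.proj.left = h) (hx : ⊤ ≤ h ⁻¹ᵁ V)
    (m : Matrix (Fin n) (Fin n) Γ(T.left, ⊤)) : Prop :=
  ∀ j, mres ((Scheme.Modules.pullback h).obj E) hx (pullSec h E V (f j)) =
    ∑ i, m i j • pullbackSection x.left Q.proj.left h w E (e i)

variable {Q E e} {V : X.left.Opens} {f : Fin n → Γ(E, V)} {T : Over S}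

theorem existsUnique_isFrameMatrix (he : IsFrame ((Scheme.Modules.pullback Q.proj.left).obj E) ⊤ e)
    (f : Fin n → Γ(E, V)) (x : T ⟶ Q.total) (h : T.left ⟶ X.left)
    (w : x.left ≫ Q.proj.left = h) (hx : ⊤ ≤ h ⁻¹ᵁ V) :
    ∃! m, IsFrameMatrix Q E e f x h w hx m :=
  (isFrame_pbSec x.left Q.proj.left h w he).existsUnique_matrix _

theorem IsFrameMatrix.comp {x : T ⟶ Q.total} {h : T.left ⟶ X.left}
    {w : x.left ≫ Q.proj.left = h} {hx : ⊤ ≤ h ⁻¹ᵁ V} {m : Matrix (Fin n) (Fin n) Γ(T.left, ⊤)}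
    (hm : IsFrameMatrix Q E e f x h w hx m) {T' : Over S} (s : T' ⟶ T) (h' : T'.left ⟶ X.left)
    (w' : (s ≫ x).left ≫ Q.proj.left = h') (hx' : ⊤ ≤ h' ⁻¹ᵁ V) :
    IsFrameMatrix Q E e f (s ≫ x) h' w' hx' (m.map s.left.appTop) := by
  intro j
  have ws : s.left ≫ h = h' := by rw [← w, ← w', Over.comp_left, Category.assoc]
  have := congrArg (pbSec s.left h h' ws E ⊤) (hm j)
  rw [pbSec_mres, pbSec_pullSec, mres_mres, map_sum] at this
  refine this.trans (Finset.sum_congr rfl fun i _ => ?_)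
  refine (pbSec_smul s.left h h' ws E ⊤ (m i j) _).trans ?_
  exact congrArg (fun z : Γ((Scheme.Modules.pullback h').obj E, ⊤) => m.map s.left.appTop i j • z)
    (pbSec_comp s.left x.left Q.proj.left h h' w ws w' E ⊤ (e i))

theorem IsFrameMatrix.isUnit (he : IsFrame ((Scheme.Modules.pullback Q.proj.left).obj E) ⊤ e)
    {I : Type u} {V : I → X.left.Opens} (hV : ⨆ a, V a = ⊤) {f : ∀ a, Fin n → Γ(E, V a)}
    (hf : ∀ a, IsFrame E (V a) (f a)) {a : I} {x : T ⟶ Q.total} {h : T.left ⟶ X.left}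
    {w : x.left ≫ Q.proj.left = h} {hx : ⊤ ≤ h ⁻¹ᵁ V a}
    {m : Matrix (Fin n) (Fin n) Γ(T.left, ⊤)}
    (hm : IsFrameMatrix Q E e (f a) x h w hx m) : IsUnit m :=
  (isFrame_pbSec x.left Q.proj.left h w he).isUnit_matrix
    ((isFrame_pullSec h hV hf a).restrict hx) hm

/-- From `f = e(x) m` and `e(g x) = e(x) ρ(g)⁻¹` one gets `f = e(g x) ρ(g) m`. -/
theorem IsFrameMatrix.smul {ρ : yonedaGrpObj G ⟶ GLFunctor n S}
    (heq : ∀ {T : Over S} (g : T ⟶ G) (x : T ⟶ Q.total) (j : Fin n),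
      pullbackSection (Q.smul g x).left Q.proj.left
          (x ≫ Q.proj).left congr(($(Q.smul_proj g x)).left) E (e j) =
        ∑ i, (repMatrix ρ g)⁻¹.val i j •
          pullbackSection x.left Q.proj.left (x ≫ Q.proj).left rfl E (e i))
    {x : T ⟶ Q.total} {h : T.left ⟶ X.left}
    {w : x.left ≫ Q.proj.left = h} {hx : ⊤ ≤ h ⁻¹ᵁ V} {m : Matrix (Fin n) (Fin n) Γ(T.left, ⊤)}
    (hm : IsFrameMatrix Q E e f x h w hx m) (g : T ⟶ G)
    (w' : (Q.smul g x).left ≫ Q.proj.left = h) :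
    IsFrameMatrix Q E e f (Q.smul g x) h w' hx ((repMatrix ρ g).val * m) := by
  obtain rfl : h = (x ≫ Q.proj).left := w.symm
  intro j
  have key (i : Fin n) : pullbackSection (Q.smul g x).left Q.proj.left (x ≫ Q.proj).left w' E (e i) =
      ∑ l, (repMatrix ρ g)⁻¹.val l i •
        pullbackSection x.left Q.proj.left (x ≫ Q.proj).left w E (e l) :=
    heq g x i
  simp only [key]
  rw [sum_smul_sum_smul, ← mul_assoc]
  have : (repMatrix ρ g)⁻¹.val * (repMatrix ρ g).val = 1 := by
    rw [← Units.val_mul, inv_mul_cancel, Units.val_one]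
  rw [this, one_mul]
  exact hm j

theorem IsFrameMatrix.transition
    (he : IsFrame ((Scheme.Modules.pullback Q.proj.left).obj E) ⊤ e) {I : Type*}
    {V : I → X.left.Opens} {f : ∀ a, Fin n → Γ(E, V a)}
    {t : ∀ a b, Matrix (Fin n) (Fin n) Γ(X.left, V a ⊓ V b)} (ht : HasTransition E V t f) {a b : I}
    {x : T ⟶ Q.total} {h : T.left ⟶ X.left} {w : x.left ≫ Q.proj.left = h} {ha : ⊤ ≤ h ⁻¹ᵁ V a}
    {hb : ⊤ ≤ h ⁻¹ᵁ V b} {m m' : Matrix (Fin n) (Fin n) Γ(T.left, ⊤)}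
    (hm : IsFrameMatrix Q E e (f a) x h w ha m) (hm' : IsFrameMatrix Q E e (f b) x h w hb m') :
    m' = m * (t a b).map fun z =>
      res T.left (le_inf ha hb : ⊤ ≤ h ⁻¹ᵁ (V a ⊓ V b)) (h.app (V a ⊓ V b) z) := by
  refine (existsUnique_isFrameMatrix he (f b) x h w hb).unique hm' fun j => ?_
  refine ((ht.pullback h).mres a b ha hb j).trans ?_
  rw [← sum_smul_sum_smul]
  refine Finset.sum_congr rfl fun i _ => ?_
  exact congrArg (fun z => res T.left (le_inf ha hb : ⊤ ≤ h ⁻¹ᵁ (V a ⊓ V b))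
    (h.app (V a ⊓ V b) (t a b i j)) • z) (hm i)

end BundlePoints

end FrobBundle

namespace FrobBundle

/-! ### The scheme of matrices -/

/-- The scheme of `n × n` matrices over `S`. -/
def matrixScheme (n : ℕ) (S : Scheme.{u}) : Over S :=
  Over.mk (AffineSpace (ULift.{u} (Fin n × Fin n)) S ↘ S)

variable {n : ℕ} {S : Scheme.{u}}

/-- The matrix of a point of the scheme of matrices. -/
def pointMatrix {T : Over S} (m : T ⟶ matrixScheme n S) : Matrix (Fin n) (Fin n) Γ(T.left, ⊤) :=
  fun i j => m.left.appTop (AffineSpace.coord S ⟨(i, j)⟩)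

/-- The point of the scheme of matrices given by a matrix. -/
def matrixPoint {T : Over S} (m : Matrix (Fin n) (Fin n) Γ(T.left, ⊤)) : T ⟶ matrixScheme n S :=
  Over.homMk (AffineSpace.homOfVector T.hom fun ij => m ij.down.1 ij.down.2)
    (AffineSpace.homOfVector_over _ _)

theorem pointMatrix_matrixPoint {T : Over S} (m : Matrix (Fin n) (Fin n) Γ(T.left, ⊤)) :
    pointMatrix (matrixPoint m) = m := by
  ext i j
  exact AffineSpace.homOfVector_appTop_coord _ _ _

theorem pointMatrix_injective {T : Over S} {m m' : T ⟶ matrixScheme n S}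
    (h : pointMatrix m = pointMatrix m') : m = m' := by
  ext1
  refine AffineSpace.hom_ext ((Over.w m).trans (Over.w m').symm) ?_
  rintro ⟨i, j⟩
  exact congr($h i j)

theorem matrixPoint_pointMatrix {T : Over S} (m : T ⟶ matrixScheme n S) :
    matrixPoint (pointMatrix m) = m := pointMatrix_injective (pointMatrix_matrixPoint _)

theorem pointMatrix_comp {T T' : Over S} (s : T' ⟶ T) (m : T ⟶ matrixScheme n S) :
    pointMatrix (s ≫ m) = (pointMatrix m).map s.left.appTop := by
  ext i j
  change (s.left ≫ m.left).appTop _ = _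
  rw [Scheme.Hom.comp_appTop]
  rfl

theorem comp_matrixPoint {T T' : Over S} (s : T' ⟶ T)
    (m : Matrix (Fin n) (Fin n) Γ(T.left, ⊤)) :
    s ≫ matrixPoint m = matrixPoint (m.map s.left.appTop) := by
  apply pointMatrix_injective
  rw [pointMatrix_comp, pointMatrix_matrixPoint, pointMatrix_matrixPoint]

instance {R : CommRingCat.{u}} : IsAffineHom (matrixScheme n (Spec R)).hom :=
  inferInstanceAs (IsAffineHom (AffineSpace (ULift.{u} (Fin n × Fin n)) (Spec R) ↘ Spec R))

instance {R : CommRingCat.{u}} : Smooth (matrixScheme n (Spec R)).hom := by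
  change Smooth (AffineSpace (ULift.{u} (Fin n × Fin n)) (Spec R) ↘ Spec R)
  have h : Smooth (Spec.map (CommRingCat.ofHom
      (MvPolynomial.C : R →+* MvPolynomial (ULift.{u} (Fin n × Fin n)) R))) := by
    rw [HasRingHomProperty.Spec_iff (P := @Smooth)]
    change RingHom.Smooth (algebraMap R (MvPolynomial (ULift.{u} (Fin n × Fin n)) R))
    rw [RingHom.smooth_algebraMap]
    exact ⟨inferInstance, inferInstance⟩
  rw [← AffineSpace.SpecIso_inv_over] at h
  rw [← (AffineSpace.SpecIso (ULift.{u} (Fin n × Fin n)) R).hom_inv_id_assoc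
    (AffineSpace (ULift.{u} (Fin n × Fin n)) (Spec R) ↘ Spec R)]
  exact smooth_comp _ _

variable {G : Over S} [GrpObj G]

theorem repMatrix_comp (ρ : yonedaGrpObj G ⟶ GLFunctor n S) {T T' : Over S} (s : T' ⟶ T)
    (g : T ⟶ G) : (repMatrix ρ (s ≫ g)).val = (repMatrix ρ g).val.map s.left.appTop := by
  have := congr($(ρ.naturality s.op) g)
  exact congrArg Units.val this

theorem repMatrix_mul (ρ : yonedaGrpObj G ⟶ GLFunctor n S) {T : Over S} (g h : T ⟶ G) :
    repMatrix ρ (g * h) = repMatrix ρ g * repMatrix ρ h := map_mul (ρ.app (op T)).hom g h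

theorem repMatrix_one (ρ : yonedaGrpObj G ⟶ GLFunctor n S) {T : Over S} :
    repMatrix ρ (1 : T ⟶ G) = 1 := map_one (ρ.app (op T)).hom

/-- The action of a group scheme on the scheme of matrices given by a representation. -/
def repAct (ρ : yonedaGrpObj G ⟶ GLFunctor n S) : PtAct G (matrixScheme n S) where
  act g m := matrixPoint ((repMatrix ρ g).val * pointMatrix m)
  comp_act s g m := by
    rw [comp_matrixPoint, repMatrix_comp, pointMatrix_comp]
    congr 1
    exact Matrix.map_mul (f := s.left.appTop.hom)
  one_act m := by
    rw [repMatrix_one, Units.val_one, one_mul, matrixPoint_pointMatrix]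
  mul_act g h m := by
    rw [repMatrix_mul, Units.val_mul, pointMatrix_matrixPoint, mul_assoc]

theorem pointMatrix_repAct (ρ : yonedaGrpObj G ⟶ GLFunctor n S) {T : Over S} (g : T ⟶ G)
    (m : T ⟶ matrixScheme n S) :
    pointMatrix ((repAct ρ).act g m) = (repMatrix ρ g).val * pointMatrix m :=
  pointMatrix_matrixPoint _

/-- The composition of a representation with a homomorphism. -/
def compRep {H : Over S} [GrpObj H] (F : G ⟶ H) [IsMonHom F]
    (ρ : yonedaGrpObj H ⟶ GLFunctor n S) : yonedaGrpObj G ⟶ GLFunctor n S where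
  app T := GrpCat.ofHom (MonoidHom.mk'
    (fun g : T.unop ⟶ G => (ρ.app T (g ≫ F) : GL (Fin n) Γ(T.unop.left, ⊤)))
    fun g h => by
      rw [MonObj.mul_comp]
      exact map_mul (ρ.app T).hom _ _)
  naturality T T' s := by
    ext1
    ext1 g
    have := congr($(ρ.naturality s) (g ≫ F))
    refine Eq.trans ?_ this
    exact congrArg (ρ.app T').hom (Category.assoc s.unop g F)

/-! ### Liftings of sections of smooth morphisms -/

/-- The infinitesimal lifting property of smooth algebras, for a surjection with nilpotent kernel;
affineness of all three schemes makes the lift global. -/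
theorem exists_section_of_smooth {Z V V₀ : Scheme.{u}} [IsAffine Z] [IsAffine V] [IsAffine V₀]
    (b : Z ⟶ V) [Smooth b] (j : V₀ ⟶ V) (hj : Function.Surjective j.appTop) {m : ℕ}
    (hm : RingHom.ker j.appTop.hom ^ m = ⊥) (r : V₀ ⟶ Z) (h : r ≫ b = j) :
    ∃ l : V ⟶ Z, l ≫ b = 𝟙 V ∧ j ≫ l = r := by
  have hb : b.appTop.hom.Smooth := HasRingHomProperty.appTop (P := @Smooth) b inferInstance
  let := b.appTop.hom.toAlgebra
  let := j.appTop.hom.toAlgebra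
  have : Algebra.Smooth Γ(V, ⊤) Γ(Z, ⊤) := hb
  have hr : b.appTop ≫ r.appTop = j.appTop := by rw [← Scheme.Hom.comp_appTop, h]
  let r' : Γ(Z, ⊤) →ₐ[Γ(V, ⊤)] Γ(V₀, ⊤) :=
    { r.appTop.hom with commutes' := fun x => congr($hr x) }
  let j' : Γ(V, ⊤) →ₐ[Γ(V, ⊤)] Γ(V₀, ⊤) := Algebra.ofId _ _
  have hj' : IsNilpotent (RingHom.ker j') := ⟨m, hm⟩
  let l' : Γ(Z, ⊤) →ₐ[Γ(V, ⊤)] Γ(V, ⊤) :=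
    Algebra.FormallySmooth.liftOfSurjective r' j' hj hj'
  have hl : j'.comp l' = r' := Algebra.FormallySmooth.comp_liftOfSurjective r' j' hj hj'
  let φ : Γ(Z, ⊤) ⟶ Γ(V, ⊤) := CommRingCat.ofHom l'.toRingHom
  have e₁ : b.appTop ≫ φ = 𝟙 _ := by
    ext x
    exact l'.commutes x
  have e₂ : φ ≫ j.appTop = r.appTop := by
    ext x
    exact DFunLike.congr_fun hl x
  obtain ⟨l, hl'⟩ : ∃ l : V ⟶ Z, l ≫ Z.toSpecΓ = V.toSpecΓ ≫ Spec.map φ :=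
    ⟨V.toSpecΓ ≫ Spec.map φ ≫ inv Z.toSpecΓ, by simp⟩
  have hlt : l.appTop = φ := by
    have := congr(($hl').appTop)
    rw [Scheme.Hom.comp_appTop, Scheme.Hom.comp_appTop, Scheme.toSpecΓ_appTop,
      Scheme.toSpecΓ_appTop, Scheme.ΓSpecIso_naturality] at this
    exact (cancel_epi _).1 this
  refine ⟨l, ext_of_isAffine ?_, ext_of_isAffine ?_⟩
  · rw [Scheme.Hom.comp_appTop, hlt, e₁, Scheme.Hom.id_appTop]
  · rw [Scheme.Hom.comp_appTop, hlt, e₂]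

end FrobBundle

namespace FrobBundle

/-! ### Lifting the Frobenius twist of an equivariant matrix -/

open CartesianMonoidalCategory (fst snd lift)
open PrincipalBundle ContrPt

variable {R R₀ : CommRingCat.{u}} {e : R ⟶ R₀} {G X : Over (Spec R)} [GrpObj G] {n : ℕ}

/-- An equivariant morphism from the restriction of a principal bundle over an open subset to the
scheme of matrices. -/
structure EquivMatrix {S : Scheme.{u}} {G X : Over S} [GrpObj G] (ρ : yonedaGrpObj G ⟶ GLFunctor n S)
    (Q : PrincipalBundle G X) (V : X.left.Opens) where
  /-- the value at a point -/
  val : ∀ {T : Over S} (x : T ⟶ Q.total), ⊤ ≤ (x ≫ Q.proj).left ⁻¹ᵁ V →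
    Matrix (Fin n) (Fin n) Γ(T.left, ⊤)
  comp : ∀ {T T' : Over S} (s : T' ⟶ T) (x : T ⟶ Q.total) (hx : ⊤ ≤ (x ≫ Q.proj).left ⁻¹ᵁ V)
    (hx' : ⊤ ≤ ((s ≫ x) ≫ Q.proj).left ⁻¹ᵁ V), val (s ≫ x) hx' = (val x hx).map s.left.appTop
  smul : ∀ {T : Over S} (g : T ⟶ G) (x : T ⟶ Q.total) (hx : ⊤ ≤ (x ≫ Q.proj).left ⁻¹ᵁ V)
    (hx' : ⊤ ≤ (Q.smul g x ≫ Q.proj).left ⁻¹ᵁ V),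
    val (Q.smul g x) hx' = (repMatrix ρ g).val * val x hx

theorem map_pow_mul {A : Type u} [CommRing A] (p : ℕ) [Fact p.Prime] (h : (p : A) = 0)
    (a b : Matrix (Fin n) (Fin n) A) :
    (a * b).map (· ^ p) = a.map (· ^ p) * b.map (· ^ p) := Matrix.map_mul (f := powHom p A h)

theorem map_pow_map {A B : Type u} [CommRing A] [CommRing B] (f : A →+* B) (p : ℕ)
    (a : Matrix (Fin n) (Fin n) A) : (a.map (· ^ p)).map f = (a.map f).map (· ^ p) := by
  ext i j
  exact map_pow f _ p

theorem natCast_eq_zero_of_hom {p : ℕ} (hp : (p : R₀) = 0) {T : Scheme.{u}} (τ : T ⟶ Spec R₀) :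
    (p : Γ(T, ⊤)) = 0 :=
  natCast_eq_zero_of_ringHom p (τ.appTop.hom.comp (Scheme.ΓSpecIso R₀).inv.hom) hp

theorem top_le_preimage_of_eq {T X : Scheme.{u}} {V : X.Opens} {h : T ⟶ X} {s : T ⟶ V}
    (hs : h = s ≫ V.ι) : ⊤ ≤ h ⁻¹ᵁ V := by
  subst hs
  intro x _
  exact (s x).2

theorem exists_eq_comp_ι {T X : Scheme.{u}} {V : X.Opens} {h : T ⟶ X} (hx : ⊤ ≤ h ⁻¹ᵁ V) :
    ∃ s : T ⟶ V, h = s ≫ V.ι :=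
  ⟨IsOpenImmersion.lift V.ι h (by
    rintro _ ⟨x, rfl⟩
    simpa using hx (trivial : x ∈ (⊤ : T.Opens))), (IsOpenImmersion.lift_fac _ _ _).symm⟩

/-- Over `V`, equivariant matrices for `ρ'` are the sections of the contracted product of `Q` with
the scheme of matrices. This is fppf-locally an affine space, hence affine and smooth over `V`, so
the section over the closed fibre given by `p`-th powers extends. -/
theorem exists_lift_equivMatrix (p : ℕ) [Fact p.Prime] (hp : (p : R₀) = 0)
    (he : Function.Surjective e) {N : ℕ} (hN : RingHom.ker e.hom ^ N = ⊥)
    {X₀ : Scheme.{u}} {i : X₀ ⟶ X.left} {q₀ : X₀ ⟶ Spec R₀}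
    (hi : IsPullback i q₀ X.hom (Spec.map e)) (ρ ρ' : yonedaGrpObj G ⟶ GLFunctor n (Spec R))
    (hρ : ∀ {T : Over (Spec R)} (τ : T.left ⟶ Spec R₀), τ ≫ Spec.map e = T.hom → ∀ g : T ⟶ G,
      (repMatrix ρ' g).val = (repMatrix ρ g).val.map (· ^ p))
    (Q : PrincipalBundle G X) {V : X.left.Opens} (hV : IsAffineOpen V)
    {Y : Over (Spec R)} [IsAffine Y.left] (σ : Y ⟶ Q.total) (f : Y.left ⟶ V) [Flat f] [Surjective f]
    [LocallyOfFinitePresentation f] (hf : f ≫ V.ι = (σ ≫ Q.proj).left)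
    (m : EquivMatrix ρ Q V) :
    ∃ m' : EquivMatrix ρ' Q V, ∀ {T : Over (Spec R)} (τ : T.left ⟶ Spec R₀),
      τ ≫ Spec.map e = T.hom → ∀ (x : T ⟶ Q.total) (hx : ⊤ ≤ (x ≫ Q.proj).left ⁻¹ᵁ V),
        m'.val x hx = (m.val x hx).map (· ^ p) := by
  let V₀ : X₀.Opens := i ⁻¹ᵁ V
  let j : (V₀ : Scheme.{u}) ⟶ V := i ∣_ V
  have hj : j ≫ V.ι = V₀.ι ≫ i := morphismRestrict_ι i V
  have : IsAffine V := hV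
  have hpj : IsPullback j (V₀.ι ≫ q₀) (V.ι ≫ X.hom) (Spec.map e) :=
    (isPullback_morphismRestrict i V).paste_vert hi
  have hjs : Function.Surjective j.appTop :=
    app_surjective_of_isPullback hpj he (isAffineOpen_top V)
  have hjk : RingHom.ker j.appTop.hom ^ N = ⊥ := ker_app_pow_eq_bot hpj he hN (isAffineOpen_top V)
  have hjc : IsClosedImmersion j := isClosedImmersion_of_isPullback hpj he
  have hVa : IsAffine (V₀ : Scheme.{u}) := isAffine_of_isAffineHom j
  have hl {T : Over (Spec R)} {x : T ⟶ Q.total} {s : T.left ⟶ V₀}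
      (h : x.left ≫ Q.proj.left = s ≫ V₀.ι ≫ i) : (x ≫ Q.proj).left = (s ≫ j) ≫ V.ι := by
    rw [Category.assoc, hj]
    exact h
  have hτ {T : Over (Spec R)} {x : T ⟶ Q.total} {s : T.left ⟶ V₀}
      (h : x.left ≫ Q.proj.left = s ≫ V₀.ι ≫ i) : (s ≫ V₀.ι ≫ q₀) ≫ Spec.map e = T.hom := by
    rw [Category.assoc, Category.assoc, ← hi.w, ← Over.w x, ← Over.w Q.proj, ← Category.assoc x.left,
      h]
    simp only [Category.assoc]
  let val {T : Over (Spec R)} (x : T ⟶ Q.total) (s : T.left ⟶ V₀)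
      (h : x.left ≫ Q.proj.left = s ≫ V₀.ι ≫ i) : T ⟶ matrixScheme n (Spec R) :=
    matrixPoint ((m.val x (top_le_preimage_of_eq (hl h))).map (· ^ p))
  -- Points over `V₀` have structure morphism through `Spec R₀`; there `p` vanishes, the entrywise
  -- power is multiplicative, and `hρ` converts equivariance for `ρ` into equivariance for `ρ'`.
  let q : ContrPt Q (repAct ρ') V₀ := mk' (V₀.ι ≫ i) (fun x s h => val x s h)
    (by
      intro T' T₂ a x s h h'
      simp only [val]
      rw [comp_matrixPoint, m.comp a x (top_le_preimage_of_eq (hl h))]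
      exact congrArg matrixPoint (map_pow_map a.left.appTop.hom p _))
    (by
      intro T' g x s h h'
      simp only [val]
      rw [m.smul g x (top_le_preimage_of_eq (hl h)),
        map_pow_mul p (natCast_eq_zero_of_hom hp (s ≫ V₀.ι ≫ q₀)), ← hρ _ (hτ h)]
      refine congrArg matrixPoint ?_
      rw [pointMatrix_matrixPoint])
  -- The part of the contracted product lying over `V`; in the trivialisation over `Y` it is all of
  -- the matrix scheme times `Y`.
  let D : Subfunctor (contr Q (repAct ρ')) :=
    { obj := fun T => {c | ∀ x, ContrPt.base (P := Q) (α := repAct ρ') c x ∈ V}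
      map := fun a c hc x => hc (a.unop x) }
  have hD : Presieve.IsSheaf Scheme.fppfTopology D.toFunctor :=
    Subfunctor.isSheaf_of_isOpen (contr_isSheaf Q _) _ fun c =>
      ⟨ContrPt.base (P := Q) (α := repAct ρ') c ⁻¹ᵁ V, fun a => Iff.rfl⟩
  have hW : IsAffineOpen (⊤ : (matrixScheme n (Spec R) ⊗ Y).left.Opens) := by
    have : IsAffineHom (pullback.snd (matrixScheme n (Spec R)).hom Y.hom) :=
      MorphismProperty.IsStableUnderBaseChange.of_isPullback (P := @IsAffineHom)
        (IsPullback.of_hasPullback _ _) inferInstance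
    have : IsAffine (matrixScheme n (Spec R) ⊗ Y).left :=
      isAffine_of_isAffineHom (pullback.snd (matrixScheme n (Spec R)).hom Y.hom)
    exact isAffineOpen_top _
  obtain ⟨Z, hZ, z, b, h, hzD, hb, hpb, -, hu⟩ := exists_affine_representing_of_section
    (α := repAct ρ') D hD hV (fun c hc => hc) σ f hf hW (fun {T} c => by
      refine ⟨fun _ _ => trivial, fun _ x => ?_⟩
      have : ContrPt.base ((univPt (repAct ρ') σ).map c) =
          (c ≫ (snd _ Y).left ≫ f) ≫ V.ι := by
        rw [Category.assoc, Category.assoc, hf]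
        rfl
      change ContrPt.base ((univPt (repAct ρ') σ).map c) x ∈ V
      rw [this]
      exact ((c ≫ (snd _ Y).left ≫ f) x).2)
  have hbs : Smooth b := by
    have : Smooth (snd (matrixScheme n (Spec R)) Y).left :=
      inferInstanceAs (Smooth (pullback.snd (matrixScheme n (Spec R)).hom Y.hom))
    -- Smoothness is known after base change to `Y` and descends along the flat, surjective,
    -- quasi-compact `f`.
    exact MorphismProperty.of_isPullback_of_descendsAlong (P := @Smooth)
      (Q := @Surjective ⊓ @Flat ⊓ @QuasiCompact) hpb.flip
      ⟨⟨inferInstance, inferInstance⟩, inferInstance⟩ (smooth_comp _ _)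
  have hqD : q ∈ D.obj (op (V₀ : Scheme.{u})) := fun x => x.2
  obtain ⟨r, hr, -⟩ := hu q hqD
  have hrb : r ≫ b = j := by
    rw [← cancel_mono V.ι, Category.assoc, hb, hj]
    exact congrArg ContrPt.base hr
  obtain ⟨l, hl₁, hl₂⟩ := exists_section_of_smooth b j hjs hjk r hrb
  let c := z.map l
  have hc : c.base = V.ι := by
    change l ≫ z.base = V.ι
    rw [← hb, reassoc_of% hl₁]
  choose s hs using fun {T : Over (Spec R)} (x : T ⟶ Q.total)
    (hx : ⊤ ≤ (x ≫ Q.proj).left ⁻¹ᵁ V) => exists_eq_comp_ι hx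
  have hs' {T : Over (Spec R)} (x : T ⟶ Q.total) (hx : ⊤ ≤ (x ≫ Q.proj).left ⁻¹ᵁ V) :
      x.left ≫ Q.proj.left = s x hx ≫ c.base := by
    rw [hc]
    exact hs x hx
  refine ⟨⟨fun x hx => pointMatrix (c.ev x (s x hx) (hs' x hx)), ?_, ?_⟩, ?_⟩
  · intro T T' a x hx hx'
    have e₁ : s (a ≫ x) hx' = a.left ≫ s x hx := by
      rw [← cancel_mono V.ι]
      refine (hs (a ≫ x) hx').symm.trans ?_
      rw [Category.assoc a.left (s x hx) V.ι, ← hs x hx]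
      exact congr(($(Category.assoc a x Q.proj)).left)
    rw [← pointMatrix_comp, c.comp_ev _ _ _ _ (e₁ ▸ hs' (a ≫ x) hx')]
    exact congrArg pointMatrix (c.ev_congr rfl e₁ _)
  · intro T g x hx hx'
    have e₁ : s (Q.smul g x) hx' = s x hx := by
      rw [← cancel_mono V.ι]
      refine (hs (Q.smul g x) hx').symm.trans (Eq.trans ?_ (hs x hx))
      exact Q.smul_left_proj g x
    have e₂ := c.ev_smul g x (s x hx) (hs' x hx) (e₁ ▸ hs' (Q.smul g x) hx')
    rw [← pointMatrix_repAct, ← e₂]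
    exact congrArg pointMatrix (c.ev_congr rfl e₁ _)
  · intro T τ hτ' x hx
    let x₀ : T.left ⟶ X₀ := hi.lift (x ≫ Q.proj).left τ (by rw [hτ', Over.w])
    have hx₀ : x₀ ≫ i = (x ≫ Q.proj).left := hi.lift_fst _ _ _
    obtain ⟨s₀, hs₀⟩ : ∃ s₀ : T.left ⟶ V₀, x₀ = s₀ ≫ V₀.ι := by
      refine exists_eq_comp_ι fun t ht => ?_
      have := hx ht
      rw [← hx₀] at this
      exact this
    have h₀ : x.left ≫ Q.proj.left = s₀ ≫ V₀.ι ≫ i := by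
      rw [← Category.assoc, ← hs₀, hx₀]
      rfl
    have e₁ : s x hx = s₀ ≫ j := by
      rw [← cancel_mono V.ι]
      exact (hs x hx).symm.trans (hl h₀)
    have e₂ : c.map j = q := by
      rw [← hr, ← hl₂]
      exact (ContrPt.map_comp_apply j l z).symm
    have e₃ : c.ev x (s x hx) (hs' x hx) = (c.map j).ev x s₀ (by rw [e₂]; exact h₀) := by
      refine Eq.trans ?_ (ContrPt.ev_map j c x s₀ _).symm
      exact c.ev_congr rfl e₁ _
    have e₄ : q.ev x s₀ h₀ = val x s₀ h₀ := ev_of_eq (q := q) rfl x s₀ h₀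
    change pointMatrix (c.ev x (s x hx) (hs' x hx)) = _
    rw [e₃, ContrPt.ev_congr_left e₂, e₄]
    exact pointMatrix_matrixPoint _

end FrobBundle

namespace FrobBundle

/-! ### Evaluation of sections at points, and descent of matrices -/

section Eval

variable {T T' Y X : Scheme.{u}}

/-- The value of a section at a point. -/
def evalOn {O : Y.Opens} (c : T ⟶ Y) (hc : ⊤ ≤ c ⁻¹ᵁ O) : Γ(Y, O) →+* Γ(T, ⊤) :=
  (res T hc).comp (c.app O).hom

theorem evalOn_comp {O : Y.Opens} (s : T' ⟶ T) (c : T ⟶ Y) (hc : ⊤ ≤ c ⁻¹ᵁ O)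
    (hc' : ⊤ ≤ (s ≫ c) ⁻¹ᵁ O) (z : Γ(Y, O)) :
    s.appTop (evalOn c hc z) = evalOn (s ≫ c) hc' z := by
  change s.app ⊤ (res T hc (c.app O z)) = res T' hc' ((s ≫ c).app O z)
  rw [app_res, Scheme.Hom.comp_app]
  rfl

theorem evalOn_res {O O' : Y.Opens} (h : O' ≤ O) (c : T ⟶ Y) (hc : ⊤ ≤ c ⁻¹ᵁ O')
    (z : Γ(Y, O)) : evalOn c hc (res Y h z) = evalOn c (hc.trans (c.preimage_mono h)) z := by
  change res T hc (c.app O' (res Y h z)) = _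
  rw [app_res, res_res]
  rfl

theorem evalOn_app {O : X.Opens} (i : Y ⟶ X) (c : T ⟶ Y) (hc : ⊤ ≤ c ⁻¹ᵁ i ⁻¹ᵁ O) {c' : T ⟶ X}
    (h : c ≫ i = c') (hc' : ⊤ ≤ c' ⁻¹ᵁ O) (z : Γ(X, O)) :
    evalOn c hc (i.app O z) = evalOn c' hc' z := by
  subst h
  change res T hc (c.app _ (i.app O z)) = res T hc' ((c ≫ i).app O z)
  rw [Scheme.Hom.comp_app]
  rfl

theorem bijective_evalOn_ι (O : Y.Opens) :
    Function.Bijective (evalOn O.ι (top_le_preimage_of_eq (Category.id_comp _).symm)) := by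
  have : (evalOn O.ι (top_le_preimage_of_eq (Category.id_comp _).symm) : Γ(Y, O) → Γ(O, ⊤)) =
      O.topIso.inv := by
    funext z
    change (O.ι.app O ≫ (O : Scheme.{u}).presheaf.map _) z = _
    simp only [Scheme.Opens.topIso, Scheme.Opens.ι_app, Scheme.Opens.toScheme_presheaf_map]
    exact congr($((Y.presheaf.map_comp _ _).symm) z)
  rw [this]
  exact ConcreteCategory.bijective_of_isIso O.topIso.inv

end Eval

namespace PrincipalBundle

variable {S : Scheme.{u}} {G X : Over S} [GrpObj G] {n : ℕ} (Q : PrincipalBundle G X)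

/-- Functions on `O` are separated by the points that lift to `Q`, because fppf-locally every point
of `X` lifts. -/
theorem matrix_ext {Y : Scheme.{u}} (y : Y ⟶ X.left) (O : Y.Opens)
    {a b : Matrix (Fin n) (Fin n) Γ(Y, O)}
    (h : ∀ {T : Over S} (x : T ⟶ Q.total) (c : T.left ⟶ Y), c ≫ y = (x ≫ Q.proj).left →
      ∀ hc : ⊤ ≤ c ⁻¹ᵁ O, a.map (evalOn c hc) = b.map (evalOn c hc)) : a = b := by
  let hO : ⊤ ≤ O.ι ⁻¹ᵁ O := top_le_preimage_of_eq (Category.id_comp _).symm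
  let T : Over S := Over.mk (O.ι ≫ y ≫ X.hom)
  let t : T ⟶ X := Over.homMk (O.ι ≫ y) (Category.assoc _ _ _)
  have key : (matrixPoint (a.map (evalOn O.ι hO)) : T ⟶ matrixScheme n S) =
      matrixPoint (b.map (evalOn O.ι hO)) := by
    refine Q.hom_ext_of_locally t fun {T₂} s x hx => ?_
    rw [comp_matrixPoint, comp_matrixPoint]
    have hc : ⊤ ≤ (s.left ≫ O.ι) ⁻¹ᵁ O := top_le_preimage_of_eq rfl
    have e := h x (s.left ≫ O.ι) ((Category.assoc _ _ _).trans congr(($hx).left).symm) hc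
    have e' (m : Matrix (Fin n) (Fin n) Γ(Y, O)) :
        (m.map (evalOn O.ι hO)).map s.left.appTop = m.map (evalOn (s.left ≫ O.ι) hc) := by
      ext k l
      exact evalOn_comp s.left O.ι hO hc _
    exact congrArg matrixPoint ((e' a).trans (e.trans (e' b).symm))
  have e := congrArg pointMatrix key
  rw [pointMatrix_matrixPoint, pointMatrix_matrixPoint] at e
  ext k l
  exact (bijective_evalOn_ι O).1 congr($e k l)

/-- Matrices of functions are points of a scheme, so invariant families over `Q` descend to the
base. -/
theorem exists_matrix_descent (O : X.left.Opens)
    (ψ : ∀ {T : Over S} (x : T ⟶ Q.total), ⊤ ≤ (x ≫ Q.proj).left ⁻¹ᵁ O →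
      Matrix (Fin n) (Fin n) Γ(T.left, ⊤))
    (hψ : ∀ {T T' : Over S} (s : T' ⟶ T) (x : T ⟶ Q.total) (hx : ⊤ ≤ (x ≫ Q.proj).left ⁻¹ᵁ O)
      (hx' : ⊤ ≤ ((s ≫ x) ≫ Q.proj).left ⁻¹ᵁ O), ψ (s ≫ x) hx' = (ψ x hx).map s.left.appTop)
    (hψ' : ∀ {T : Over S} (g : T ⟶ G) (x : T ⟶ Q.total) (hx : ⊤ ≤ (x ≫ Q.proj).left ⁻¹ᵁ O)
      (hx' : ⊤ ≤ (Q.smul g x ≫ Q.proj).left ⁻¹ᵁ O), ψ (Q.smul g x) hx' = ψ x hx) :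
    ∃ t : Matrix (Fin n) (Fin n) Γ(X.left, O), ∀ {T : Over S} (x : T ⟶ Q.total)
      (hx : ⊤ ≤ (x ≫ Q.proj).left ⁻¹ᵁ O), ψ x hx = t.map (evalOn (x ≫ Q.proj).left hx) := by
  let hO : ⊤ ≤ O.ι ⁻¹ᵁ O := top_le_preimage_of_eq (Category.id_comp _).symm
  let T₀ : Over S := Over.mk (O.ι ≫ X.hom)
  let t₀ : T₀ ⟶ X := Over.homMk O.ι
  have hl {T : Over S} {s : T ⟶ T₀} {x : T ⟶ Q.total} (h : x ≫ Q.proj = s ≫ t₀) :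
      (x ≫ Q.proj).left = s.left ≫ O.ι := congr(($h).left)
  obtain ⟨r, hr, -⟩ := Q.exists_descent (Z := matrixScheme n S) t₀
    (fun s x h => matrixPoint (ψ x (top_le_preimage_of_eq (hl h))))
    (by
      intro T₂ T₃ a s x h h'
      rw [comp_matrixPoint, hψ a x (top_le_preimage_of_eq (hl h))])
    (by
      intro T₂ s g x h h'
      rw [hψ' g x (top_le_preimage_of_eq (hl h))])
  choose w hw using fun k l => (bijective_evalOn_ι O).2 (pointMatrix r k l)
  refine ⟨w, fun {T} x hx => ?_⟩
  obtain ⟨s, hs⟩ := exists_eq_comp_ι hx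
  let s' : T ⟶ T₀ := Over.homMk s (by
    change s ≫ O.ι ≫ X.hom = _
    rw [← reassoc_of% hs]
    exact Over.w (x ≫ Q.proj))
  have h : x ≫ Q.proj = s' ≫ t₀ := by
    ext1
    exact hs
  have e := congrArg pointMatrix (hr s' x h)
  rw [pointMatrix_comp, pointMatrix_matrixPoint] at e
  rw [← e]
  ext k l
  change s.appTop (pointMatrix r k l) = evalOn _ hx (w k l)
  rw [← hw]
  refine (evalOn_comp s O.ι hO (hs ▸ hx) _).trans ?_
  congr 2
  exact hs.symm

end PrincipalBundle

/-! ### The matrices of the frames as equivariant matrices -/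

section

variable {S : Scheme.{u}} {G X : Over S} [GrpObj G] {n : ℕ} {Q : PrincipalBundle G X}
  {E : X.left.Modules} {e : Fin n → Γ((Scheme.Modules.pullback Q.proj.left).obj E, ⊤)}
  {V : X.left.Opens} {f : Fin n → Γ(E, V)} {T : Over S}

theorem IsFrameMatrix.congr {x : T ⟶ Q.total} {h h' : T.left ⟶ X.left}
    {w : x.left ≫ Q.proj.left = h} {hx : ⊤ ≤ h ⁻¹ᵁ V} {m : Matrix (Fin n) (Fin n) Γ(T.left, ⊤)}
    (hm : IsFrameMatrix Q E e f x h w hx m) (hh : h = h') :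
    IsFrameMatrix Q E e f x h' (w.trans hh) (hh ▸ hx) m := by
  subst hh
  exact hm

theorem exists_equivMatrix {ρ : yonedaGrpObj G ⟶ GLFunctor n S}
    (he : IsFrame ((Scheme.Modules.pullback Q.proj.left).obj E) ⊤ e)
    (heq : ∀ {T : Over S} (g : T ⟶ G) (x : T ⟶ Q.total) (j : Fin n),
      pullbackSection (Q.smul g x).left Q.proj.left
          (x ≫ Q.proj).left congr(($(Q.smul_proj g x)).left) E (e j) =
        ∑ i, (repMatrix ρ g)⁻¹.val i j •
          pullbackSection x.left Q.proj.left (x ≫ Q.proj).left rfl E (e i))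
    (f : Fin n → Γ(E, V)) :
    ∃ m : EquivMatrix ρ Q V, ∀ {T : Over S} (x : T ⟶ Q.total)
      (hx : ⊤ ≤ (x ≫ Q.proj).left ⁻¹ᵁ V),
      IsFrameMatrix Q E e f x (x ≫ Q.proj).left rfl hx (m.val x hx) := by
  choose m hm using fun {T : Over S} (x : T ⟶ Q.total) (hx : ⊤ ≤ (x ≫ Q.proj).left ⁻¹ᵁ V) =>
    (existsUnique_isFrameMatrix he f x (x ≫ Q.proj).left rfl hx).exists
  refine ⟨⟨m, fun s x hx hx' => ?_, fun g x hx hx' => ?_⟩, hm⟩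
  · exact (existsUnique_isFrameMatrix he f (s ≫ x) _ rfl hx').unique (hm (s ≫ x) hx')
      ((hm x hx).comp s _ rfl hx')
  · exact (existsUnique_isFrameMatrix he f (Q.smul g x) _ rfl hx').unique (hm (Q.smul g x) hx')
      (((hm x hx).smul heq g congr(($(Q.smul_proj g x)).left)).congr
        congr(($(Q.smul_proj g x)).left).symm)

end

end FrobBundle

namespace FrobBundle

/-! ### Lifting the Frobenius pullback of a vector bundle -/

variable {R R₀ : CommRingCat.{u}} {e : R ⟶ R₀} {G X : Over (Spec R)} [GrpObj G] {n : ℕ}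
  {Q : PrincipalBundle G X}

theorem exists_affine_frames {E : X.left.Modules} (hE : IsVectorBundle n E)
    (Q : PrincipalBundle G X) :
    ∃ (V : X.left → X.left.Opens) (f : ∀ a, Fin n → Γ(E, V a)), (⨆ a, V a = ⊤) ∧
      (∀ a, IsFrame E (V a) (f a)) ∧ (∀ a, IsAffineOpen (V a)) ∧
      ∀ a, ∃ (Y : Over (Spec R)) (_ : IsAffine Y.left) (σ : Y ⟶ Q.total) (g : Y.left ⟶ V a),
        Flat g ∧ Surjective g ∧ LocallyOfFinitePresentation g ∧
        g ≫ (V a).ι = (σ ≫ Q.proj).left := by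
  choose U hU d hd using hE
  choose V Y g s hV hY hg₁ hg₂ hg₃ hx hle hs using fun a =>
    exists_affine_section Q.proj.left Q.locally_trivial (hU a)
  refine ⟨V, fun a i => mres E (hle a) (d a i), ?_, fun a => (hd a).restrict (hle a), hV,
    fun a => ⟨Over.mk (s a ≫ Q.total.hom), hY a, Over.homMk (s a), g a, hg₁ a, hg₂ a, hg₃ a,
      (hs a).symm⟩⟩
  exact eq_top_iff.2 fun x _ => TopologicalSpace.Opens.mem_iSup.2 ⟨x, hx x⟩

/-- The determinant is a unit on the closed fibre of `T`, which has the same points as `T`. -/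
theorem EquivMatrix.isUnit (he : Function.Surjective e) {N : ℕ} (hN : RingHom.ker e.hom ^ N = ⊥)
    {ρ : yonedaGrpObj G ⟶ GLFunctor n (Spec R)} {V : X.left.Opens} (m : EquivMatrix ρ Q V)
    (hm : ∀ {T : Over (Spec R)} (τ : T.left ⟶ Spec R₀), τ ≫ Spec.map e = T.hom →
      ∀ (x : T ⟶ Q.total) (hx : ⊤ ≤ (x ≫ Q.proj).left ⁻¹ᵁ V), IsUnit (m.val x hx))
    {T : Over (Spec R)} (x : T ⟶ Q.total) (hx : ⊤ ≤ (x ≫ Q.proj).left ⁻¹ᵁ V) :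
    IsUnit (m.val x hx) := by
  let T₀ : Over (Spec R) := Over.mk (pullback.fst T.hom (Spec.map e) ≫ T.hom)
  let s : T₀ ⟶ T := Over.homMk (pullback.fst T.hom (Spec.map e))
  have hs : Surjective s.left :=
    surjective_of_isPullback (IsPullback.of_hasPullback T.hom (Spec.map e)) he hN
  have hx' : ⊤ ≤ ((s ≫ x) ≫ Q.proj).left ⁻¹ᵁ V := fun t _ =>
    hx (trivial : s.left t ∈ (⊤ : T.left.Opens))
  have h := hm (T := T₀) (pullback.snd T.hom (Spec.map e)) pullback.condition.symm (s ≫ x) hx'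
  rw [m.comp s x hx, Matrix.isUnit_iff_isUnit_det] at h
  rw [Matrix.isUnit_iff_isUnit_det]
  refine isUnit_of_isUnit_app (i := s.left) (U := ⊤) ?_
  have e₁ : s.left.appTop.hom (m.val x hx).det = ((m.val x hx).map s.left.appTop).det :=
    RingHom.map_det _ _
  exact e₁ ▸ h

theorem top_le_preimage_inf {T Y : Scheme.{u}} {c : T ⟶ Y} {U V : Y.Opens} (hU : ⊤ ≤ c ⁻¹ᵁ U)
    (hV : ⊤ ≤ c ⁻¹ᵁ V) : ⊤ ≤ c ⁻¹ᵁ (U ⊓ V) := le_inf hU hV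

theorem top_le_preimage_left {T Y : Scheme.{u}} {c : T ⟶ Y} {U V : Y.Opens}
    (h : ⊤ ≤ c ⁻¹ᵁ (U ⊓ V)) : ⊤ ≤ c ⁻¹ᵁ U := h.trans (c.preimage_mono inf_le_left)

theorem top_le_preimage_right {T Y : Scheme.{u}} {c : T ⟶ Y} {U V : Y.Opens}
    (h : ⊤ ≤ c ⁻¹ᵁ (U ⊓ V)) : ⊤ ≤ c ⁻¹ᵁ V := h.trans (c.preimage_mono inf_le_right)

/-- The quotient `m_a⁻¹ m_b` is invariant, as the factors `ρ(g)` cancel, so it descends to the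
overlap. -/
theorem exists_transition {S : Scheme.{u}} {G X : Over S} [GrpObj G] {Q : PrincipalBundle G X}
    {ρ : yonedaGrpObj G ⟶ GLFunctor n S} {I : Type*}
    {V : I → X.left.Opens} (m : ∀ a, EquivMatrix ρ Q (V a))
    (hm : ∀ a {T : Over S} (x : T ⟶ Q.total) (hx : ⊤ ≤ (x ≫ Q.proj).left ⁻¹ᵁ V a),
      IsUnit ((m a).val x hx)) (a b : I) :
    ∃ t : Matrix (Fin n) (Fin n) Γ(X.left, V a ⊓ V b), ∀ {T : Over S} (x : T ⟶ Q.total)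
      (ha : ⊤ ≤ (x ≫ Q.proj).left ⁻¹ᵁ V a) (hb : ⊤ ≤ (x ≫ Q.proj).left ⁻¹ᵁ V b),
      (m b).val x hb = (m a).val x ha * t.map (evalOn (x ≫ Q.proj).left (top_le_preimage_inf ha hb)) := by
  obtain ⟨t, ht⟩ := Q.exists_matrix_descent (V a ⊓ V b)
    (fun x hx => ((m a).val x (top_le_preimage_left hx))⁻¹ * (m b).val x (top_le_preimage_right hx))
    (by
      intro T T' s x hx hx'
      rw [(m a).comp s x (top_le_preimage_left hx), (m b).comp s x (top_le_preimage_right hx)]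
      have h₁ := (Matrix.isUnit_iff_isUnit_det _).1 (hm a x (top_le_preimage_left hx))
      have h₂ := (Matrix.isUnit_iff_isUnit_det _).1 (hm a (s ≫ x) (top_le_preimage_left hx'))
      rw [(m a).comp s x (top_le_preimage_left hx)] at h₂
      have h₃ (c d : Matrix (Fin n) (Fin n) Γ(T.left, ⊤)) : (c * d).map s.left.appTop =
        c.map s.left.appTop * d.map s.left.appTop := Matrix.map_mul (f := s.left.appTop.hom)
      have h₄ : (m b).val x (top_le_preimage_right hx) = (m a).val x (top_le_preimage_left hx) *
          (((m a).val x (top_le_preimage_left hx))⁻¹ * (m b).val x (top_le_preimage_right hx)) :=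
        (Matrix.mul_nonsing_inv_cancel_left _ _ h₁).symm
      have h₅ := congrArg (fun c : Matrix (Fin n) (Fin n) Γ(T.left, ⊤) =>
        c.map s.left.appTop) h₄
      refine (congrArg _ (h₅.trans (h₃ _ _))).trans ?_
      exact Matrix.nonsing_inv_mul_cancel_left _ _ h₂)
    (by
      intro T g x hx hx'
      rw [(m a).smul g x (top_le_preimage_left hx), (m b).smul g x (top_le_preimage_right hx),
        Matrix.mul_inv_rev, mul_assoc, ← mul_assoc _⁻¹ (repMatrix ρ g).val]
      rw [Matrix.nonsing_inv_mul _ ((Matrix.isUnit_iff_isUnit_det _).1 (repMatrix ρ g).isUnit),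
        one_mul])
  refine ⟨t, fun x ha hb => ?_⟩
  have e := ht x (top_le_preimage_inf ha hb)
  rw [← e, Matrix.mul_nonsing_inv_cancel_left _ _
    ((Matrix.isUnit_iff_isUnit_det _).1 (hm a x ha))]

theorem IsGlued.congr {X : Scheme.{u}} {M : X.Modules} {I : Type*} {V : I → X.Opens}
    {t t' : ∀ a b, Matrix (Fin n) (Fin n) Γ(X, V a ⊓ V b)} {e : ∀ a, Fin n → Γ(M, V a)}
    (h : IsGlued M V t e) (ht : ∀ a b, t a b = t' a b) : IsGlued M V t' e := by
  obtain rfl : t = t' := funext fun a => funext (ht a)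
  exact h

/-- Lifting the transition matrices separately would not preserve the cocycle condition. One lifts
instead the matrices `m_a` on `Q`, which satisfy no condition between different `a`, and takes
quotients afterwards. -/
theorem exists_frobenius_lift_of_hasReduction (p : ℕ) [Fact p.Prime] (hp : (p : R₀) = 0)
    (he : Function.Surjective e) {N : ℕ} (hN : RingHom.ker e.hom ^ N = ⊥)
    {X₀ : Scheme.{u}} {i : X₀ ⟶ X.left} {q₀ : X₀ ⟶ Spec R₀}
    (hi : IsPullback i q₀ X.hom (Spec.map e)) (hX₀ : (p : Γ(X₀, ⊤)) = 0)
    (ρ ρ' : yonedaGrpObj G ⟶ GLFunctor n (Spec R))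
    (hρ : ∀ {T : Over (Spec R)} (τ : T.left ⟶ Spec R₀), τ ≫ Spec.map e = T.hom → ∀ g : T ⟶ G,
      (repMatrix ρ' g).val = (repMatrix ρ g).val.map (· ^ p))
    {E : X.left.Modules} (hE : IsVectorBundle n E) (hred : HasReduction ρ E) :
    ∃ E' : X.left.Modules, IsVectorBundle n E' ∧
      Nonempty ((Scheme.Modules.pullback i).obj E' ≅
        (Scheme.Modules.pullback (absFrobenius p X₀ hX₀)).obj
          ((Scheme.Modules.pullback i).obj E)) := by
  obtain ⟨Q, d, hd, heq⟩ := hred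
  obtain ⟨V, f, hV, hf, hVa, hsec⟩ := exists_affine_frames hE Q
  obtain ⟨t, ht⟩ := exists_hasTransition hf
  choose m hm using fun a => exists_equivMatrix (ρ := ρ) hd heq (f a)
  have hmt (a b) {T : Over (Spec R)} (x : T ⟶ Q.total) (ha : ⊤ ≤ (x ≫ Q.proj).left ⁻¹ᵁ V a)
      (hb : ⊤ ≤ (x ≫ Q.proj).left ⁻¹ᵁ V b) : (m b).val x hb =
        (m a).val x ha * (t a b).map (evalOn (x ≫ Q.proj).left (top_le_preimage_inf ha hb)) :=
    (hm a x ha).transition hd ht (hm b x hb)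
  have hmu (a) {T : Over (Spec R)} (x : T ⟶ Q.total) (hx : ⊤ ≤ (x ≫ Q.proj).left ⁻¹ᵁ V a) :
      IsUnit ((m a).val x hx) := (hm a x hx).isUnit hd hV hf
  have hM (a) : ∃ m' : EquivMatrix ρ' Q (V a), ∀ {T : Over (Spec R)} (τ : T.left ⟶ Spec R₀),
      τ ≫ Spec.map e = T.hom → ∀ (x : T ⟶ Q.total) (hx : ⊤ ≤ (x ≫ Q.proj).left ⁻¹ᵁ V a),
        m'.val x hx = ((m a).val x hx).map (· ^ p) := by
    obtain ⟨Y, hY, σ, g, hg₁, hg₂, hg₃, hg⟩ := hsec a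
    exact exists_lift_equivMatrix p hp he hN hi ρ ρ' hρ Q (hVa a) σ g hg (m a)
  choose M hM using hM
  have hMu (a) {T : Over (Spec R)} (x : T ⟶ Q.total) (hx : ⊤ ≤ (x ≫ Q.proj).left ⁻¹ᵁ V a) :
      IsUnit ((M a).val x hx) := by
    refine (M a).isUnit he hN (fun τ hτ x hx => ?_) x hx
    rw [hM a τ hτ]
    exact (hmu a x hx).map (powHom p _ (natCast_eq_zero_of_hom hp τ)).mapMatrix
  choose t' ht' using exists_transition M hMu
  have hcancel (a) {T : Over (Spec R)} (x : T ⟶ Q.total)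
      (hx : ⊤ ≤ (x ≫ Q.proj).left ⁻¹ᵁ V a) {c d : Matrix (Fin n) (Fin n) Γ(T.left, ⊤)}
      (h : (M a).val x hx * c = (M a).val x hx * d) : c = d := (hMu a x hx).mul_left_cancel h
  -- Checked at points of `Q`, where `t'_ab = M_a⁻¹ M_b` makes the cocycle condition formal after
  -- multiplying by the invertible `M_a`.
  have hcoc : IsCocycle V t' := by
    refine ⟨fun a => ?_, fun a b c O ha hb hc => ?_⟩
    · refine Q.matrix_ext (𝟙 _) _ fun {T} x c hcx hc => ?_
      obtain rfl : c = (x ≫ Q.proj).left := (Category.comp_id c).symm.trans hcx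
      refine hcancel a x (top_le_preimage_left hc) ?_
      rw [← ht' a a x (top_le_preimage_left hc) (top_le_preimage_right hc),
        Matrix.map_one _ (map_zero _) (map_one _), mul_one]
    · refine Q.matrix_ext (𝟙 _) _ fun {T} x z hzx hz => ?_
      obtain rfl : z = (x ≫ Q.proj).left := (Category.comp_id z).symm.trans hzx
      have hxa := hz.trans (Scheme.Hom.preimage_mono _ ha)
      have hxb := hz.trans (Scheme.Hom.preimage_mono _ hb)
      have hxc := hz.trans (Scheme.Hom.preimage_mono _ hc)
      have hr {a b : X.left} (ha : O ≤ V a) (hb : O ≤ V b) :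
          ((t' a b).map (res X.left (le_inf ha hb))).map (evalOn (x ≫ Q.proj).left hz) =
          (t' a b).map (evalOn (x ≫ Q.proj).left (top_le_preimage_inf
            (hz.trans (Scheme.Hom.preimage_mono _ ha))
            (hz.trans (Scheme.Hom.preimage_mono _ hb)))) := by
        ext k l
        exact evalOn_res (le_inf ha hb) _ hz _
      refine hcancel a x hxa ?_
      rw [Matrix.map_mul, hr ha hc, hr ha hb, hr hb hc, ← mul_assoc, ← ht' a b x hxa hxb,
        ← ht' b c x hxb hxc, ← ht' a c x hxa hxc]
  -- On the closed fibre `M_a` is the entrywise `p`-th power of `m_a`; cancelling it from the `p`-th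
  -- power of `m_b = m_a t_ab` gives the claim.
  have hred (a b) : (t' a b).map (i.app (V a ⊓ V b)) =
      ((t a b).map (i.app (V a ⊓ V b))).map (· ^ p) := by
    refine Q.matrix_ext i _ fun {T} x c hcx hc => ?_
    have hx : ⊤ ≤ (x ≫ Q.proj).left ⁻¹ᵁ (V a ⊓ V b) := by
      rw [← hcx]
      exact hc
    have hτ : (c ≫ q₀) ≫ Spec.map e = T.hom := by
      rw [Category.assoc, ← hi.w, reassoc_of% hcx, Over.w]
    have he (r : Matrix (Fin n) (Fin n) Γ(X.left, V a ⊓ V b)) :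
        (r.map (i.app (V a ⊓ V b))).map (evalOn c hc) = r.map (evalOn (x ≫ Q.proj).left hx) := by
      ext k l
      exact evalOn_app i c hc hcx hx _
    have hxa := top_le_preimage_left hx
    have hxb := top_le_preimage_right hx
    refine hcancel a x hxa ?_
    rw [map_pow_map (evalOn c hc), he, he, ← ht' a b x hxa hxb, hM b _ hτ, hM a _ hτ,
      ← map_pow_mul p (natCast_eq_zero_of_hom hp (c ≫ q₀)), ← hmt a b x hxa hxb]
  obtain ⟨E', f', hf', hE'⟩ := exists_isFrame_of_isCocycle hcoc
  refine ⟨E', fun x => ?_, ?_⟩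
  · obtain ⟨a, ha⟩ := TopologicalSpace.Opens.mem_iSup.1 (hV ▸ trivial : x ∈ ⨆ a, V a)
    exact ⟨V a, ha, f' a, hf' a⟩
  -- Both modules are glued along the same cocycle, since absolute Frobenius is the identity on
  -- opens and the `p`-th power on sections.
  · have h₁ := (isGlued_of_isFrame hV hf' hE').pullback i
    have h₂ := ((isGlued_of_isFrame hV hf ht).pullback i).pullback (absFrobenius p X₀ hX₀)
    exact (h₁.congr hred).nonempty_iso h₂

end FrobBundle

namespace FrobBundle

/-! ### Representations and liftings of the Frobenius homomorphism -/

/-- Both matrices are values of `π` at points of `G`, and these points differ by the endomorphism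
`c` of `T`. Naturality of `π` along `c` concludes; in the application `c` is the absolute Frobenius.
-/
theorem repMatrix_baseChangeRep {B S : Scheme.{u}} (f : S ⟶ B) (φ : B ⟶ B) {G : Over B} [GrpObj G]
    {n : ℕ} (π : yonedaGrpObj G ⟶ GLFunctor n B) {T : Over S}
    (g : T ⟶ (Over.pullback f).obj G)
    (g' : T ⟶ (Over.pullback f).obj ((Over.pullback φ).obj G)) (c : T.left ⟶ T.left)
    (hc : c ≫ T.hom ≫ f = (T.hom ≫ f) ≫ φ)
    (hg : (g'.left ≫ pullback.fst (pullback.snd G.hom φ) f) ≫ pullback.fst G.hom φ =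
      c ≫ g.left ≫ pullback.fst G.hom f) :
    (repMatrix (baseChangeRep f (baseChangeRep φ π)) g').val =
      (repMatrix (baseChangeRep f π) g).val.map c.appTop := by
  let c' : (Over.map φ).obj ((Over.map f).obj T) ⟶ (Over.map f).obj T := Over.homMk c hc
  have e : transpose φ (transpose f g') = c' ≫ transpose f g := by
    ext1
    refine (transpose_left φ _).trans ?_
    refine (congrArg (· ≫ pullback.fst G.hom φ) (transpose_left f g')).trans (hg.trans ?_)
    exact congrArg (c ≫ ·) (transpose_left f g).symm
  change (repMatrix π (transpose φ (transpose f g'))).val = _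
  rw [e]
  exact repMatrix_comp π c' (transpose f g)

section

variable {p : ℕ} [Fact p.Prime] {k : Type u} [Field k] [CharP k p] {A : Type u} [CommRing A]
  [Algebra (WittVector p k) A] {ε : A →+* k}
  (hε : ε.comp (algebraMap (WittVector p k) A) = WittVector.constantCoeff)
  {G : Over (Spec (.of (WittVector p k)))}

theorem relFrobenius_left_fst (X : Over (Spec (.of k))) :
    (relFrobenius p X).left ≫ pullback.fst X.hom (frobPoint p) =
      absFrobenius p X.left (natCast_section_over p X) :=
  (transpose_left (frobPoint p) (relFrobenius p X)).symm.trans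
    congr(($(transpose_relFrobenius p X)).left)

theorem twistFibreIncl_left_fst_fst :
    ((twistFibreIncl hε G).left ≫ pullback.fst (pullback.snd G.hom (frobWitt p)) (specAlg p A)) ≫
      pullback.fst G.hom (frobWitt p) =
    pullback.fst (pullback.snd G.hom (closedPoint p)) (frobPoint p) ≫
      pullback.fst G.hom (closedPoint p) := by
  have e₁ : (twistFibreIncl hε G).left ≫ pullback.fst (wittTwist p G).hom (specAlg p A) =
      pullback.lift _ _ (twistFibreIncl_aux G) := pullback.lift_fst _ _ _
  exact (congrArg (· ≫ pullback.fst G.hom (frobWitt p)) e₁).trans (pullback.lift_fst _ _ _)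

variable {hε} [GrpObj G]

/-- A point of `G_A` on a scheme over `k` factors through the special fibre, where `F` is the
relative Frobenius; projecting the twist back to `G` turns this into the absolute Frobenius, which
moves to the source by naturality. -/
theorem IsFrobeniusLifting.left_fst_fst {F : overAlg p A G ⟶ overAlg p A (wittTwist p G)}
    (hF : IsFrobeniusLifting hε F) {T : Over (Spec (.of A))} (τ : T.left ⟶ Spec (.of k))
    (hτ : τ ≫ specRes ε = T.hom) (hT : (p : Γ(T.left, ⊤)) = 0) (g : T ⟶ overAlg p A G) :
    ((g ≫ F).left ≫ pullback.fst (pullback.snd G.hom (frobWitt p)) (specAlg p A)) ≫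
      pullback.fst G.hom (frobWitt p) =
    absFrobenius p T.left hT ≫ g.left ≫ pullback.fst G.hom (specAlg p A) := by
  have hw : g.left ≫ pullback.snd G.hom (specAlg p A) = T.hom := Over.w g
  have e₀ : (g.left ≫ pullback.fst G.hom (specAlg p A)) ≫ G.hom = τ ≫ closedPoint p := by
    rw [Category.assoc, pullback.condition, reassoc_of% hw, ← hτ, Category.assoc,
      specRes_specAlg hε]
  let g₀ : T.left ⟶ (specialFibre p G).left :=
    pullback.lift (g.left ≫ pullback.fst G.hom (specAlg p A)) τ e₀
  have h₁ : g₀ ≫ pullback.fst G.hom (closedPoint p) = g.left ≫ pullback.fst G.hom (specAlg p A) :=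
    pullback.lift_fst _ _ _
  have h₂ : g₀ ≫ pullback.snd G.hom (closedPoint p) = τ := pullback.lift_snd _ _ _
  have hg : g.left = g₀ ≫ (fibreIncl hε G).left := by
    refine pullback.hom_ext ?_ ?_
    · refine Eq.trans h₁.symm ?_
      rw [Category.assoc]
      exact congrArg (g₀ ≫ ·) (pullback.lift_fst _ _ _).symm
    · refine hw.trans ?_
      rw [← hτ, ← h₂, Category.assoc, Category.assoc]
      exact congrArg (g₀ ≫ ·) (pullback.lift_snd _ _ _).symm
  have e₁ : (fibreIncl hε G).left ≫ F.left =
      (relFrobenius p (specialFibre p G)).left ≫ (twistFibreIncl hε G).left :=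
    congr(($(hF.restrict)).left)
  have e₂ : (g ≫ F).left =
      g₀ ≫ (relFrobenius p (specialFibre p G)).left ≫ (twistFibreIncl hε G).left := by
    rw [Over.comp_left, hg, Category.assoc, e₁]
  have e₃ := twistFibreIncl_left_fst_fst hε (G := G)
  have e₄ := relFrobenius_left_fst (p := p) (specialFibre p G)
  have e₅ : g₀ ≫ absFrobenius p (specialFibre p G).left (natCast_section_over p _) =
      absFrobenius p T.left hT ≫ g₀ := absFrobenius_naturality p g₀ _ _
  rw [e₂, Category.assoc, Category.assoc, Category.assoc]
  rw [Category.assoc] at e₃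
  refine (congrArg (fun z => g₀ ≫ (relFrobenius p (specialFibre p G)).left ≫ z) e₃).trans ?_
  refine (congrArg (fun z => g₀ ≫ z) ((Category.assoc _ _ _).symm.trans
    (congrArg (· ≫ pullback.fst G.hom (closedPoint p)) e₄))).trans ?_
  rw [← h₁]
  exact (Category.assoc _ _ _).symm.trans
    ((congrArg (· ≫ pullback.fst G.hom (closedPoint p)) e₅).trans (Category.assoc _ _ _))

/-- On schemes over `k` the twisted representation composed with `F` is `π` followed by Frobenius on
matrix entries. This is the compatibility between `ρ` and `ρ'` required for lifting `p`-th powers.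
-/
theorem IsFrobeniusLifting.repMatrix_eq {F : overAlg p A G ⟶ overAlg p A (wittTwist p G)}
    (hF : IsFrobeniusLifting hε F) {n : ℕ}
    (π : yonedaGrpObj G ⟶ GLFunctor n (Spec (.of (WittVector p k)))) {T : Over (Spec (.of A))}
    (τ : T.left ⟶ Spec (.of k)) (hτ : τ ≫ specRes ε = T.hom) (g : T ⟶ overAlg p A G) :
    (repMatrix (baseChangeRep (specAlg p A) (baseChangeRep (frobWitt p) π)) (g ≫ F)).val =
      (repMatrix (baseChangeRep (specAlg p A) π) g).val.map (· ^ p) := by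
  have hT : (p : Γ(T.left, ⊤)) = 0 := natCast_section_over p (Over.mk τ)
  refine (repMatrix_baseChangeRep (specAlg p A) (frobWitt p) π g (g ≫ F) (absFrobenius p T.left hT)
    ?_ (hF.left_fst_fst τ hτ hT g)).trans rfl
  have e : absFrobenius p T.left hT ≫ τ = τ ≫ frobPoint p := absFrobenius_comp (Over.mk τ) hT
  have e' : T.hom ≫ specAlg p A = τ ≫ closedPoint p := by
    rw [← hτ, Category.assoc, specRes_specAlg hε]
  rw [e', reassoc_of% e, Category.assoc, closedPoint_frobWitt]

theorem exists_module_lift [IsLocalRing A] [IsArtinianRing A]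
    {F : overAlg p A G ⟶ overAlg p A (wittTwist p G)} (hF : IsFrobeniusLifting hε F)
    {X : Over (Spec (.of k))} {XA : Over (Spec (.of A))}
    {i : (Over.map (specRes ε)).obj X ⟶ XA} (hi : IsDeformation ε i) {n : ℕ}
    (π : yonedaGrpObj G ⟶ GLFunctor n (Spec (.of (WittVector p k))))
    {E : XA.left.Modules} (hE : IsVectorBundle n E)
    (hred : HasReduction (baseChangeRep (specAlg p A) π) E) :
    ∃ E' : XA.left.Modules, IsVectorBundle n E' ∧
      Nonempty ((Scheme.Modules.pullback i.left).obj E' ≅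
        (Scheme.Modules.pullback (overFrobenius p X).left).obj
          ((Scheme.Modules.pullback i.left).obj E)) := by
  have := hF.isMonHom
  obtain ⟨m, hm⟩ := exists_ker_pow_eq_bot ε
  exact exists_frobenius_lift_of_hasReduction (e := CommRingCat.ofHom ε) p
    (CharP.cast_eq_zero k p) (augmentation_surjective hε) hm hi.isPullback
    (natCast_section_over p X) (baseChangeRep (specAlg p A) π)
    (compRep F (baseChangeRep (specAlg p A) (baseChangeRep (frobWitt p) π)))
    (fun τ hτ g => hF.repMatrix_eq π τ hτ g) hE hred

end

end FrobBundle

end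

/-- Liftings of the Frobenius homomorphism of a group scheme and Frobenius pullbacks of principal
bundles and of vector bundles with a reduction of structure group. -/
theorem mainTheorem5 {p : ℕ} [Fact p.Prime] {k : Type u} [Field k] [CharP k p] [PerfectRing k p]
    (G : Over (Spec (.of (WittVector p k)))) [GrpObj G]
    (A : Type u) [CommRing A] [IsLocalRing A] [IsArtinianRing A] [Algebra (WittVector p k) A]
    (ε : A →+* k) (hε : ε.comp (algebraMap (WittVector p k) A) = WittVector.constantCoeff)
    (F : overAlg p A G ⟶ overAlg p A (wittTwist p G)) (hF : IsFrobeniusLifting hε F)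
    (X : Over (Spec (.of k))) (XA : Over (Spec (.of A)))
    (i : (Over.map (specRes ε)).obj X ⟶ XA) (hi : IsDeformation ε i) :
    (∀ (P : PrincipalBundle (specialFibre p G) X) (PA : PrincipalBundle (overAlg p A G) XA),
      PrincipalBundle.IsPullbackOf (specRes ε) (fibreIncl hε G) i P PA →
      ∃ PA' : PrincipalBundle (overAlg p A (wittTwist p G)) XA,
        PrincipalBundle.IsPullbackOf (specRes ε) (twistFibreIncl hε G) i
          (P.frobeniusPullback p) PA') ∧
    (∀ (n : ℕ) (π : yonedaGrpObj G ⟶ GLFunctor n (Spec (.of (WittVector p k))))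
      (E : XA.left.Modules), IsVectorBundle n E →
      HasReduction (baseChangeRep (specAlg p A) π) E →
      ∃ E' : XA.left.Modules, IsVectorBundle n E' ∧
        Nonempty ((Scheme.Modules.pullback i.left).obj E' ≅
          (Scheme.Modules.pullback (overFrobenius p X).left).obj
            ((Scheme.Modules.pullback i.left).obj E))) := by
  exact ⟨fun P PA h => exists_bundle_lift hε hF hi P PA h,
    fun n π E hE hred => exists_module_lift hF hi π hE hred⟩
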